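/- Let $d\in\mathbb N$, $T>0$, $1<p<\infty$, and let $\mathbb T^d=\mathbb R^d/\mathbb Z^d$. Let $u:(0,T)\times\mathbb T^d\to\mathbb R^d$ be a vector field with $$u\in L^1(0,T;W^{1,p}(\mathbb T^d))^d\cap L^\infty((0,T)\times\mathbb T^d)^d,$$ and suppose that the negative part of its divergence satisfies $\operatorname{div}(u)^-\in L^\infty((0,T)\times\mathbb T^d)$ if $p\le d$, and $\operatorname{div}(u)^-\in L^1(0,T;L^\infty(\mathbb T^d))$ if $p>d$. Let $\Phi$ be a regular Lagrangian flow of $u$ on $[0,T]$, that is: for a.e. $x$ the curve $t\mapsto\Phi(t,x)$ is an absolutely continuous solution of $\partial_t\Phi(t,x)=u(t,\Phi(t,x))$, $\Phi(0,x)=x$, and there is $L>0$ with $\Phi(t,\cdot)_\#\mathscr L^d\le L\,\mathscr L^d$ for all $t\in[0,T]$. For a mollifier $\eta$ (that is, $\eta\in C_c^\infty(\mathbb R^d)$, $\eta\ge0$, supported in the closed unit ball, $\int\eta=1$) and $\delta>0$ let $\eta_\delta(x)=\delta^{-d}\eta(x/\delta)$ and $u_\delta(t,\cdot)=\eta_\delta*u(t,\cdot)$,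 and let $\Phi_\delta$ be the classical flow of $u_\delta$, that is, for every $x$ the curve $t\mapsto\Phi_\delta(t,x)$ is the absolutely continuous solution of $\partial_t\Phi_\delta=u_\delta(t,\Phi_\delta)$, $\Phi_\delta(0,x)=x$. Flows on $\mathbb T^d$ are identified with their lifts to $\mathbb R^d$, with both lifts starting at the same point $x$ at time $0$, so that $|\Phi-\Phi_\delta|$ is the Euclidean distance of the lifts. Put $$E_\delta(t)=\|u-u_\delta\|_{L^1(0,t;L^p(\mathbb T^d))}.$$ Then there are a function $t\mapsto C_t\ge0$ with $C_t\to0$ as $t\to0^+$ and constants $A>0$, $\delta_0\in(0,1)$, all independent of $\delta$ and $\eta$ (and $A,\delta_0$ independent of $t$), such that for every mollifier $\eta$, every $\delta>0$ and every $t\in[0,T]$: 1. if $E_\delta(t)\ne1$, then $\|\Phi(t,\cdot)-\Phi_\delta(t,\cdot)\|_{L^p(\mathbb T^d)}\le C_t\,\bigl|\log E_\delta(t)\bigr|^{-1}$, where the right-hand side is read as $0$ if $E_\delta(t)=0$; 2. if $\delta<\delta_0$, then $E_\delta(t)<1$ and $\bigl|\log E_\delta(t)\bigr|^{-1}\le A\,|\log\delta|^{-1}$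 (with the same convention if $E_\delta(t)=0$); 3. if $\delta<1$, then $\|\Phi(t,\cdot)-\Phi_\delta(t,\cdot)\|_{L^p(\mathbb T^d)}\le A\,C_t\,|\log\delta|^{-1}$. -/

import Mathlib

open MeasureTheory Set Filter Topology
open scoped ENNReal NNReal Convolution

noncomputable section

namespace TorusFlow

/-- The space `ℝ^d` with its Euclidean norm. -/
abbrev Space (d : ℕ) : Type := EuclideanSpace ℝ (Fin d)

/-- The `i`-th vector of the standard basis. -/
abbrev basisVec {d : ℕ} (i : Fin d) : Space d := EuclideanSpace.single i (1 : ℝ)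

/-- Functions on the torus `𝕋^d = ℝ^d / ℤ^d` are the `ℤ^d`-periodic functions on `ℝ^d`. -/
def IsPeriodic {d : ℕ} {F : Type*} (f : Space d → F) : Prop :=
  ∀ (i : Fin d) (x : Space d), f (x + basisVec i) = f x

/-- The unit cube `[0,1)^d`, a fundamental domain of the torus. -/
def unitCube (d : ℕ) : Set (Space d) := {x | ∀ i, x i ∈ Ico (0 : ℝ) 1}

/-- Lebesgue measure on the torus, realised on the fundamental domain. For a periodic `f`,
`eLpNorm f p (torusMeasure d)` is the norm of `f` in `L^p(𝕋^d)`. -/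
def torusMeasure (d : ℕ) : Measure (Space d) := volume.restrict (unitCube d)

/-- Lebesgue measure on `(0,T) × 𝕋^d`. -/
def spaceTimeMeasure (d : ℕ) (T : ℝ) : Measure (ℝ × Space d) :=
  (volume.restrict (Ioo 0 T)).prod (torusMeasure d)

/-- `g` is the gradient of `f` in the sense of distributions: for every test function `φ` and
every direction `e`, `∫ ∂_e φ f = - ∫ φ (g e)`. -/
def IsWeakGradient {d : ℕ} (f : Space d → Space d) (g : Space d → Space d →L[ℝ] Space d) : Prop :=
  LocallyIntegrable f volume ∧ LocallyIntegrable g volume ∧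
    ∀ φ : Space d → ℝ, ContDiff ℝ ((⊤ : ℕ∞) : WithTop ℕ∞) φ → HasCompactSupport φ →
      ∀ e : Space d, ∫ x, (fderiv ℝ φ x e) • f x = - ∫ x, φ x • (g x e)

/-- `Du` is the spatial gradient of `u` and `u ∈ L^1(0,T; W^{1,p}(𝕋^d))`. -/
structure IsSobolevGradient {d : ℕ} (T p : ℝ) (u : ℝ → Space d → Space d)
    (Du : ℝ → Space d → Space d →L[ℝ] Space d) : Prop where
  periodic : ∀ t, IsPeriodic (Du t)
  measurable_u : AEStronglyMeasurable (Function.uncurry u) (spaceTimeMeasure d T)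
  measurable_Du : AEStronglyMeasurable (Function.uncurry Du) (spaceTimeMeasure d T)
  weakGradient : ∀ᵐ t ∂(volume.restrict (Ioo 0 T)), IsWeakGradient (u t) (Du t)
  norm_finite :
    ∫⁻ t in Ioo 0 T, (eLpNorm (u t) (ENNReal.ofReal p) (torusMeasure d)
      + eLpNorm (Du t) (ENNReal.ofReal p) (torusMeasure d)) < ⊤

/-- The negative part of the divergence (the trace of the gradient). -/
def divNeg {d : ℕ} (Du : ℝ → Space d → Space d →L[ℝ] Space d) (t : ℝ) (x : Space d) : ℝ :=
  max (-∑ i : Fin d, (Du t x (basisVec i)) i) 0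

/-- The standing assumptions on the velocity field `u` on `(0,T) × 𝕋^d`:
`u ∈ L^1(0,T; W^{1,p}) ∩ L^∞`, and the negative part of `div u` is in `L^∞((0,T) × 𝕋^d)` if
`p ≤ d` and in `L^1(0,T; L^∞(𝕋^d))` if `p > d`. -/
structure IsAdmissible {d : ℕ} (T p : ℝ) (u : ℝ → Space d → Space d) : Prop where
  periodic : ∀ t, IsPeriodic (u t)
  bounded : MemLp (Function.uncurry u) ⊤ (spaceTimeMeasure d T)
  sobolev : ∃ Du : ℝ → Space d → Space d →L[ℝ] Space d, IsSobolevGradient T p u Du ∧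
    (p ≤ d → MemLp (Function.uncurry (divNeg Du)) ⊤ (spaceTimeMeasure d T)) ∧
    ((d : ℝ) < p → ∫⁻ t in Ioo 0 T, eLpNorm (divNeg Du t) ⊤ (torusMeasure d) < ⊤)

/-- `y` is an absolutely continuous solution on `[0,T]` of `y' = v(t,y)`, `y(0) = x`. -/
def IsACSolution {d : ℕ} (T : ℝ) (v : ℝ → Space d → Space d) (x : Space d) (y : ℝ → Space d) :
    Prop :=
  AbsolutelyContinuousOnInterval y 0 T ∧ y 0 = x ∧
    ∀ᵐ t ∂(volume.restrict (Ioo 0 T)), HasDerivAt y (v t (y t)) t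

/-- `Φ` is a regular Lagrangian flow of `u` on the torus, written as a map of `ℝ^d` that commutes
with the translations by `ℤ^d`. -/
structure IsRegularLagrangianFlow {d : ℕ} (T : ℝ) (u : ℝ → Space d → Space d)
    (Φ : ℝ → Space d → Space d) : Prop where
  equivariant : ∀ t ∈ Icc 0 T, ∀ᵐ x : Space d, ∀ i : Fin d,
    Φ t (x + basisVec i) = Φ t x + basisVec i
  solution : ∀ᵐ x : Space d, IsACSolution T u x (fun t => Φ t x)
  measurable : ∀ t ∈ Icc 0 T, AEMeasurable (Φ t) volume
  compressibility : ∃ L : ℝ≥0, 0 < L ∧ ∀ t ∈ Icc 0 T,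
    (volume : Measure (Space d)).map (Φ t) ≤ L • (volume : Measure (Space d))

/-- `Φ` is the flow of `v` in the classical sense: every trajectory solves the equation. -/
def IsClassicalFlow {d : ℕ} (T : ℝ) (v : ℝ → Space d → Space d)
    (Φ : ℝ → Space d → Space d) : Prop :=
  ∀ x : Space d, IsACSolution T v x (fun t => Φ t x)

/-- A mollifier on `ℝ^d`: smooth, nonnegative, supported in the closed unit ball, of integral 1. -/
structure IsMollifier {d : ℕ} (η : Space d → ℝ) : Prop where
  smooth : ContDiff ℝ ((⊤ : ℕ∞) : WithTop ℕ∞) η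
  nonneg : ∀ x, 0 ≤ η x
  support : tsupport η ⊆ Metric.closedBall 0 1
  integral_eq_one : ∫ x, η x = 1

/-- `η_δ(x) = δ^{-d} η(x/δ)`. -/
def rescale {d : ℕ} (η : Space d → ℝ) (δ : ℝ) (x : Space d) : ℝ :=
  (δ ^ d)⁻¹ * η (δ⁻¹ • x)

/-- `u_δ(t,·) = η_δ * u(t,·)`, convolution in space only. -/
def regularise {d : ℕ} (η : Space d → ℝ) (δ : ℝ) (u : ℝ → Space d → Space d) :
    ℝ → Space d → Space d :=
  fun t => rescale η δ ⋆[ContinuousLinearMap.lsmul ℝ ℝ, volume] u t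

/-- The norm of `w` in `L^1(0,t; L^p(𝕋^d))`. -/
def normL1Lp {d : ℕ} (p t : ℝ) (w : ℝ → Space d → Space d) : ℝ≥0∞ :=
  ∫⁻ s in Ioo 0 t, eLpNorm (w s) (ENNReal.ofReal p) (torusMeasure d)

end TorusFlow

end

namespace TorusFlow

/-! The argument is the logarithmic Grönwall method of Crippa and De Lellis. For r > 0 consider ½
log(1 + |Φ - Φδ|²/r²) along a pair of trajectories with the same initial point. Writing u(Φ) -
u_δ(Φδ) = (u - u_δ)(Φ) + (u_δ(Φ) - u_δ(Φδ)), its time derivative is at most |u - u_δ|(Φ)/r plus a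
difference quotient of u_δ, and the latter is bounded by 4^d (M|∇u_δ|(Φ) + M|∇u_δ|(Φδ)), with M a
local maximal function (`enorm_sub_le_maximalFunction`). Since u_δ is smooth in space, this holds at
every point, without exceptional sets.

Take L^p norms in x. Minkowski's integral inequality, the bounded compression of both flows, the
strong-type maximal estimate and ‖∇u_δ‖_p ≤ ‖∇u‖_p give a bound c (E_δ(t)/r + ‖∇u‖_{L¹L^p})
(`exists_lintegral_log_rpow_le`). For r = E_δ(t) this is a constant independent of δ and η. The
compression of Φδ must not depend on the Lipschitz constant of u_δ: it is controlled by div(u)^-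
alone, through a one-sided Liouville theorem obtained from the Euler scheme
(`volume_preimage_flow_le`).

Since u is bounded, |Φ - Φδ| ≤ s with s = S t. By concavity of the logarithm, a bound on log(1 + |Φ
- Φδ|/r) yields ‖Φ - Φδ‖_p ≤ (B + 1) s / log(1 + s/r) (`eLpNorm_le_of_log_le`). As also E_δ(t) ≤ s,
replacing log(1 + s/E_δ) by |log E_δ| costs only the factor s + |s log s|/log 2 in place of s
(`div_log_one_add_le`). This factor vanishes as t → 0, and is C_t up to the constant B + 1.

The second claim follows from E_δ ≤ δ ‖∇u‖_{L¹L^p}, so that E_δ < √δ for small δ. The third follows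
from the first two for small δ, and from |Φ - Φδ| ≤ S t ≤ C_t for the others. -/

/-! ### Absolutely continuous curves and the logarithmic Grönwall estimate -/

theorem absolutelyContinuousOnInterval_of_dist_le {X Y : Type*} [PseudoMetricSpace X]
    [PseudoMetricSpace Y] {f : ℝ → X} {g : ℝ → Y} {a b K : ℝ}
    (hf : AbsolutelyContinuousOnInterval f a b)
    (h : ∀ x ∈ uIcc a b, ∀ y ∈ uIcc a b, dist (g x) (g y) ≤ K * dist (f x) (f y)) :
    AbsolutelyContinuousOnInterval g a b := by
  unfold AbsolutelyContinuousOnInterval at hf ⊢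
  have h0 := hf.const_mul K
  rw [mul_zero] at h0
  refine squeeze_zero' (Eventually.of_forall fun E => Finset.sum_nonneg fun _ _ => dist_nonneg)
    ?_ h0
  refine eventually_inf_principal.2 (Eventually.of_forall fun E hE => ?_)
  rw [Finset.mul_sum]
  exact Finset.sum_le_sum fun i hi => h _ (hE.1 i hi).1 _ (hE.1 i hi).2

/-- The increment of an absolutely continuous function is at most the integral of the positive
part of its derivative. -/
theorem ofReal_sub_le_lintegral {f f' : ℝ → ℝ} {T a b : ℝ}
    (hf : AbsolutelyContinuousOnInterval f 0 T)
    (hd : ∀ᵐ t ∂(volume.restrict (Ioo 0 T)), HasDerivAt f (f' t) t)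
    (ha : 0 ≤ a) (hab : a ≤ b) (hb : b ≤ T) :
    ENNReal.ofReal (f b - f a) ≤ ∫⁻ t in Ioo a b, ENNReal.ofReal (f' t) := by
  have hT : 0 ≤ T := ha.trans (hab.trans hb)
  have hfab : AbsolutelyContinuousOnInterval f a b := hf.mono (by
    rw [uIcc_of_le hab, uIcc_of_le hT]; exact Icc_subset_Icc ha hb)
  have hd' : ∀ᵐ t ∂(volume.restrict (Ioo a b)), HasDerivAt f (f' t) t :=
    ae_restrict_of_ae_restrict_of_subset (Ioo_subset_Ioo ha hb) hd
  rw [← hfab.integral_deriv_eq_sub, intervalIntegral.integral_of_le hab,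
    integral_Ioc_eq_integral_Ioo]
  have hi : Integrable (deriv f) (volume.restrict (Ioo a b)) :=
    ((intervalIntegrable_iff_integrableOn_Ioo_of_le hab).1 hfab.intervalIntegrable_deriv)
  calc ENNReal.ofReal (∫ t in Ioo a b, deriv f t)
      ≤ ENNReal.ofReal (∫ t in Ioo a b, max (deriv f t) 0) :=
        ENNReal.ofReal_le_ofReal (integral_mono hi hi.pos_part fun t => le_max_left _ _)
    _ = ∫⁻ t in Ioo a b, ENNReal.ofReal (max (deriv f t) 0) :=
        ofReal_integral_eq_lintegral_ofReal hi.pos_part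
          (Eventually.of_forall fun t => le_max_right _ _)
    _ ≤ _ := by
        refine lintegral_mono_ae ?_
        filter_upwards [hd'] with t ht
        rw [ht.deriv, ENNReal.ofReal_max, ENNReal.ofReal_zero, max_eq_left zero_le]

/-- Pairing the curve with the unit vector along its own increment reduces this to the scalar case
`ofReal_sub_le_lintegral`. -/
theorem enorm_sub_le_lintegral {E : Type*} [NormedAddCommGroup E] [InnerProductSpace ℝ E]
    {y y' : ℝ → E} {T a b : ℝ}
    (hf : AbsolutelyContinuousOnInterval y 0 T)
    (hd : ∀ᵐ t ∂(volume.restrict (Ioo 0 T)), HasDerivAt y (y' t) t)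
    (ha : 0 ≤ a) (hab : a ≤ b) (hb : b ≤ T) :
    ‖y b - y a‖ₑ ≤ ∫⁻ t in Ioo a b, ‖y' t‖ₑ := by
  by_cases h0 : y b - y a = 0
  · simp [h0]
  set e : E := ‖y b - y a‖⁻¹ • (y b - y a)
  have he : ‖e‖ = 1 := norm_smul_inv_norm (𝕜 := ℝ) h0
  have hin : ∀ z : E, inner ℝ e z ≤ ‖z‖ := fun z => by
    simpa [he] using real_inner_le_norm e z
  have hac : AbsolutelyContinuousOnInterval (fun t => inner ℝ e (y t)) 0 T :=
    absolutelyContinuousOnInterval_of_dist_le (K := 1) hf fun s _ t _ => by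
      rw [Real.dist_eq, ← inner_sub_right, one_mul, dist_eq_norm]
      simpa [he] using abs_real_inner_le_norm e (y s - y t)
  have hder : ∀ᵐ t ∂(volume.restrict (Ioo 0 T)),
      HasDerivAt (fun t => inner ℝ e (y t)) (inner ℝ e (y' t)) t := by
    filter_upwards [hd] with t ht
    exact (innerSL ℝ e).hasFDerivAt.comp_hasDerivAt t ht
  have := ofReal_sub_le_lintegral hac hder ha hab hb
  rw [← inner_sub_right] at this
  have h1 : inner ℝ e (y b - y a) = ‖y b - y a‖ := by
    simp only [e, real_inner_smul_left, real_inner_self_eq_norm_sq]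
    have : ‖y b - y a‖ ≠ 0 := norm_ne_zero_iff.2 h0
    field_simp
  rw [h1, ofReal_norm] at this
  refine this.trans (lintegral_mono fun t => ?_)
  rw [← ofReal_norm]
  exact ENNReal.ofReal_le_ofReal (hin _)

theorem norm_sub_le_of_ae_norm_le {E : Type*} [NormedAddCommGroup E] [InnerProductSpace ℝ E]
    {y y' : ℝ → E} {T a b K : ℝ} (hK : 0 ≤ K)
    (hf : AbsolutelyContinuousOnInterval y 0 T)
    (hd : ∀ᵐ t ∂(volume.restrict (Ioo 0 T)), HasDerivAt y (y' t) t)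
    (hy' : ∀ᵐ t ∂(volume.restrict (Ioo 0 T)), ‖y' t‖ ≤ K)
    (ha : 0 ≤ a) (hab : a ≤ b) (hb : b ≤ T) :
    ‖y b - y a‖ ≤ K * (b - a) := by
  have h := enorm_sub_le_lintegral hf hd ha hab hb
  have h2 : ∫⁻ t in Ioo a b, ‖y' t‖ₑ ≤ ∫⁻ t in Ioo a b, ENNReal.ofReal K := by
    refine lintegral_mono_ae ?_
    filter_upwards [ae_restrict_of_ae_restrict_of_subset (Ioo_subset_Ioo ha hb) hy'] with t ht
    rw [← ofReal_norm]
    exact ENNReal.ofReal_le_ofReal ht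
  rw [lintegral_const, Measure.restrict_apply_univ, Real.volume_Ioo,
    ← ENNReal.ofReal_mul hK] at h2
  rw [← ofReal_norm] at h
  exact (ENNReal.ofReal_le_ofReal_iff (mul_nonneg hK (sub_nonneg.2 hab))).1 (h.trans h2)

/-- The logarithmic Grönwall estimate of Crippa and De Lellis along a single trajectory. -/
theorem ofReal_log_le_lintegral {E : Type*} [NormedAddCommGroup E] [InnerProductSpace ℝ E]
    {y y' : ℝ → E} {T t r : ℝ} {α β : ℝ → ℝ≥0∞} (hr : 0 < r)
    (hf : AbsolutelyContinuousOnInterval y 0 T) (h0 : y 0 = 0)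
    (hd : ∀ᵐ t ∂(volume.restrict (Ioo 0 T)), HasDerivAt y (y' t) t)
    (hb : ∀ᵐ t ∂(volume.restrict (Ioo 0 T)), ‖y' t‖ₑ ≤ α t + β t * ‖y t‖ₑ)
    (ht : t ∈ Icc 0 T) :
    ENNReal.ofReal (1 / 2 * Real.log (1 + ‖y t‖ ^ 2 / r ^ 2)) ≤
      ∫⁻ s in Ioo 0 t, (α s / ENNReal.ofReal r + β s) := by
  have hn : AbsolutelyContinuousOnInterval (fun t => ‖y t‖) 0 T :=
    absolutelyContinuousOnInterval_of_dist_le (K := 1) hf fun s _ t _ => by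
      rw [one_mul, dist_eq_norm (y s)]; exact abs_norm_sub_norm_le _ _
  -- On nonnegative reals a ↦ log(1 + a/r²) is Lipschitz with constant 1/r², so composing it with
  -- ‖y‖² preserves absolute continuity.
  have hlog : ∀ a b : ℝ, 0 ≤ a → 0 ≤ b →
      |Real.log (1 + a / r ^ 2) - Real.log (1 + b / r ^ 2)| ≤ 1 / r ^ 2 * |a - b| := by
    have key : ∀ a b : ℝ, 0 ≤ a → 0 ≤ b →
        Real.log (1 + a / r ^ 2) - Real.log (1 + b / r ^ 2) ≤ 1 / r ^ 2 * |a - b| := by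
      intro a b ha hb
      have h1 : 0 < 1 + a / r ^ 2 := by positivity
      have h2 : 0 < 1 + b / r ^ 2 := by positivity
      rw [← Real.log_div h1.ne' h2.ne']
      refine (Real.log_le_sub_one_of_pos (by positivity)).trans ?_
      rw [div_sub_one h2.ne']
      calc (1 + a / r ^ 2 - (1 + b / r ^ 2)) / (1 + b / r ^ 2)
          = (1 / r ^ 2 * (a - b)) / (1 + b / r ^ 2) := by ring
        _ ≤ (1 / r ^ 2 * |a - b|) / (1 + b / r ^ 2) := by gcongr; exact le_abs_self _
        _ ≤ _ := div_le_self (by positivity) (by simp; positivity)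
    intro a b ha hb
    rw [abs_sub_le_iff]
    refine ⟨key a b ha hb, ?_⟩
    rw [abs_sub_comm]
    exact key b a hb ha
  have hac : AbsolutelyContinuousOnInterval
      (fun t => 1 / 2 * Real.log (1 + ‖y t‖ ^ 2 / r ^ 2)) 0 T := by
    refine AbsolutelyContinuousOnInterval.const_mul _ ?_
    refine absolutelyContinuousOnInterval_of_dist_le (K := 1 / r ^ 2) (hn.mul hn) fun s _ t _ => ?_
    simp only [Real.dist_eq, Pi.mul_apply, ← pow_two]
    exact hlog _ _ (sq_nonneg _) (sq_nonneg _)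
  have hder : ∀ᵐ t ∂(volume.restrict (Ioo 0 T)),
      HasDerivAt (fun t => 1 / 2 * Real.log (1 + ‖y t‖ ^ 2 / r ^ 2))
        (inner ℝ (y t) (y' t) / (r ^ 2 + ‖y t‖ ^ 2)) t := by
    filter_upwards [hd] with t ht
    have h1 : HasDerivAt (fun t => 1 + ‖y t‖ ^ 2 / r ^ 2)
        (2 * inner ℝ (y t) (y' t) / r ^ 2) t := (ht.norm_sq.div_const _).const_add _
    convert! (h1.log (by positivity)).const_mul (1 / 2) using 1
    field_simp
  have := ofReal_sub_le_lintegral hac hder le_rfl ht.1 ht.2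
  simp only [h0, norm_zero] at this
  simp only [ne_eq, OfNat.ofNat_ne_zero, not_false_eq_true, zero_pow, zero_div, add_zero,
    Real.log_one, mul_zero, sub_zero] at this
  refine this.trans (lintegral_mono_ae ?_)
  filter_upwards [ae_restrict_of_ae_restrict_of_subset (Ioo_subset_Ioo le_rfl ht.2) hb] with s hs
  have hpos : 0 < r ^ 2 + ‖y s‖ ^ 2 := by positivity
  calc ENNReal.ofReal (inner ℝ (y s) (y' s) / (r ^ 2 + ‖y s‖ ^ 2))
      ≤ ENNReal.ofReal (‖y s‖ / (r ^ 2 + ‖y s‖ ^ 2) * ‖y' s‖) := by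
        refine ENNReal.ofReal_le_ofReal ?_
        rw [div_mul_eq_mul_div]
        gcongr
        exact real_inner_le_norm _ _
    _ = ENNReal.ofReal (‖y s‖ / (r ^ 2 + ‖y s‖ ^ 2)) * ‖y' s‖ₑ := by
        rw [ENNReal.ofReal_mul (by positivity), ofReal_norm]
    _ ≤ ENNReal.ofReal (‖y s‖ / (r ^ 2 + ‖y s‖ ^ 2)) * (α s + β s * ‖y s‖ₑ) := by gcongr
    _ = ENNReal.ofReal (‖y s‖ / (r ^ 2 + ‖y s‖ ^ 2)) * α s
        + ENNReal.ofReal (‖y s‖ / (r ^ 2 + ‖y s‖ ^ 2) * ‖y s‖) * β s := by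
        rw [ENNReal.ofReal_mul (by positivity), ofReal_norm]; ring
    -- With n = ‖y s‖, the two coefficients are n/(r² + n²) ≤ 1/r and n²/(r² + n²) ≤ 1.
    _ ≤ ENNReal.ofReal r⁻¹ * α s + ENNReal.ofReal 1 * β s := by
        gcongr
        · rw [inv_eq_one_div, div_le_div_iff₀ hpos hr]
          nlinarith [sq_nonneg (r - ‖y s‖), mul_nonneg hr.le (norm_nonneg (y s))]
        · rw [div_mul_eq_mul_div, div_le_one hpos]
          nlinarith
    _ = α s / ENNReal.ofReal r + β s := by
        rw [ENNReal.ofReal_inv_of_pos hr, ENNReal.ofReal_one, one_mul, mul_comm, div_eq_mul_inv]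

/-- Pairing with an arbitrary vector reduces this to the fundamental theorem of calculus for real
absolutely continuous functions. -/
theorem sub_eq_integral_of_hasDerivAt {E : Type*} [NormedAddCommGroup E] [InnerProductSpace ℝ E]
    [CompleteSpace E] {y y' : ℝ → E} {T a b : ℝ}
    (hf : AbsolutelyContinuousOnInterval y 0 T)
    (hd : ∀ᵐ t ∂(volume.restrict (Ioo 0 T)), HasDerivAt y (y' t) t)
    (hi : IntegrableOn y' (Ioo a b))
    (ha : 0 ≤ a) (hab : a ≤ b) (hb : b ≤ T) :
    y b - y a = ∫ t in Ioo a b, y' t := by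
  have hT : 0 ≤ T := ha.trans (hab.trans hb)
  refine ext_inner_left ℝ fun e => ?_
  have hac : AbsolutelyContinuousOnInterval (fun t => inner ℝ e (y t)) 0 T :=
    absolutelyContinuousOnInterval_of_dist_le (K := ‖e‖) hf fun s _ t _ => by
      rw [Real.dist_eq, ← inner_sub_right, dist_eq_norm]
      exact abs_real_inner_le_norm e (y s - y t)
  have hac' : AbsolutelyContinuousOnInterval (fun t => inner ℝ e (y t)) a b := hac.mono (by
    rw [uIcc_of_le hab, uIcc_of_le hT]; exact Icc_subset_Icc ha hb)
  have h1 := hac'.integral_deriv_eq_sub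
  rw [intervalIntegral.integral_of_le hab, integral_Ioc_eq_integral_Ioo] at h1
  rw [inner_sub_right, ← h1, ← integral_inner hi]
  refine integral_congr_ae ?_
  filter_upwards [ae_restrict_of_ae_restrict_of_subset (Ioo_subset_Ioo ha hb) hd] with t ht
  exact ((innerSL ℝ e).hasFDerivAt.comp_hasDerivAt t ht).deriv

/-! ### Determinants near the identity and compression of volume -/

/-- The divergence as a linear functional of the gradient. -/
noncomputable def traceCLM (d : ℕ) : (Space d →L[ℝ] Space d) →L[ℝ] ℝ :=
  ∑ i : Fin d, (EuclideanSpace.proj i : Space d →L[ℝ] ℝ).comp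
    (ContinuousLinearMap.apply ℝ (Space d) (basisVec i))

theorem traceCLM_apply {d : ℕ} (A : Space d →L[ℝ] Space d) :
    traceCLM d A = ∑ i : Fin d, (A (basisVec i)) i := by
  simp [traceCLM]

theorem neg_traceCLM_le {d : ℕ} (A : Space d →L[ℝ] Space d) :
    -traceCLM d A ≤ d * ‖A‖ := by
  rw [traceCLM_apply, ← Finset.sum_neg_distrib]
  refine (Finset.sum_le_card_nsmul _ _ ‖A‖ fun i _ => ?_).trans (by simp)
  refine (neg_le_abs _).trans ?_
  rw [← Real.norm_eq_abs]
  refine (PiLp.norm_apply_le _ i).trans ((A.le_opNorm _).trans ?_)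
  simp

/-- First order expansion of the determinant at the identity. -/
theorem exists_le_det_one_add (d : ℕ) {ε : ℝ} (hε : 0 < ε) :
    ∃ ρ > 0, ∀ A : Space d →L[ℝ] Space d, ‖A‖ ≤ ρ →
      1 + traceCLM d A - ε * ‖A‖ ≤ (1 + A).det := by
  let b := (EuclideanSpace.basisFun (Fin d) ℝ).toBasis
  let mat : (Space d →L[ℝ] Space d) → Matrix (Fin d) (Fin d) ℝ :=
    fun A => LinearMap.toMatrix b b A
  have hmat : ∀ A i j, mat A i j = (A (basisVec j)) i := by
    intro A i j
    simp [mat, b, LinearMap.toMatrix_apply]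
  have hdet : ∀ A : Space d →L[ℝ] Space d, A.det = (mat A).det := by
    intro A
    simp [mat, ContinuousLinearMap.det]
  have hmat1 : ∀ (r : ℝ) (A : Space d →L[ℝ] Space d), mat (1 + r • A) = 1 + r • mat A := by
    intro r A
    ext i j
    simp [hmat, Matrix.one_apply, PiLp.single_apply]
  have hdiff : Differentiable ℝ fun A : Space d →L[ℝ] Space d => (1 + A).det := by
    simp only [hdet, Matrix.det_apply', hmat]
    have h1 : ∀ i j : Fin d, Differentiable ℝ
        fun A : Space d →L[ℝ] Space d => ((1 + A) (basisVec j)) i := by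
      intro i j
      have h2 : Differentiable ℝ fun A : Space d →L[ℝ] Space d =>
          ((EuclideanSpace.proj i : Space d →L[ℝ] ℝ).comp
            (ContinuousLinearMap.apply ℝ (Space d) (basisVec j))) (1 + A) :=
        (ContinuousLinearMap.differentiable _).comp (differentiable_id.const_add 1)
      exact h2
    fun_prop
  have hder := (hdiff 0).hasFDerivAt
  set g' := fderiv ℝ (fun A : Space d →L[ℝ] Space d => (1 + A).det) 0 with hg'
  have htr : ∀ A, g' A = traceCLM d A := by
    intro A
    have h1 : HasDerivAt (fun r : ℝ => (1 + r • A).det) (g' A) 0 := by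
      have h2 : HasDerivAt (fun r : ℝ => r • A) A 0 := by
        simpa using (hasDerivAt_id (0 : ℝ)).smul_const A
      exact hder.comp_hasDerivAt_of_eq (0 : ℝ) h2 (zero_smul ℝ A).symm
    have h4 : HasDerivAt (fun r : ℝ => (1 + r • A).det) ((mat A).trace) 0 := by
      -- det(1 + rM) is a polynomial in r with constant coefficient 1 and linear coefficient tr M;
      -- `P` is what remains after removing these and dividing by r². Hence the derivative at r = 0
      -- is the trace.
      set P := (Matrix.det (1 + (Polynomial.X : Polynomial ℝ) • (mat A).map Polynomial.C)).divX.divX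
        with hP
      have heq : (fun r : ℝ => (1 + r • A).det) =
          fun r => 1 + (mat A).trace * r + P.eval r * r ^ 2 := by
        funext r
        rw [hdet, hmat1, Matrix.det_one_add_smul]
      rw [heq]
      have h5 := (((hasDerivAt_id (0 : ℝ)).const_mul (mat A).trace).const_add 1).add
        ((P.hasDerivAt 0).mul ((hasDerivAt_id (0 : ℝ)).pow 2))
      exact HasDerivAt.congr_deriv (f := fun r => 1 + (mat A).trace * r + P.eval r * r ^ 2) h5
        (by simp)
    rw [h1.unique h4, traceCLM_apply]
    simp [Matrix.trace, hmat]
  have ho := hder.isLittleO.bound hε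
  simp only [sub_zero, add_zero] at ho
  obtain ⟨ρ, hρ, hball⟩ := Metric.eventually_nhds_iff.1 ho
  refine ⟨ρ / 2, half_pos hρ, fun A hA => ?_⟩
  have := hball (y := A) (by rw [dist_zero_right]; linarith)
  rw [htr, show (1 : Space d →L[ℝ] Space d).det = 1 by simp [ContinuousLinearMap.det]] at this
  have := (abs_le.1 this).1
  linarith

/-- A perturbation of the identity by a small map with divergence bounded below does not
compress volume much. -/
theorem volume_preimage_add_le {d : ℕ} {ε ρ κ a : ℝ} (hε : 0 < ε)
    (hρ : ∀ A : Space d →L[ℝ] Space d, ‖A‖ ≤ ρ → 1 + traceCLM d A - ε * ‖A‖ ≤ (1 + A).det)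
    (hκ : κ ≤ ρ) (hκ' : (d + ε + 1) * κ ≤ 1 / 2) (hκ0 : 0 ≤ κ)
    {w : Space d → Space d} {w' : Space d → Space d →L[ℝ] Space d}
    (hw : ∀ x, HasFDerivAt w (w' x) x) (hw' : ∀ x, ‖w' x‖ ≤ κ) (ha : 0 ≤ a)
    (htr : ∀ x, -traceCLM d (w' x) ≤ a) {B : Set (Space d)} (hB : MeasurableSet B) :
    volume ((fun x => x + w x) ⁻¹' B) ≤ ENNReal.ofReal (Real.exp (2 * (a + ε * κ))) * volume B := by
  set F : Space d → Space d := fun x => x + w x with hF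
  have hder : ∀ x, HasFDerivAt F (1 + w' x) x := fun x => (hasFDerivAt_id x).add (hw x)
  have hcont : Continuous F :=
    continuous_iff_continuousAt.2 fun x => (hder x).continuousAt
  have hlip : ∀ x y, ‖w x - w y‖ ≤ κ * ‖x - y‖ := fun x y =>
    convex_univ.norm_image_sub_le_of_norm_hasFDerivWithin_le
      (fun z _ => (hw z).hasFDerivWithinAt) (fun z _ => hw' z) (mem_univ y) (mem_univ x)
  have hκ1 : κ ≤ 1 / 2 := by nlinarith [mul_nonneg (Nat.cast_nonneg (α := ℝ) d) hκ0, mul_nonneg hε.le hκ0]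
  -- Since κ ≤ 1/2, `w` is a contraction and a perturbation of the identity by it is injective.
  -- Surjectivity is not needed, as F(F⁻¹B) ⊆ B suffices.
  have hinj : Function.Injective F := by
    intro x y hxy
    have h1 : x - y = -(w x - w y) := by
      have : x + w x = y + w y := hxy
      rw [eq_neg_iff_add_eq_zero, show x - y + (w x - w y) = (x + w x) - (y + w y) by abel, this,
        sub_self]
    have h2 := hlip x y
    rw [← norm_neg (w x - w y), ← h1] at h2
    have h3 : ‖x - y‖ = 0 := by nlinarith [norm_nonneg (x - y)]
    exact sub_eq_zero.1 (norm_eq_zero.1 h3)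
  -- The determinant is at least 1 - c, with c ≤ (d + ε)κ ≤ 1/2 by `hκ'`, and 1 - c ≥ exp(-2c) on
  -- [0, 1/2]. This is the origin of the factor 2 in the exponent.
  have hdet : ∀ x, Real.exp (-(2 * (a + ε * κ))) ≤ |(1 + w' x).det| := by
    intro x
    refine le_trans ?_ (le_abs_self _)
    have h1 := hρ (w' x) ((hw' x).trans hκ)
    have h2 : ε * ‖w' x‖ ≤ ε * κ := mul_le_mul_of_nonneg_left (hw' x) hε.le
    have h3 : (d : ℝ) * ‖w' x‖ ≤ d * κ := mul_le_mul_of_nonneg_left (hw' x) (Nat.cast_nonneg d)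
    set c := -traceCLM d (w' x) + ε * ‖w' x‖ with hc
    have hca : c ≤ a + ε * κ := add_le_add (htr x) h2
    have hc2 : c ≤ 1 / 2 := by nlinarith [neg_traceCLM_le (w' x)]
    refine le_trans ?_ (show 1 - c ≤ _ by linarith)
    have hnn : 0 ≤ a + ε * κ := by positivity
    rcases le_or_gt c 0 with h0 | h0
    · exact (Real.exp_le_one_iff.2 (by linarith)).trans (by linarith)
    · calc Real.exp (-(2 * (a + ε * κ))) ≤ Real.exp (-(2 * c)) :=
            Real.exp_le_exp.2 (by linarith)
        _ = 1 / Real.exp (2 * c) := by rw [Real.exp_neg, one_div]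
        _ ≤ 1 - c := by
            rw [div_le_iff₀ (Real.exp_pos _)]
            have := Real.add_one_le_exp (2 * c)
            nlinarith
  have hmeas : MeasurableSet (F ⁻¹' B) := hcont.measurable hB
  have h1 := lintegral_abs_det_fderiv_eq_addHaar_image volume hmeas
    (fun x _ => (hder x).hasFDerivWithinAt) hinj.injOn
  have h2 : ENNReal.ofReal (Real.exp (-(2 * (a + ε * κ)))) * volume (F ⁻¹' B) ≤ volume B := by
    calc _ = ∫⁻ x in F ⁻¹' B, ENNReal.ofReal (Real.exp (-(2 * (a + ε * κ)))) := by simp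
      _ ≤ ∫⁻ x in F ⁻¹' B, ENNReal.ofReal |(1 + w' x).det| :=
          lintegral_mono fun x => ENNReal.ofReal_le_ofReal (hdet x)
      _ ≤ volume B := h1 ▸ measure_mono (image_preimage_subset _ _)
  calc volume (F ⁻¹' B) = ENNReal.ofReal (Real.exp (2 * (a + ε * κ))) *
        (ENNReal.ofReal (Real.exp (-(2 * (a + ε * κ)))) * volume (F ⁻¹' B)) := by
        rw [← mul_assoc, ← ENNReal.ofReal_mul (Real.exp_pos _).le, ← Real.exp_add]
        simp
    _ ≤ _ := by gcongr

/-! ### Euler scheme and one-sided Liouville theorem for bounded C¹ fields -/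

/-- A bounded time-dependent field, measurable in time, differentiable in space with a bounded
and measurable derivative. -/
structure IsBoundedC1Field {d : ℕ} (K Λ : ℝ) (v : ℝ → Space d → Space d)
    (v' : ℝ → Space d → Space d →L[ℝ] Space d) : Prop where
  stronglyMeasurable : StronglyMeasurable (Function.uncurry v)
  stronglyMeasurable_deriv : StronglyMeasurable (Function.uncurry v')
  norm_le : ∀ t x, ‖v t x‖ ≤ K
  hasFDerivAt : ∀ t x, HasFDerivAt (v t) (v' t x) x
  norm_deriv_le : ∀ t x, ‖v' t x‖ ≤ Λ

namespace IsBoundedC1Field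

variable {d : ℕ} {K Λ : ℝ} {v : ℝ → Space d → Space d}
  {v' : ℝ → Space d → Space d →L[ℝ] Space d}

theorem bound_nonneg (h : IsBoundedC1Field K Λ v v') : 0 ≤ K :=
  (norm_nonneg _).trans (h.norm_le 0 0)

theorem lipschitz_nonneg (h : IsBoundedC1Field K Λ v v') : 0 ≤ Λ :=
  (norm_nonneg _).trans (h.norm_deriv_le 0 0)

theorem norm_sub_le (h : IsBoundedC1Field K Λ v v') (t : ℝ) (x y : Space d) :
    ‖v t x - v t y‖ ≤ Λ * ‖x - y‖ :=
  convex_univ.norm_image_sub_le_of_norm_hasFDerivWithin_le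
    (fun z _ => (h.hasFDerivAt t z).hasFDerivWithinAt) (fun z _ => h.norm_deriv_le t z)
    (mem_univ y) (mem_univ x)

theorem integrableOn_apply (h : IsBoundedC1Field K Λ v v') (x : Space d) (a b : ℝ) :
    IntegrableOn (fun s => v s x) (Ioo a b) :=
  Measure.integrableOn_of_bounded (M := K) (by simp)
    (h.stronglyMeasurable.comp_measurable (measurable_id.prodMk measurable_const)).aestronglyMeasurable
    (Eventually.of_forall fun s => h.norm_le s x)

theorem integrableOn_deriv_apply (h : IsBoundedC1Field K Λ v v') (x : Space d) (a b : ℝ) :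
    IntegrableOn (fun s => v' s x) (Ioo a b) :=
  Measure.integrableOn_of_bounded (M := Λ) (by simp)
    (h.stronglyMeasurable_deriv.comp_measurable
      (measurable_id.prodMk measurable_const)).aestronglyMeasurable
    (Eventually.of_forall fun s => h.norm_deriv_le s x)

theorem hasFDerivAt_integral (h : IsBoundedC1Field K Λ v v') (a b : ℝ) (x : Space d) :
    HasFDerivAt (fun x => ∫ s in Ioo a b, v s x) (∫ s in Ioo a b, v' s x) x :=
  hasFDerivAt_integral_of_dominated_of_fderiv_le (bound := fun _ => Λ) univ_mem
    (Eventually.of_forall fun x => (h.integrableOn_apply x a b).aestronglyMeasurable)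
    (h.integrableOn_apply x a b) (h.integrableOn_deriv_apply x a b).aestronglyMeasurable
    (Eventually.of_forall fun s z _ => h.norm_deriv_le s z)
    (by simp) (Eventually.of_forall fun s z _ => h.hasFDerivAt s z)

theorem norm_integral_deriv_le (h : IsBoundedC1Field K Λ v v') {a b : ℝ} (hab : a ≤ b)
    (x : Space d) : ‖∫ s in Ioo a b, v' s x‖ ≤ Λ * (b - a) := by
  refine (norm_setIntegral_le_of_norm_le_const (C := Λ) (by simp)
    (fun s _ => h.norm_deriv_le s x)).trans ?_
  simp [measureReal_def, ENNReal.toReal_ofReal (sub_nonneg.2 hab)]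

/-- The trace commutes with the integral, so the displacement of one Euler step has divergence at
least minus the share of ∫ m belonging to that step. Only monotonicity of the lower integral is
used, so `m` need not be measurable. -/
theorem neg_traceCLM_integral_le (h : IsBoundedC1Field K Λ v v') {a b : ℝ} {m : ℝ → ℝ≥0∞}
    (hm : ∀ᵐ t ∂(volume.restrict (Ioo a b)), ∀ x, ENNReal.ofReal (-traceCLM d (v' t x)) ≤ m t)
    (hfin : ∫⁻ t in Ioo a b, m t ≠ ⊤) (x : Space d) :
    -traceCLM d (∫ s in Ioo a b, v' s x) ≤ (∫⁻ t in Ioo a b, m t).toReal := by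
  rw [← ContinuousLinearMap.integral_comp_comm _ (h.integrableOn_deriv_apply x a b),
    ← integral_neg]
  have hi : Integrable (fun s => -traceCLM d (v' s x)) (volume.restrict (Ioo a b)) :=
    ((traceCLM d).integrable_comp (h.integrableOn_deriv_apply x a b)).neg
  refine (integral_mono hi hi.pos_part fun t => le_max_left _ _).trans ?_
  rw [integral_eq_lintegral_of_nonneg_ae (f := fun t => max (-traceCLM d (v' t x)) 0)
    (Eventually.of_forall fun t => le_max_right _ _) hi.pos_part.aestronglyMeasurable]
  refine ENNReal.toReal_mono hfin (lintegral_mono_ae ?_)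
  filter_upwards [hm] with t ht
  rw [ENNReal.ofReal_max, ENNReal.ofReal_zero, max_eq_left zero_le]
  exact ht x

theorem norm_sub_le_of_isACSolution (h : IsBoundedC1Field K Λ v v') {T a b : ℝ} {x : Space d}
    {y : ℝ → Space d} (hy : IsACSolution T v x y) (ha : 0 ≤ a) (hab : a ≤ b) (hb : b ≤ T) :
    ‖y b - y a‖ ≤ K * (b - a) :=
  norm_sub_le_of_ae_norm_le h.bound_nonneg hy.1 hy.2.2
    (Eventually.of_forall fun t => h.norm_le t (y t)) ha hab hb

/-- The error of one explicit Euler step. -/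
theorem norm_euler_step_le (h : IsBoundedC1Field K Λ v v') {T a b : ℝ} {x : Space d}
    {y : ℝ → Space d} (hy : IsACSolution T v x y) (ha : 0 ≤ a) (hab : a ≤ b) (hb : b ≤ T) :
    ‖y b - (y a + ∫ s in Ioo a b, v s (y a))‖ ≤ Λ * K * (b - a) ^ 2 := by
  have hT : 0 ≤ T := ha.trans (hab.trans hb)
  have hcont : ContinuousOn y (Ioo a b) := (hy.1.continuousOn).mono (by
    rw [uIcc_of_le hT]; exact Ioo_subset_Icc_self.trans (Icc_subset_Icc ha hb))
  have hmeas : AEMeasurable y (volume.restrict (Ioo a b)) := hcont.aemeasurable measurableSet_Ioo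
  have hint : IntegrableOn (fun s => v s (y s)) (Ioo a b) := by
    refine Integrable.of_bound ?_ K (Eventually.of_forall fun s => h.norm_le s (y s))
    exact (h.stronglyMeasurable.measurable.comp_aemeasurable
      (aemeasurable_id.prodMk hmeas)).aestronglyMeasurable
  rw [← sub_sub, sub_eq_integral_of_hasDerivAt hy.1 hy.2.2 hint ha hab hb,
    ← integral_sub hint (h.integrableOn_apply _ a b)]
  -- During the step the curve moves by at most K(b - a), which changes the field by at most ΛK(b -
  -- a).
  refine (norm_setIntegral_le_of_norm_le_const (C := Λ * (K * (b - a))) (by simp)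
    (fun s hs => (h.norm_sub_le s _ _).trans ?_)).trans ?_
  · refine mul_le_mul_of_nonneg_left ?_ h.lipschitz_nonneg
    refine (h.norm_sub_le_of_isACSolution hy ha hs.1.le (hs.2.le.trans hb)).trans ?_
    exact mul_le_mul_of_nonneg_left (by linarith [hs.2]) h.bound_nonneg
  · simp [measureReal_def, ENNReal.toReal_ofReal (sub_nonneg.2 hab)]
    exact le_of_eq (by ring)

/-- The Euler approximation with `k` steps of length `h`: distance to the flow, and compression. -/
theorem exists_euler (h : IsBoundedC1Field K Λ v v') {T τ : ℝ} {m : ℝ → ℝ≥0∞}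
    (hm : ∀ᵐ t ∂(volume.restrict (Ioo 0 T)), ∀ x, ENNReal.ofReal (-traceCLM d (v' t x)) ≤ m t)
    (hfin : ∫⁻ t in Ioo 0 T, m t ≠ ⊤) {X : ℝ → Space d → Space d} (hX : IsClassicalFlow T v X)
    {ε ρ : ℝ} (hε : 0 < ε)
    (hρ : ∀ A : Space d →L[ℝ] Space d, ‖A‖ ≤ ρ → 1 + traceCLM d A - ε * ‖A‖ ≤ (1 + A).det)
    (hτ : 0 ≤ τ) (h1 : Λ * τ ≤ ρ) (h2 : (d + ε + 1) * (Λ * τ) ≤ 1 / 2) (k : ℕ) (hk : k * τ ≤ T) :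
    ∃ Y : Space d → Space d, Measurable Y ∧
      (∀ x, ‖X (k * τ) x - Y x‖ ≤ k * (Λ * K * τ ^ 2) * Real.exp (k * (Λ * τ))) ∧
      ∀ B, MeasurableSet B → volume (Y ⁻¹' B) ≤
        ENNReal.ofReal (Real.exp (2 * ((∫⁻ t in Ioo 0 (k * τ), m t).toReal + ε * (k * (Λ * τ)))))
          * volume B := by
  have hΛ := h.lipschitz_nonneg
  have hK := h.bound_nonneg
  induction k with
  | zero =>
    refine ⟨id, measurable_id, fun x => ?_, fun B _ => by simp⟩
    simp [(hX x).2.1]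
  | succ k ih =>
    have hkτ : (k : ℝ) * τ ≤ (k + 1 : ℕ) * τ := by push_cast; nlinarith
    have hk0 : 0 ≤ (k : ℝ) * τ := by positivity
    have hdiff : ((k + 1 : ℕ) : ℝ) * τ - k * τ = τ := by push_cast; ring
    obtain ⟨Y, hYm, hYe, hYv⟩ := ih (hkτ.trans hk)
    set a := (k : ℝ) * τ
    set b := ((k + 1 : ℕ) : ℝ) * τ
    set w : Space d → Space d := fun x => ∫ s in Ioo a b, v s x with hw
    have hwd := h.hasFDerivAt_integral a b
    have hwn : ∀ x, ‖∫ s in Ioo a b, v' s x‖ ≤ Λ * τ := fun x => by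
      have := h.norm_integral_deriv_le hkτ x
      rwa [hdiff] at this
    have hwc : Continuous w := continuous_iff_continuousAt.2 fun x => (hwd x).continuousAt
    have hwl : ∀ x y, ‖w x - w y‖ ≤ Λ * τ * ‖x - y‖ := fun x y =>
      convex_univ.norm_image_sub_le_of_norm_hasFDerivWithin_le
        (fun z _ => (hwd z).hasFDerivWithinAt) (fun z _ => hwn z) (mem_univ y) (mem_univ x)
    have hsub : Ioo a b ⊆ Ioo 0 T := Ioo_subset_Ioo hk0 hk
    have hfin' : ∫⁻ t in Ioo a b, m t ≠ ⊤ :=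
      ((lintegral_mono_set hsub).trans_lt hfin.lt_top).ne
    have hfin'' : ∫⁻ t in Ioo 0 a, m t ≠ ⊤ :=
      ((lintegral_mono_set (Ioo_subset_Ioo le_rfl (hkτ.trans hk))).trans_lt hfin.lt_top).ne
    refine ⟨fun x => Y x + w (Y x), hYm.add (hwc.measurable.comp hYm), fun x => ?_, fun B hB => ?_⟩
    · have e1 := h.norm_euler_step_le (hX x) hk0 hkτ hk
      rw [hdiff] at e1
      have e2 := hYe x
      have e3 := hwl (X a x) (Y x)
      have e4 : Real.exp (((k + 1 : ℕ) : ℝ) * (Λ * τ))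
          = Real.exp (k * (Λ * τ)) * Real.exp (Λ * τ) := by
        rw [← Real.exp_add]; push_cast; ring_nf
      have e5 : 1 + Λ * τ ≤ Real.exp (Λ * τ) := by linarith [Real.add_one_le_exp (Λ * τ)]
      have e6 : 1 ≤ Real.exp (k * (Λ * τ)) := Real.one_le_exp (by positivity)
      have e7 : 0 ≤ Λ * τ := by positivity
      have e8 : 0 ≤ Λ * K * τ ^ 2 := by positivity
      rw [e4]
      set c := Λ * K * τ ^ 2
      set q := Real.exp (k * (Λ * τ))
      set z := Real.exp (Λ * τ)
      -- Discrete Grönwall: the new error is the local error c plus (1 + Λτ) times the old one, and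
      -- 1 + Λτ ≤ exp(Λτ).
      calc ‖X b x - (Y x + w (Y x))‖
          = ‖(X b x - (X a x + w (X a x))) + ((X a x - Y x) + (w (X a x) - w (Y x)))‖ := by
            congr 1; abel
        _ ≤ c + (‖X a x - Y x‖ + Λ * τ * ‖X a x - Y x‖) :=
            (norm_add_le _ _).trans (add_le_add e1 ((norm_add_le _ _).trans (by gcongr)))
        _ = c + (1 + Λ * τ) * ‖X a x - Y x‖ := by ring
        _ ≤ c * (q * z) + z * (k * c * q) := by
            refine add_le_add ?_ (mul_le_mul e5 e2 (norm_nonneg _) (Real.exp_pos _).le)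
            refine le_mul_of_one_le_right e8 ?_
            exact one_le_mul_of_one_le_of_one_le e6 (by linarith)
        _ = ((k + 1 : ℕ) : ℝ) * c * (q * z) := by push_cast; ring
    · have hmeas : MeasurableSet ((fun x => x + w x) ⁻¹' B) :=
        (continuous_id.add hwc).measurable hB
      -- Compression factors multiply under composition, so the exponents of the single steps add up
      -- to 2(∫ m + εkΛτ).
      have s1 := volume_preimage_add_le hε hρ h1 h2 (by positivity) hwd hwn ENNReal.toReal_nonneg
        (fun x => h.neg_traceCLM_integral_le
          (ae_restrict_of_ae_restrict_of_subset hsub hm) hfin' x) hB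
      have s2 := hYv _ hmeas
      refine s2.trans ((mul_le_mul_right s1 _).trans ?_)
      rw [← mul_assoc, ← ENNReal.ofReal_mul (Real.exp_pos _).le, ← Real.exp_add]
      gcongr
      have s3 : (∫⁻ t in Ioo 0 a, m t) + ∫⁻ t in Ioo a b, m t ≤ ∫⁻ t in Ioo 0 b, m t := by
        rw [← lintegral_union measurableSet_Ioo
          (Set.disjoint_left.2 fun z hz hz' => lt_asymm hz.2 hz'.1)]
        exact lintegral_mono_set (union_subset (Ioo_subset_Ioo le_rfl hkτ)
          (Ioo_subset_Ioo hk0 le_rfl))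
      have hfinb : ∫⁻ t in Ioo 0 b, m t ≠ ⊤ :=
        ((lintegral_mono_set (Ioo_subset_Ioo le_rfl hk)).trans_lt hfin.lt_top).ne
      have s4 := ENNReal.toReal_mono hfinb s3
      rw [ENNReal.toReal_add hfin'' hfin'] at s4
      push_cast
      nlinarith [s4]

/-- Measurable maps converging to the flow and uniformly not compressing. -/
theorem exists_tendsto_flow (h : IsBoundedC1Field K Λ v v') {T t : ℝ} {m : ℝ → ℝ≥0∞}
    (hm : ∀ᵐ t ∂(volume.restrict (Ioo 0 T)), ∀ x, ENNReal.ofReal (-traceCLM d (v' t x)) ≤ m t)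
    (hfin : ∫⁻ t in Ioo 0 T, m t ≠ ⊤) {X : ℝ → Space d → Space d} (hX : IsClassicalFlow T v X)
    (ht : t ∈ Icc 0 T) :
    ∃ Y : ℕ → Space d → Space d, (∀ N, Measurable (Y N)) ∧
      (∀ x, Tendsto (fun N => Y N x) atTop (𝓝 (X t x))) ∧
      ∀ᶠ N in atTop, ∀ B, MeasurableSet B → volume (Y N ⁻¹' B) ≤
        ENNReal.ofReal (Real.exp (2 * ((∫⁻ t in Ioo 0 T, m t).toReal + 1))) * volume B := by
  have hΛ := h.lipschitz_nonneg
  have hK := h.bound_nonneg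
  have ht0 := ht.1
  -- With this choice the determinant errors of all steps together contribute ε Λ t ≤ 1. That is the
  -- `+ 1` in the compression constant, which therefore does not depend on Λ.
  set ε : ℝ := (1 + Λ * t)⁻¹ with hε
  have hε0 : 0 < ε := by positivity
  have hεt : ε * (Λ * t) ≤ 1 := by
    rw [hε, inv_mul_le_iff₀ (by positivity)]; linarith
  obtain ⟨ρ, hρ0, hρ⟩ := exists_le_det_one_add d hε0
  have hlim : Tendsto (fun N : ℕ => Λ * (t / N)) atTop (𝓝 0) := by
    simpa using (tendsto_const_div_atTop_nhds_zero_nat t).const_mul Λ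
  have hlim' : Tendsto (fun N : ℕ => (d + ε + 1) * (Λ * (t / N))) atTop (𝓝 0) := by
    simpa using hlim.const_mul ((d : ℝ) + ε + 1)
  have hev2 : ∀ᶠ N : ℕ in atTop, (d + ε + 1) * (Λ * (t / N)) ≤ 1 / 2 :=
    hlim'.eventually_le_const (by norm_num)
  obtain ⟨N₀, hN₀⟩ := eventually_atTop.1
    ((hlim.eventually_le_const hρ0).and (hev2.and (eventually_ge_atTop 1)))
  have hex : ∀ N : ℕ, ∃ Y : Space d → Space d, Measurable Y ∧ (N₀ ≤ N →
      (∀ x, ‖X t x - Y x‖ ≤ Λ * K * t ^ 2 * Real.exp (Λ * t) / N) ∧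
        ∀ B, MeasurableSet B → volume (Y ⁻¹' B) ≤
          ENNReal.ofReal (Real.exp (2 * ((∫⁻ t in Ioo 0 T, m t).toReal + 1))) * volume B) := by
    intro N
    by_cases hN : N₀ ≤ N
    · obtain ⟨g1, g2, g3⟩ := hN₀ N hN
      have hN0 : (N : ℝ) ≠ 0 := by positivity
      have hNt : (N : ℝ) * (t / N) = t := by field_simp
      obtain ⟨Y, hY0, hY1, hY2⟩ := h.exists_euler hm hfin hX hε0 hρ (by positivity) g1 g2 N
        (hNt.le.trans ht.2)
      refine ⟨Y, hY0, fun _ => ⟨fun x => ?_, fun B hB => ?_⟩⟩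
      · have := hY1 x
        rw [mul_left_comm (N : ℝ) Λ, hNt] at this
        refine this.trans (le_of_eq ?_)
        field_simp
      · refine (hY2 B hB).trans ?_
        rw [mul_left_comm (N : ℝ) Λ, hNt]
        gcongr
        exact ht.2
    · exact ⟨id, measurable_id, fun h => absurd h hN⟩
  choose Y hYm hY using hex
  refine ⟨Y, hYm, fun x => ?_, ?_⟩
  · rw [tendsto_iff_norm_sub_tendsto_zero]
    refine squeeze_zero' (Eventually.of_forall fun _ => norm_nonneg _) ?_
      (tendsto_const_div_atTop_nhds_zero_nat (Λ * K * t ^ 2 * Real.exp (Λ * t)))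
    filter_upwards [eventually_ge_atTop N₀] with N hN
    rw [norm_sub_rev]
    exact (hY N hN).1 x
  · filter_upwards [eventually_ge_atTop N₀] with N hN
    exact (hY N hN).2

/-- Liouville's theorem, one-sided: the flow of a field whose divergence is bounded below
does not compress volume by more than a constant factor. -/
theorem volume_preimage_flow_le (h : IsBoundedC1Field K Λ v v') {T t : ℝ} {m : ℝ → ℝ≥0∞}
    (hm : ∀ᵐ t ∂(volume.restrict (Ioo 0 T)), ∀ x, ENNReal.ofReal (-traceCLM d (v' t x)) ≤ m t)
    (hfin : ∫⁻ t in Ioo 0 T, m t ≠ ⊤) {X : ℝ → Space d → Space d} (hX : IsClassicalFlow T v X)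
    (ht : t ∈ Icc 0 T) (B : Set (Space d)) :
    volume (X t ⁻¹' B) ≤
      ENNReal.ofReal (Real.exp (2 * ((∫⁻ t in Ioo 0 T, m t).toReal + 1))) * volume B := by
  obtain ⟨Y, -, hconv, hev⟩ := h.exists_tendsto_flow hm hfin hX ht
  set c := ENNReal.ofReal (Real.exp (2 * ((∫⁻ t in Ioo 0 T, m t).toReal + 1))) with hc
  have hc0 : c ≠ 0 := by simp [hc, Real.exp_pos]
  have hc1 : c ≠ ⊤ := by simp [hc]
  -- Outer regularity reduces the claim to open sets. For open U, a point whose image under `X t`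
  -- lies in U is eventually mapped into U by the Euler maps, so X⁻¹U lies in the increasing union
  -- of their tail intersections. No differentiability of the flow itself is needed.
  suffices hopen : ∀ U : Set (Space d), IsOpen U → volume (X t ⁻¹' U) ≤ c * volume U by
    rw [mul_comm, ← ENNReal.div_le_iff hc0 hc1, Set.measure_eq_iInf_isOpen B]
    refine le_iInf fun U => le_iInf fun hBU => le_iInf fun hU => ?_
    rw [ENNReal.div_le_iff hc0 hc1, mul_comm]
    exact (measure_mono (preimage_mono hBU)).trans (hopen U hU)
  intro U hU
  obtain ⟨N₀, hN₀⟩ := eventually_atTop.1 hev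
  have hsub : X t ⁻¹' U ⊆ ⋃ n : ℕ, ⋂ N ≥ n, Y N ⁻¹' U := by
    intro x hx
    obtain ⟨n, hn⟩ := eventually_atTop.1 ((hconv x).eventually (hU.mem_nhds hx))
    exact mem_iUnion.2 ⟨n, mem_iInter₂.2 hn⟩
  have hmono : Monotone fun n : ℕ => ⋂ N ≥ n, Y N ⁻¹' U := fun n n' hnn =>
    biInter_mono (fun N hN => le_trans hnn hN) fun _ _ => le_rfl
  refine (measure_mono hsub).trans ?_
  rw [hmono.measure_iUnion]
  refine iSup_le fun n => ?_
  have : (⋂ N ≥ n, Y N ⁻¹' U) ⊆ Y (max n N₀) ⁻¹' U := fun x hx =>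
    mem_iInter₂.1 hx (max n N₀) (le_max_left _ _)
  exact (measure_mono this).trans (hN₀ _ (le_max_right _ _) U hU.measurableSet)

/-- The flow of a bounded `C^1` field is measurable in the initial point. -/
theorem measurable_flow (h : IsBoundedC1Field K Λ v v') {T t : ℝ}
    {X : ℝ → Space d → Space d} (hX : IsClassicalFlow T v X)
    (ht : t ∈ Icc 0 T) : Measurable (X t) := by
  -- The crude divergence bound dΛ is enough here: only the pointwise convergence of measurable
  -- Euler maps is used, not their compression constant.
  obtain ⟨Y, hY, hconv, -⟩ := h.exists_tendsto_flow (m := fun _ => ENNReal.ofReal (d * Λ))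
    (Eventually.of_forall fun t x => ENNReal.ofReal_le_ofReal ((neg_traceCLM_le _).trans
      (mul_le_mul_of_nonneg_left (h.norm_deriv_le t x) (Nat.cast_nonneg d))))
    (by simp [ENNReal.mul_eq_top]) hX ht
  exact measurable_of_tendsto_metrizable hY (tendsto_pi_nhds.2 hconv)

end IsBoundedC1Field

/-! ### Local maximal function: weak and strong estimates -/

/-- The Hardy–Littlewood maximal function over balls with rational radius at most `R`. -/
noncomputable def maximalFunction {d : ℕ} (R : ℝ) (f : Space d → ℝ≥0∞) (x : Space d) : ℝ≥0∞ :=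
  ⨆ q : {q : ℚ // 0 < q ∧ (q : ℝ) ≤ R},
    (volume (Metric.ball (0 : Space d) (q : ℚ)))⁻¹ * ∫⁻ z in Metric.ball x (q : ℚ), f z

theorem volume_ball_ne_zero {d : ℕ} (x : Space d) {r : ℝ} (hr : 0 < r) :
    volume (Metric.ball x r) ≠ 0 := (Metric.measure_ball_pos volume x hr).ne'

/-- Only countably many (rational) radii occur, so the supremum is measurable once each ball
integral is. The parameter `a` lets the function and the centre vary together, as needed for fields
depending on time. -/
theorem measurable_maximalFunction {α : Type*} [MeasurableSpace α] {d : ℕ} (R : ℝ)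
    {f : α → Space d → ℝ≥0∞} (hf : Measurable (Function.uncurry f)) {c : α → Space d}
    (hc : Measurable c) : Measurable fun a => maximalFunction R (f a) (c a) := by
  refine Measurable.iSup fun q => Measurable.const_mul ?_ _
  have h1 : ∀ a, ∫⁻ y in Metric.ball (c a) (q : ℚ), f a y
      = ∫⁻ y, {w : α × Space d | dist w.2 (c w.1) < (q : ℚ)}.indicator
          (Function.uncurry f) (a, y) := by
    intro z
    rw [← lintegral_indicator Metric.isOpen_ball.measurableSet]
    rfl
  simp only [h1]
  refine Measurable.lintegral_prod_right' (hf.indicator ?_)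
  exact measurableSet_lt (measurable_snd.dist (hc.comp measurable_fst)) measurable_const

theorem maximalFunction_le_of_le {d : ℕ} {R : ℝ} {f : Space d → ℝ≥0∞} {B : ℝ≥0∞}
    (hf : ∀ x, f x ≤ B) (x : Space d) : maximalFunction R f x ≤ B := by
  refine iSup_le fun q => ?_
  have hq : (0 : ℝ) < (q : ℚ) := by exact_mod_cast q.2.1
  calc _ ≤ (volume (Metric.ball (0 : Space d) (q : ℚ)))⁻¹ *
        ∫⁻ z in Metric.ball x (q : ℚ), B := by gcongr; exact hf _
    _ = ((volume (Metric.ball (0 : Space d) (q : ℚ)))⁻¹ *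
        volume (Metric.ball (0 : Space d) (q : ℚ))) * B := by
        rw [setLIntegral_const, Measure.addHaar_ball_center volume x]; ring
    _ = B := by
        rw [ENNReal.inv_mul_cancel (volume_ball_ne_zero _ hq) measure_ball_lt_top.ne, one_mul]

/-- Averages of a constant are that constant; this is what allows truncating `f` at a level before
applying the weak-type bound. -/
theorem maximalFunction_le_add {d : ℕ} {R : ℝ} {f g : Space d → ℝ≥0∞} {c : ℝ≥0∞}
    (h : ∀ x, f x ≤ c + g x) (x : Space d) :
    maximalFunction R f x ≤ c + maximalFunction R g x := by
  refine iSup_le fun q => ?_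
  have hq : (0 : ℝ) < (q : ℚ) := by exact_mod_cast q.2.1
  calc _ ≤ (volume (Metric.ball (0 : Space d) (q : ℚ)))⁻¹ *
        ∫⁻ z in Metric.ball x (q : ℚ), (c + g z) := by gcongr; exact h _
    _ = ((volume (Metric.ball (0 : Space d) (q : ℚ)))⁻¹ *
        volume (Metric.ball (0 : Space d) (q : ℚ))) * c +
        (volume (Metric.ball (0 : Space d) (q : ℚ)))⁻¹ *
        ∫⁻ z in Metric.ball x (q : ℚ), g z := by
        rw [lintegral_add_left measurable_const, setLIntegral_const, Measure.addHaar_ball_center volume x]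
        ring
    _ ≤ _ := by
        rw [ENNReal.inv_mul_cancel (volume_ball_ne_zero _ hq) measure_ball_lt_top.ne, one_mul]
        gcongr
        exact le_iSup (fun q : {q : ℚ // 0 < q ∧ (q : ℝ) ≤ R} =>
          (volume (Metric.ball (0 : Space d) (q : ℚ)))⁻¹ * ∫⁻ z in Metric.ball x (q : ℚ), g z) q

/-- The weak-type estimate for the maximal function. -/
theorem mul_volume_lt_maximalFunction_le {d : ℕ} (R : ℝ) (f : Space d → ℝ≥0∞) (c : ℝ≥0∞) :
    c * volume {x | c < maximalFunction R f x} ≤ 4 ^ d * ∫⁻ x, f x := by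
  let rad : Space d × {q : ℚ // 0 < q ∧ (q : ℝ) ≤ R} → ℝ := fun a => (a.2 : ℚ)
  have hrad : ∀ a, 0 < rad a := fun a => by simpa [rad] using a.2.2.1
  let t : Set (Space d × {q : ℚ // 0 < q ∧ (q : ℝ) ≤ R}) :=
    {a | c * volume (Metric.ball (0 : Space d) (rad a)) ≤ ∫⁻ z in Metric.ball a.1 (rad a), f z}
  -- The Vitali covering lemma requires bounded radii, supplied by `R`, and an enlargement factor
  -- above 3; the factor 4 produces 4^d.
  obtain ⟨u, hut, hdisj, hcov⟩ := Vitali.exists_disjoint_subfamily_covering_enlargement_ball t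
    Prod.fst rad R (fun a _ => a.2.2.2) 4 (by norm_num)
  have hcount : u.Countable := hdisj.countable_of_isOpen (fun _ _ => Metric.isOpen_ball)
    fun a _ => Metric.nonempty_ball.2 (hrad a)
  have hsub : {x | c < maximalFunction R f x} ⊆ ⋃ b ∈ u, Metric.ball b.1 (4 * rad b) := by
    intro x hx
    obtain ⟨q, hq⟩ := lt_iSup_iff.1 (show c < maximalFunction R f x from hx)
    have hmem : (x, q) ∈ t := by
      have h0 := volume_ball_ne_zero (0 : Space d) (hrad (x, q))
      have h1 : volume (Metric.ball (0 : Space d) (rad (x, q))) ≠ ⊤ := measure_ball_lt_top.ne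
      change c * volume (Metric.ball (0 : Space d) (rad (x, q))) ≤ _
      rw [← ENNReal.le_div_iff_mul_le (Or.inl h0) (Or.inl h1), div_eq_mul_inv, mul_comm]
      exact hq.le
    obtain ⟨b, hb, hsb⟩ := hcov _ hmem
    exact mem_iUnion₂.2 ⟨b, hb, hsb (Metric.mem_ball_self (hrad _))⟩
  calc c * volume {x | c < maximalFunction R f x}
      ≤ c * ∑' b : u, volume (Metric.ball b.1.1 (4 * rad b)) := by
        gcongr
        exact (measure_mono hsub).trans (measure_biUnion_le _ hcount _)
    _ = ∑' b : u, 4 ^ d * (c * volume (Metric.ball (0 : Space d) (rad b))) := by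
        rw [← ENNReal.tsum_mul_left]
        congr 1
        funext b
        rw [Measure.addHaar_ball_mul_of_pos _ _ (by norm_num : (0 : ℝ) < 4), finrank_euclideanSpace,
          Fintype.card_fin, ENNReal.ofReal_pow (by norm_num)]
        simp only [ENNReal.ofReal_ofNat]
        ring
    _ ≤ ∑' b : u, 4 ^ d * ∫⁻ z in Metric.ball b.1.1 (rad b), f z := by
        gcongr with b
        exact hut b.2
    _ = 4 ^ d * ∫⁻ z in ⋃ b ∈ u, Metric.ball b.1 (rad b), f z := by
        rw [ENNReal.tsum_mul_left, lintegral_biUnion hcount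
          (fun _ _ => Metric.isOpen_ball.measurableSet) hdisj]
    _ ≤ _ := by gcongr; exact Measure.restrict_le_self

theorem lintegral_Ioo_rpow_sub_two {p a : ℝ} (hp : 1 < p) (ha : 0 ≤ a) :
    ∫⁻ t in Ioo 0 a, ENNReal.ofReal (t ^ (p - 2)) = ENNReal.ofReal (a ^ (p - 1) / (p - 1)) := by
  have h1 : IntervalIntegrable (fun t : ℝ => t ^ (p - 2)) volume 0 a :=
    intervalIntegral.intervalIntegrable_rpow' (by linarith)
  rw [← ofReal_integral_eq_lintegral_ofReal
    ((intervalIntegrable_iff_integrableOn_Ioo_of_le ha).1 h1)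
    ((ae_restrict_iff' measurableSet_Ioo).2 (Eventually.of_forall fun t ht =>
      Real.rpow_nonneg ht.1.le _)),
    ← integral_Ioc_eq_integral_Ioo, ← intervalIntegral.integral_of_le ha,
    integral_rpow (Or.inl (by linarith))]
  rw [show p - 2 + 1 = p - 1 by ring, Real.zero_rpow (by linarith), sub_zero]

/-- The integrand of the layer cake formula, restricted to the levels below `2 f`. -/
noncomputable def levelIntegrand {d : ℕ} (p : ℝ) (f : Space d → ℝ≥0∞) : ℝ × Space d → ℝ≥0∞ :=
  {w : ℝ × Space d | w.1 < 2 * (f w.2).toReal}.indicator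
    (fun w => ENNReal.ofReal (w.1 ^ (p - 2)) * f w.2)

theorem measurable_levelIntegrand {d : ℕ} (p : ℝ) {f : Space d → ℝ≥0∞} (hf : Measurable f) :
    Measurable (levelIntegrand p f) := by
  unfold levelIntegrand
  refine Measurable.indicator ?_ ?_
  · exact ((measurable_fst.pow_const _).ennreal_ofReal).mul (hf.comp measurable_snd)
  · exact measurableSet_lt measurable_fst ((hf.comp measurable_snd).ennreal_toReal.const_mul 2)

/-- The weak-type estimate with the integral restricted to the set where `f` is large. -/
theorem volume_lt_maximalFunction_mul_le {d : ℕ} {p : ℝ} (R : ℝ)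
    {f : Space d → ℝ≥0∞} (hf : Measurable f) {B : ℝ≥0∞} (hB : B ≠ ⊤) (hfB : ∀ x, f x ≤ B)
    {t : ℝ} (ht0 : 0 < t) :
    volume {x | t < (maximalFunction R f x).toReal} * ENNReal.ofReal (t ^ (p - 1)) ≤
      ∫⁻ x, ENNReal.ofReal (2 * 4 ^ d) *
        levelIntegrand p f (t, x) := by
  have hMt : ∀ x, maximalFunction R f x ≠ ⊤ := fun x =>
    ((maximalFunction_le_of_le hfB x).trans_lt hB.lt_top).ne
  have hft : ∀ x, f x ≠ ⊤ := fun x => ((hfB x).trans_lt hB.lt_top).ne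
  set c := ENNReal.ofReal (t / 2) with hc
  have hc0 : c ≠ 0 := by simp [hc, ht0]
  have hct : c ≠ ⊤ := by simp [hc]
  -- Splitting at half the level: f ≤ t/2 + g with g the part of f above t/2, so Mf > t forces Mg >
  -- t/2.
  set g : Space d → ℝ≥0∞ := {x | t < 2 * (f x).toReal}.indicator f with hg
  have h1 : ∀ x, f x ≤ c + g x := by
    intro x
    by_cases hx : t < 2 * (f x).toReal
    · rw [hg, indicator_of_mem (by exact hx)]; exact le_add_self
    · refine le_add_right ?_
      rw [← ENNReal.ofReal_toReal (hft x)]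
      exact ENNReal.ofReal_le_ofReal (by linarith)
  have h2 : {x | t < (maximalFunction R f x).toReal} ⊆ {x | c < maximalFunction R g x} := by
    intro x hx
    have h3 := maximalFunction_le_add (R := R) h1 x
    have h4 : ENNReal.ofReal t < maximalFunction R f x :=
      (ENNReal.ofReal_lt_iff_lt_toReal ht0.le (hMt x)).2 hx
    have h5 : ENNReal.ofReal t = c + c := by
      rw [hc, ← ENNReal.ofReal_add (by positivity) (by positivity)]; ring_nf
    rw [h5] at h4
    exact (ENNReal.add_lt_add_iff_left hct).1 (h4.trans_le h3)
  have h6 := mul_volume_lt_maximalFunction_le R g c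
  have h7 : volume {x | t < (maximalFunction R f x).toReal} ≤ c⁻¹ * (4 ^ d * ∫⁻ x, g x) := by
    refine (measure_mono h2).trans ?_
    rw [← ENNReal.div_eq_inv_mul, ENNReal.le_div_iff_mul_le (Or.inl hc0) (Or.inl hct), mul_comm]
    exact h6
  -- The weak-type bound at level c = t/2 contributes 2/t, which turns t^(p-1) into 2 t^(p-2).
  have h8 : c⁻¹ * 4 ^ d * ENNReal.ofReal (t ^ (p - 1))
      = ENNReal.ofReal (2 * 4 ^ d) * ENNReal.ofReal (t ^ (p - 2)) := by
    have h4d : (4 : ℝ≥0∞) ^ d = ENNReal.ofReal (4 ^ d) := by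
      rw [ENNReal.ofReal_pow (by norm_num)]; simp
    rw [hc, ← ENNReal.ofReal_inv_of_pos (by positivity), h4d,
      ← ENNReal.ofReal_mul (by positivity), ← ENNReal.ofReal_mul (by positivity),
      ← ENNReal.ofReal_mul (by positivity)]
    congr 1
    rw [show p - 1 = (p - 2) + 1 by ring, Real.rpow_add_one ht0.ne']
    field_simp
  calc volume {x | t < (maximalFunction R f x).toReal} * ENNReal.ofReal (t ^ (p - 1))
      ≤ c⁻¹ * (4 ^ d * ∫⁻ x, g x) * ENNReal.ofReal (t ^ (p - 1)) := by gcongr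
    _ = (c⁻¹ * 4 ^ d * ENNReal.ofReal (t ^ (p - 1))) * ∫⁻ x, g x := by ring
    _ = ∫⁻ x, ENNReal.ofReal (2 * 4 ^ d) * ENNReal.ofReal (t ^ (p - 2)) * g x := by
        rw [h8, lintegral_const_mul]
        exact hf.indicator (measurableSet_lt measurable_const (hf.ennreal_toReal.const_mul 2))
    _ = _ := by
        refine lintegral_congr fun x => ?_
        rw [mul_assoc]
        congr 1
        unfold levelIntegrand
        by_cases hx : t < 2 * (f x).toReal
        · rw [hg, indicator_of_mem (by exact hx), indicator_of_mem (by exact hx)]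
        · rw [hg, indicator_of_notMem (by exact hx), indicator_of_notMem (by exact hx), mul_zero]

/-- The time integral left after Tonelli: ∫ t^(p-2) over (0, 2f) is (2f)^(p-1)/(p-1), finite at 0
precisely because p > 1; the remaining factor f completes f^p. -/
theorem lintegral_Ioi_indicator_rpow {d : ℕ} {p : ℝ} (hp : 1 < p)
    {f : Space d → ℝ≥0∞} (x : Space d) (hft : f x ≠ ⊤) :
    ∫⁻ t in Ioi 0, ENNReal.ofReal (2 * 4 ^ d) *
        levelIntegrand p f (t, x) =
      ENNReal.ofReal ((2 * 4 ^ d) * (2 ^ (p - 1) / (p - 1))) * f x ^ p := by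
  have hp0 : 0 < p := by linarith
  have hp1 : 0 < p - 1 := by linarith
  rw [lintegral_const_mul' _ _ ENNReal.ofReal_ne_top]
  have h1 : ∫⁻ t in Ioi 0, levelIntegrand p f (t, x)
      = ∫⁻ t in Ioo 0 (2 * (f x).toReal), ENNReal.ofReal (t ^ (p - 2)) * f x := by
    rw [← Ioi_inter_Iio, inter_comm, ← Measure.restrict_restrict measurableSet_Iio,
      ← lintegral_indicator measurableSet_Iio]
    rfl
  rw [h1, lintegral_mul_const' _ _ hft,
    lintegral_Ioo_rpow_sub_two hp (by positivity),
    ENNReal.ofReal_mul (p := 2 * 4 ^ d) (by positivity), mul_assoc]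
  congr 1
  obtain ⟨y, hy0, hy⟩ : ∃ y : ℝ, 0 ≤ y ∧ f x = ENNReal.ofReal y :=
    ⟨_, ENNReal.toReal_nonneg, (ENNReal.ofReal_toReal (hft)).symm⟩
  rw [hy, ENNReal.toReal_ofReal hy0, ENNReal.ofReal_rpow_of_nonneg hy0 hp0.le,
    ← ENNReal.ofReal_mul (by positivity), ← ENNReal.ofReal_mul (by positivity)]
  congr 1
  rw [Real.mul_rpow (by norm_num) hy0]
  rcases hy0.eq_or_lt with rfl | hy1
  · rw [Real.zero_rpow hp0.ne']; ring
  · rw [Real.rpow_sub_one hy1.ne']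
    field_simp

/-- The strong-type estimate for the maximal function of a bounded function. -/
theorem lintegral_maximalFunction_rpow_le {d : ℕ} {p : ℝ} (hp : 1 < p) (R : ℝ)
    {f : Space d → ℝ≥0∞} (hf : Measurable f) {B : ℝ≥0∞} (hB : B ≠ ⊤) (hfB : ∀ x, f x ≤ B) :
    ∫⁻ x, maximalFunction R f x ^ p ≤
      ENNReal.ofReal (p * (2 * 4 ^ d) * (2 ^ (p - 1) / (p - 1))) * ∫⁻ x, f x ^ p := by
  have hp0 : 0 < p := by linarith
  have hp1 : 0 < p - 1 := by linarith
  have hM : Measurable (fun x => maximalFunction R f x) :=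
    measurable_maximalFunction R (f := fun _ : Space d => f) (hf.comp measurable_snd) measurable_id
  -- Boundedness of `f` keeps Mf finite, so nothing is lost in passing to real values for the layer
  -- cake formula.
  have hMt : ∀ x, maximalFunction R f x ≠ ⊤ := fun x =>
    ((maximalFunction_le_of_le hfB x).trans_lt hB.lt_top).ne
  have hft : ∀ x, f x ≠ ⊤ := fun x => ((hfB x).trans_lt hB.lt_top).ne
  have hind := measurable_levelIntegrand p hf
  have h1 : ∫⁻ x, maximalFunction R f x ^ p
      = ENNReal.ofReal p * ∫⁻ t in Ioi 0, volume {x | t < (maximalFunction R f x).toReal} *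
          ENNReal.ofReal (t ^ (p - 1)) := by
    rw [← lintegral_rpow_eq_lintegral_meas_lt_mul volume
      (Eventually.of_forall fun _ => ENNReal.toReal_nonneg) hM.ennreal_toReal.aemeasurable hp0]
    refine lintegral_congr fun x => ?_
    rw [← ENNReal.ofReal_rpow_of_nonneg ENNReal.toReal_nonneg hp0.le,
      ENNReal.ofReal_toReal (hMt x)]
  have h2 : ∫⁻ t in Ioi 0, volume {x | t < (maximalFunction R f x).toReal} *
          ENNReal.ofReal (t ^ (p - 1)) ≤
        ∫⁻ t in Ioi 0, ∫⁻ x, ENNReal.ofReal (2 * 4 ^ d) * levelIntegrand p f (t, x) :=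
    setLIntegral_mono' measurableSet_Ioi fun t ht =>
      volume_lt_maximalFunction_mul_le R hf hB hfB ht
  have h3 : ∫⁻ t in Ioi 0, ∫⁻ x, ENNReal.ofReal (2 * 4 ^ d) * levelIntegrand p f (t, x) =
      ∫⁻ x, ∫⁻ t in Ioi 0, ENNReal.ofReal (2 * 4 ^ d) * levelIntegrand p f (t, x) :=
    lintegral_lintegral_swap (μ := volume.restrict (Ioi (0 : ℝ))) (ν := (volume : Measure (Space d)))
      (f := fun t x => ENNReal.ofReal (2 * 4 ^ d) * levelIntegrand p f (t, x))
      (hind.const_mul _).aemeasurable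
  rw [h1]
  refine (mul_le_mul_right (h2.trans_eq h3) _).trans_eq ?_
  simp_rw [fun x => lintegral_Ioi_indicator_rpow hp x (hft x)]
  rw [lintegral_const_mul _ (hf.pow_const p), ← mul_assoc, ← ENNReal.ofReal_mul hp0.le, mul_assoc p]

/-! ### Increments of a C¹ field bounded by the maximal function of its gradient -/

theorem setLIntegral_ball_eq {d : ℕ} (x : Space d) (r : ℝ) (f : Space d → ℝ≥0∞) :
    ∫⁻ z in Metric.ball x r, f z = ∫⁻ w in Metric.ball (0 : Space d) r, f (x + w) := by
  rw [← lintegral_indicator Metric.isOpen_ball.measurableSet,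
    ← lintegral_indicator Metric.isOpen_ball.measurableSet,
    ← lintegral_add_left_eq_self _ x]
  refine lintegral_congr fun w => ?_
  simp only [indicator, Metric.mem_ball, dist_zero_right, dist_self_add_left]

theorem setLIntegral_ball_smul {d : ℕ} {f : Space d → ℝ≥0∞} {s r : ℝ} (hs : 0 < s) :
    ∫⁻ w in Metric.ball (0 : Space d) r, f (s • w)
      = ENNReal.ofReal (s ^ d)⁻¹ * ∫⁻ w in Metric.ball (0 : Space d) (s * r), f w := by
  rw [← lintegral_indicator Metric.isOpen_ball.measurableSet,
    ← lintegral_indicator Metric.isOpen_ball.measurableSet]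
  have h1 : ∀ w, (Metric.ball (0 : Space d) r).indicator (fun w => f (s • w)) w =
      (Metric.ball (0 : Space d) (s * r)).indicator f (s • w) := by
    intro w
    simp only [indicator, Metric.mem_ball, dist_zero_right, norm_smul, Real.norm_eq_abs,
      abs_of_pos hs, mul_lt_mul_iff_right₀ hs]
  simp_rw [h1]
  have h2 := Measure.map_addHaar_smul (volume : Measure (Space d)) hs.ne'
  have h3 : MeasurableEmbedding fun w : Space d => s • w :=
    (Homeomorph.smulOfNeZero s hs.ne').measurableEmbedding
  rw [← h3.lintegral_map, h2, lintegral_smul_measure, finrank_euclideanSpace, Fintype.card_fin,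
    abs_of_pos (by positivity), smul_eq_mul]

/-- The radius r is enlarged to a rational one in (r, 2r); this costs the factor 2^d and explains
the condition 2r ≤ R. -/
theorem setLIntegral_ball_le_maximalFunction {d : ℕ} {f : Space d → ℝ≥0∞} {R r : ℝ} (x : Space d)
    (hr : 0 < r) (hR : 2 * r ≤ R) :
    ∫⁻ z in Metric.ball x r, f z ≤
      2 ^ d * volume (Metric.ball (0 : Space d) r) * maximalFunction R f x := by
  obtain ⟨q, hq1, hq2⟩ := exists_rat_btwn (show r < 2 * r by linarith)
  have hq0 : (0 : ℝ) < q := hr.trans hq1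
  have h1 := le_iSup (fun q : {q : ℚ // 0 < q ∧ (q : ℝ) ≤ R} =>
    (volume (Metric.ball (0 : Space d) (q : ℚ)))⁻¹ * ∫⁻ z in Metric.ball x (q : ℚ), f z)
    ⟨q, by exact_mod_cast hq0, hq2.le.trans hR⟩
  rw [← ENNReal.div_eq_inv_mul, ENNReal.div_le_iff (volume_ball_ne_zero _ hq0)
    measure_ball_lt_top.ne] at h1
  calc ∫⁻ z in Metric.ball x r, f z ≤ ∫⁻ z in Metric.ball x q, f z :=
        lintegral_mono_set (Metric.ball_subset_ball hq1.le)
    _ ≤ maximalFunction R f x * volume (Metric.ball (0 : Space d) q) := h1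
    _ ≤ maximalFunction R f x * volume (Metric.ball (0 : Space d) (2 * r)) := by
        gcongr
    _ = _ := by
        rw [Measure.addHaar_ball_mul_of_pos _ _ (by norm_num : (0 : ℝ) < 2),
          finrank_euclideanSpace, Fintype.card_fin, ENNReal.ofReal_pow (by norm_num)]
        simp only [ENNReal.ofReal_ofNat]
        ring

section

variable {d : ℕ} {Λ : ℝ} {v : Space d → Space d} {v' : Space d → Space d →L[ℝ] Space d}

theorem enorm_add_sub_le_lintegral (hv : ∀ x, HasFDerivAt v (v' x) x) (hΛ : ∀ x, ‖v' x‖ ≤ Λ)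
    (x w : Space d) :
    ‖v (x + w) - v x‖ₑ ≤ ∫⁻ s in Ioo (0 : ℝ) 1, ‖v' (x + s • w)‖ₑ * ‖w‖ₑ := by
  have hder : ∀ s : ℝ, HasDerivAt (fun s : ℝ => v (x + s • w)) (v' (x + s • w) w) s := by
    intro s
    have h2 : HasDerivAt (fun r : ℝ => x + r • w) w s := by
      simpa using ((hasDerivAt_id s).smul_const w).const_add x
    exact (hv _).comp_hasDerivAt s h2
  have hlip : ∀ a b, ‖v a - v b‖ ≤ Λ * ‖a - b‖ := fun a b =>
    convex_univ.norm_image_sub_le_of_norm_hasFDerivWithin_le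
      (fun z _ => (hv z).hasFDerivWithinAt) (fun z _ => hΛ z) (mem_univ b) (mem_univ a)
  have hac : AbsolutelyContinuousOnInterval (fun s : ℝ => v (x + s • w)) 0 1 := by
    refine LipschitzOnWith.absolutelyContinuousOnInterval (K := (Λ * ‖w‖).toNNReal)
      (LipschitzOnWith.of_dist_le_mul fun a _ b _ => ?_)
    have hΛ0 : 0 ≤ Λ := (norm_nonneg _).trans (hΛ 0)
    rw [Real.coe_toNNReal _ (by positivity), dist_eq_norm, dist_eq_norm]
    refine (hlip _ _).trans (le_of_eq ?_)
    rw [add_sub_add_left_eq_sub, ← sub_smul, norm_smul]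
    ring
  have := enorm_sub_le_lintegral hac (Eventually.of_forall hder) le_rfl zero_le_one le_rfl
  simp only [one_smul, zero_smul, add_zero] at this
  refine this.trans (lintegral_mono fun s => ?_)
  exact ContinuousLinearMap.le_opENorm _ _

/-- Integrate the bound along segments over the ball and exchange the integrals. After the
substitution w ↦ s w the Jacobian s^(-d) cancels the volume factor s^d of the smaller ball, so the
bound is uniform in s. Dominating the gradient by `f` on the ball alone is enough, which permits
cutting it off further out. -/
theorem setLIntegral_enorm_sub_le (hv : ∀ x, HasFDerivAt v (v' x) x) (hΛ : ∀ x, ‖v' x‖ ≤ Λ)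
    (hv' : Measurable v') {f : Space d → ℝ≥0∞} {R r : ℝ} {x : Space d} (hr : 0 < r)
    (hR : 2 * r ≤ R) (hf : ∀ z ∈ Metric.ball x r, ‖v' z‖ₑ ≤ f z) :
    ∫⁻ z in Metric.ball x r, ‖v z - v x‖ₑ ≤
      ENNReal.ofReal r * (2 ^ d * volume (Metric.ball (0 : Space d) r) * maximalFunction R f x) := by
  rw [setLIntegral_ball_eq x r fun z => ‖v z - v x‖ₑ]
  have hmeas : Measurable (Function.uncurry fun (w : Space d) (s : ℝ) =>
      ‖v' (x + s • w)‖ₑ * ENNReal.ofReal r) :=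
    ((hv'.comp (measurable_const.add (measurable_snd.smul measurable_fst))).enorm).mul_const _
  calc ∫⁻ w in Metric.ball (0 : Space d) r, ‖v (x + w) - v x‖ₑ
      ≤ ∫⁻ w in Metric.ball (0 : Space d) r, ∫⁻ s in Ioo (0 : ℝ) 1,
          ‖v' (x + s • w)‖ₑ * ENNReal.ofReal r := by
        refine setLIntegral_mono' Metric.isOpen_ball.measurableSet fun w hw => ?_
        refine (enorm_add_sub_le_lintegral hv hΛ x w).trans (lintegral_mono fun s => ?_)
        gcongr
        rw [← ofReal_norm]
        exact ENNReal.ofReal_le_ofReal (mem_ball_zero_iff.1 hw).le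
    _ = ∫⁻ s in Ioo (0 : ℝ) 1, ∫⁻ w in Metric.ball (0 : Space d) r,
          ‖v' (x + s • w)‖ₑ * ENNReal.ofReal r :=
        lintegral_lintegral_swap hmeas.aemeasurable
    _ ≤ ∫⁻ s in Ioo (0 : ℝ) 1, ENNReal.ofReal r *
          (2 ^ d * volume (Metric.ball (0 : Space d) r) * maximalFunction R f x) := by
        refine setLIntegral_mono' measurableSet_Ioo fun s hs => ?_
        rw [lintegral_mul_const' _ _ ENNReal.ofReal_ne_top, mul_comm]
        gcongr
        rw [setLIntegral_ball_smul (f := fun w => ‖v' (x + w)‖ₑ) hs.1,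
          ← setLIntegral_ball_eq x (s * r) fun z => ‖v' z‖ₑ]
        have hsr : s * r ≤ r := mul_le_of_le_one_left hr.le hs.2.le
        have h1 : ∫⁻ z in Metric.ball x (s * r), ‖v' z‖ₑ ≤ ∫⁻ z in Metric.ball x (s * r), f z :=
          setLIntegral_mono' Metric.isOpen_ball.measurableSet fun z hz =>
            hf z (Metric.ball_subset_ball hsr hz)
        have h2 := setLIntegral_ball_le_maximalFunction (f := f) (R := R) x (mul_pos hs.1 hr)
          (by linarith)
        refine (mul_le_mul_right (h1.trans h2) _).trans (le_of_eq ?_)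
        rw [Measure.addHaar_ball_mul_of_pos _ _ hs.1, finrank_euclideanSpace, Fintype.card_fin]
        have h3 : ENNReal.ofReal (s ^ d)⁻¹ * ENNReal.ofReal (s ^ d) = 1 := by
          rw [← ENNReal.ofReal_mul (by have := hs.1; positivity),
            inv_mul_cancel₀ (by have := hs.1; positivity), ENNReal.ofReal_one]
        calc _ = (ENNReal.ofReal (s ^ d)⁻¹ * ENNReal.ofReal (s ^ d)) *
              (2 ^ d * volume (Metric.ball (0 : Space d) r) * maximalFunction R f x) := by ring
          _ = _ := by rw [h3, one_mul]
    _ = _ := by simp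

/-- The increments of a differentiable field are controlled by the maximal function of its
gradient at the two end points. -/
theorem enorm_sub_le_maximalFunction (hv : ∀ x, HasFDerivAt v (v' x) x) (hΛ : ∀ x, ‖v' x‖ ≤ Λ)
    (hv' : Measurable v') {f : Space d → ℝ≥0∞} {R : ℝ}
    (hf : ∀ z ∈ Metric.ball (0 : Space d) (3 * R), ‖v' z‖ₑ ≤ f z) {x y : Space d}
    (hx : x ∈ Metric.ball (0 : Space d) R) (hy : y ∈ Metric.ball (0 : Space d) R) :
    ‖v x - v y‖ₑ ≤ 4 ^ d * ‖x - y‖ₑ *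
      (maximalFunction (4 * R) f x + maximalFunction (4 * R) f y) := by
  rcases eq_or_ne x y with rfl | hxy
  · simp
  rw [mem_ball_zero_iff] at hx hy
  set r := ‖x - y‖ with hr
  have hr0 : 0 < r := norm_pos_iff.2 (sub_ne_zero.2 hxy)
  -- This fixes the radii: balls of radius r around points of B(0, R) stay in B(0, 3R), and doubled
  -- radii stay below 4R.
  have hrR : r < 2 * R := (norm_sub_le x y).trans_lt (by linarith)
  have hball : ∀ a : Space d, ‖a‖ < R → Metric.ball a r ⊆ Metric.ball 0 (3 * R) := by
    intro a ha
    refine Metric.ball_subset_ball' ?_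
    rw [dist_zero_right]; linarith
  have hIx := setLIntegral_enorm_sub_le hv hΛ hv' (R := 4 * R) hr0 (by linarith)
    fun z hz => hf z (hball x hx hz)
  have hIy := setLIntegral_enorm_sub_le hv hΛ hv' (R := 4 * R) hr0 (by linarith)
    fun z hz => hf z (hball y hy hz)
  set V := volume (Metric.ball (0 : Space d) r)
  have hV0 : V ≠ 0 := volume_ball_ne_zero _ hr0
  have hVt : V ≠ ⊤ := measure_ball_lt_top.ne
  -- The ball of radius r/2 about the midpoint lies in both B(x, r) and B(y, r), so the triangle
  -- inequality through v(z) may be averaged over it. Its volume ratio gives one factor 2^d, the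
  -- rounding of radii in the maximal function the other.
  set m := midpoint ℝ x y
  have hmx : Metric.ball m (2⁻¹ * r) ⊆ Metric.ball x r := by
    refine Metric.ball_subset_ball' ?_
    rw [dist_midpoint_left, dist_eq_norm, ← hr]
    norm_num; linarith
  have hmy : Metric.ball m (2⁻¹ * r) ⊆ Metric.ball y r := by
    refine Metric.ball_subset_ball' ?_
    rw [dist_midpoint_right, dist_eq_norm, ← hr]
    norm_num; linarith
  have hvol : V = 2 ^ d * volume (Metric.ball m (2⁻¹ * r)) := by
    rw [Measure.addHaar_ball_mul_of_pos _ _ (by norm_num : (0 : ℝ) < 2⁻¹),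
          finrank_euclideanSpace, Fintype.card_fin, ENNReal.ofReal_pow (by norm_num),
          ENNReal.ofReal_inv_of_pos (by norm_num), ENNReal.ofReal_ofNat, ← mul_assoc, ← mul_pow,
          ENNReal.mul_inv_cancel (by norm_num) (by norm_num), one_pow, one_mul]
  have hvm : Measurable v := (continuous_iff_continuousAt.2
    fun x => (hv x).continuousAt).measurable
  have key : V * ‖v x - v y‖ₑ ≤ V * (4 ^ d * ‖x - y‖ₑ *
      (maximalFunction (4 * R) f x + maximalFunction (4 * R) f y)) := by
    calc V * ‖v x - v y‖ₑ = 2 ^ d * ∫⁻ z in Metric.ball m (2⁻¹ * r), ‖v x - v y‖ₑ := by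
          rw [setLIntegral_const, hvol]; ring
      _ ≤ 2 ^ d * ∫⁻ z in Metric.ball m (2⁻¹ * r), (‖v z - v x‖ₑ + ‖v z - v y‖ₑ) := by
          gcongr with z
          rw [← enorm_neg (v z - v x), neg_sub]
          refine le_trans (le_of_eq ?_) (enorm_add_le _ _)
          congr 1; abel
      _ = 2 ^ d * ((∫⁻ z in Metric.ball m (2⁻¹ * r), ‖v z - v x‖ₑ) +
            ∫⁻ z in Metric.ball m (2⁻¹ * r), ‖v z - v y‖ₑ) := by
          rw [lintegral_add_left (hvm.sub_const _).enorm]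
      _ ≤ 2 ^ d * ((∫⁻ z in Metric.ball x r, ‖v z - v x‖ₑ) +
            ∫⁻ z in Metric.ball y r, ‖v z - v y‖ₑ) := by
          gcongr
      _ ≤ 2 ^ d * (ENNReal.ofReal r * (2 ^ d * V * maximalFunction (4 * R) f x) +
            ENNReal.ofReal r * (2 ^ d * V * maximalFunction (4 * R) f y)) := by
          gcongr
      _ = _ := by
          rw [hr, ofReal_norm, show (4 : ℝ≥0∞) ^ d = 2 ^ d * 2 ^ d by rw [← mul_pow]; norm_num]
          ring
  exact (ENNReal.mul_le_mul_iff_right hV0 hVt).1 key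

end

/-! ### Periodic functions and the unit cube -/

section

open scoped Pointwise

/-- The standard basis of `ℝ^d`. -/
noncomputable abbrev stdBasis (d : ℕ) : Module.Basis (Fin d) ℝ (Space d) :=
  (EuclideanSpace.basisFun (Fin d) ℝ).toBasis

/-- The lattice `ℤ^d` in `ℝ^d`. -/
abbrev latticeZ (d : ℕ) : AddSubgroup (Space d) :=
  (Submodule.span ℤ (range (stdBasis d))).toAddSubgroup

instance countable_latticeZ (d : ℕ) : Countable (latticeZ d) :=
  inferInstanceAs (Countable (Submodule.span ℤ (range (stdBasis d))))

theorem unitCube_eq_fundamentalDomain (d : ℕ) :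
    unitCube d = ZSpan.fundamentalDomain (stdBasis d) := by
  ext x
  simp [unitCube, ZSpan.mem_fundamentalDomain]

theorem measurableSet_unitCube (d : ℕ) : MeasurableSet (unitCube d) := by
  rw [unitCube_eq_fundamentalDomain]
  exact ZSpan.fundamentalDomain_measurableSet _

theorem isAddFundamentalDomain_unitCube (d : ℕ) :
    IsAddFundamentalDomain (latticeZ d) (unitCube d) volume := by
  rw [unitCube_eq_fundamentalDomain]
  exact ZSpan.isAddFundamentalDomain' (stdBasis d) volume

theorem IsPeriodic.add_of_mem {d : ℕ} {F : Type*} {f : Space d → F} (hf : IsPeriodic f)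
    {z : Space d} (hz : z ∈ latticeZ d) (x : Space d) : f (x + z) = f x := by
  change z ∈ Submodule.span ℤ (range (stdBasis d)) at hz
  revert x
  induction hz using Submodule.span_induction with
  | mem z hz =>
    obtain ⟨i, rfl⟩ := hz
    intro x
    simpa using hf i x
  | zero => simp
  | add y z _ _ hy hz => intro x; rw [← add_assoc, hz, hy]
  | smul n z _ hz =>
    intro x
    induction n generalizing x with
    | zero => simp
    | succ k ih => rw [add_smul, one_smul, ← add_assoc, hz, ih]
    | pred k ih =>
      rw [← hz (x + _), sub_smul, one_smul, add_assoc, sub_add_cancel]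
      exact ih x

theorem IsPeriodic.comp {d : ℕ} {F G : Type*} {f : Space d → F} (hf : IsPeriodic f) (g : F → G) :
    IsPeriodic fun x => g (f x) := fun i x => congrArg g (hf i x)

/-- The representative in the unit cube of a point of the torus. -/
noncomputable def fractPt {d : ℕ} (x : Space d) : Space d := ZSpan.fract (stdBasis d) x

theorem IsPeriodic.apply_fractPt {d : ℕ} {F : Type*} {f : Space d → F} (hf : IsPeriodic f)
    (x : Space d) : f (fractPt x) = f x := by
  have h : x = fractPt x + (ZSpan.floor (stdBasis d) x : Space d) := by
    simp [fractPt, ZSpan.fract_apply]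
  conv_rhs => rw [h]
  exact (hf.add_of_mem (ZSpan.floor (stdBasis d) x).2 _).symm

theorem fractPt_apply {d : ℕ} (x : Space d) (i : Fin d) : fractPt x i = Int.fract (x i) := by
  have := ZSpan.repr_fract_apply (stdBasis d) x i
  simp only [stdBasis, OrthonormalBasis.coe_toBasis_repr_apply,
    EuclideanSpace.basisFun_repr] at this
  exact this

theorem isPeriodic_fractPt (d : ℕ) : IsPeriodic (fractPt : Space d → Space d) := fun i x => by
  ext j
  rw [fractPt_apply, fractPt_apply]
  by_cases h : j = i
  · subst h; simp
  · simp [h]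

theorem measurable_fractPt (d : ℕ) : Measurable (fractPt : Space d → Space d) := by
  have h : Measurable fun x : Space d => WithLp.ofLp (fractPt x) := by
    refine measurable_pi_iff.2 fun i => ?_
    simp only [fractPt_apply]
    exact (by fun_prop : Measurable fun x : Space d => x i).fract
  exact (WithLp.measurable_toLp 2 _).comp h

/-- The preimage of a null set is invariant under the lattice and meets the fundamental cube in a
null set, so it is null in ℝ^d. Almost-everywhere statements thus pass from the torus to ℝ^d. -/
theorem quasiMeasurePreserving_fractPt (d : ℕ) :
    Measure.QuasiMeasurePreserving (fractPt : Space d → Space d) volume (torusMeasure d) := by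
  refine ⟨measurable_fractPt d, Measure.AbsolutelyContinuous.mk fun N hN h0 => ?_⟩
  rw [Measure.map_apply (measurable_fractPt d) hN]
  refine (isAddFundamentalDomain_unitCube d).measure_zero_of_invariant _ (fun g => ?_) ?_
  · ext x
    rw [mem_vadd_set_iff_neg_vadd_mem, mem_preimage, mem_preimage]
    have : fractPt (-g +ᵥ x) = fractPt x := by
      rw [AddSubgroup.vadd_def, vadd_eq_add, add_comm]
      exact (isPeriodic_fractPt d).add_of_mem (-g).2 x
    rw [this]
  · rw [torusMeasure, Measure.restrict_apply hN] at h0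
    refine measure_mono_null (t := N ∩ unitCube d) (fun x hx => ⟨?_, hx.2⟩) h0
    have : fractPt x = x := by
      ext i
      rw [fractPt_apply, Int.fract_eq_self.2 (hx.2 i)]
    rw [← this]
    exact hx.1

/-- A translate of the cube is again a fundamental domain, and an invariant function has the same
integral over each of them. -/
theorem IsPeriodic.setLIntegral_add {d : ℕ} {g : Space d → ℝ≥0∞} (hg : IsPeriodic g)
    (a : Space d) : ∫⁻ x, g (x + a) ∂torusMeasure d = ∫⁻ x, g x ∂torusMeasure d := by
  have h1 := isAddFundamentalDomain_unitCube d
  have h2 : IsAddFundamentalDomain (latticeZ d) (a +ᵥ unitCube d) volume := h1.vadd_of_comm a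
  have h3 := h1.setLIntegral_eq h2 g fun z x => by
    rw [AddSubgroup.vadd_def, vadd_eq_add, add_comm]; exact hg.add_of_mem z.2 x
  rw [torusMeasure, h3, ← lintegral_indicator (measurableSet_unitCube d),
    ← lintegral_indicator ((measurableSet_unitCube d).const_vadd a), ← lintegral_add_right_eq_self _ (-a)]
  refine lintegral_congr fun x => ?_
  have : x ∈ a +ᵥ unitCube d ↔ x + -a ∈ unitCube d := by
    rw [mem_vadd_set_iff_neg_vadd_mem, vadd_eq_add, add_comm]
  by_cases hx : x + -a ∈ unitCube d
  · rw [indicator_of_mem hx, indicator_of_mem (this.2 hx), neg_add_cancel_right]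
  · rw [indicator_of_notMem hx, indicator_of_notMem (fun h => hx (this.1 h))]

theorem IsPeriodic.setLIntegral_sub {d : ℕ} {g : Space d → ℝ≥0∞} (hg : IsPeriodic g)
    (a : Space d) : ∫⁻ x, g (x - a) ∂torusMeasure d = ∫⁻ x, g x ∂torusMeasure d := by
  simpa [sub_eq_add_neg] using hg.setLIntegral_add (-a)

theorem ae_of_ae_torusMeasure {d : ℕ} {P : Space d → Prop} (hP : ∀ᵐ x ∂torusMeasure d, P x)
    (hper : IsPeriodic P) : ∀ᵐ x : Space d, P x := by
  filter_upwards [(quasiMeasurePreserving_fractPt d).ae hP] with x hx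
  rwa [hper.apply_fractPt] at hx

instance isProbabilityMeasure_torusMeasure (d : ℕ) : IsProbabilityMeasure (torusMeasure d) := by
  refine ⟨?_⟩
  have h : unitCube d = WithLp.ofLp ⁻¹' (Set.pi univ fun _ : Fin d => Ico (0 : ℝ) 1) := by
    ext x; simp [unitCube]
  rw [torusMeasure, Measure.restrict_apply_univ, h,
    (PiLp.volume_preserving_ofLp (Fin d)).measure_preimage
      (MeasurableSet.univ_pi fun _ => measurableSet_Ico).nullMeasurableSet, Real.volume_pi_Ico]
  simp

theorem unitCube_subset_ball (d : ℕ) : unitCube d ⊆ Metric.ball 0 (d + 1) := by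
  intro x hx
  rw [mem_ball_zero_iff]
  have h1 : ‖x‖ ≤ ∑ i : Fin d, ‖x i‖ := by
    rw [EuclideanSpace.norm_eq]
    refine Real.sqrt_le_iff.2 ⟨Finset.sum_nonneg fun _ _ => norm_nonneg _, ?_⟩
    exact Finset.sum_sq_le_sq_sum_of_nonneg fun _ _ => norm_nonneg _
  have h2 : ∑ i : Fin d, ‖x i‖ ≤ ∑ i : Fin d, (1 : ℝ) := Finset.sum_le_sum fun i _ => by
    rw [Real.norm_of_nonneg (hx i).1]; exact (hx i).2.le
  rw [Finset.sum_const, Finset.card_univ, Fintype.card_fin, nsmul_eq_mul, mul_one] at h2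
  linarith

/-- The integral of a periodic function over a ball is at most a multiple of its integral over
the torus. -/
theorem exists_setLIntegral_ball_le (d : ℕ) (R : ℝ) :
    ∃ n : ℕ, ∀ g : Space d → ℝ≥0∞, IsPeriodic g →
      ∫⁻ x in Metric.ball 0 R, g x ≤ n * ∫⁻ x, g x ∂torusMeasure d := by
  obtain ⟨k, hk⟩ := exists_nat_gt R
  -- The ball is covered by the cubes translated by integer vectors with entries in [-k, k]; the
  -- constant is their number.
  let S : Finset (Fin d → ℤ) := Fintype.piFinset fun _ => Finset.Icc (-(k : ℤ)) k
  let vec : (Fin d → ℤ) → Space d := fun n => WithLp.toLp 2 fun i => (n i : ℝ)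
  refine ⟨S.card, fun g hg => ?_⟩
  have hvec : ∀ n, vec n ∈ latticeZ d := by
    intro n
    have : vec n = ∑ i, n i • stdBasis d i := by
      ext j
      simp [vec, Pi.single_apply]
    rw [this]
    exact (Submodule.span ℤ (range (stdBasis d))).sum_mem fun i _ =>
      Submodule.smul_mem _ _ (Submodule.subset_span ⟨i, rfl⟩)
  have hcov : Metric.ball (0 : Space d) R ⊆ ⋃ n : S, (fun x => x - vec n) ⁻¹' unitCube d := by
    intro x hx
    rw [mem_ball_zero_iff] at hx
    refine mem_iUnion.2 ⟨⟨fun i => ⌊x i⌋, ?_⟩, fun i => ?_⟩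
    · refine Fintype.mem_piFinset.2 fun i => Finset.mem_Icc.2 ?_
      have h1 : |x i| ≤ k := by
        rw [← Real.norm_eq_abs]
        exact (PiLp.norm_apply_le x i).trans (by linarith)
      rw [abs_le] at h1
      exact ⟨Int.le_floor.2 (by push_cast; exact h1.1),
        (Int.floor_le_floor h1.2).trans (by simp)⟩
    · have : (x - vec fun i => ⌊x i⌋) i = Int.fract (x i) := by
        simp [vec]
      change (x - vec fun i => ⌊x i⌋) i ∈ _
      rw [this]
      exact ⟨Int.fract_nonneg _, Int.fract_lt_one _⟩
  calc ∫⁻ x in Metric.ball 0 R, g x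
      ≤ ∫⁻ x in ⋃ n : S, (fun x => x - vec n) ⁻¹' unitCube d, g x := lintegral_mono_set hcov
    _ ≤ ∑' n : S, ∫⁻ x in (fun x => x - vec n) ⁻¹' unitCube d, g x := lintegral_iUnion_le _ _
    _ = ∑' n : S, ∫⁻ x, g x ∂torusMeasure d := by
        congr 1
        funext n
        have hm : MeasurableSet ((fun x : Space d => x - vec n) ⁻¹' unitCube d) :=
          (measurable_id.sub_const _) (measurableSet_unitCube d)
        rw [torusMeasure, ← lintegral_indicator hm, ← lintegral_indicator (measurableSet_unitCube d),
          ← lintegral_add_right_eq_self _ (vec n)]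
        refine lintegral_congr fun x => ?_
        have h1 : x + vec n ∈ (fun x : Space d => x - vec n) ⁻¹' unitCube d ↔ x ∈ unitCube d := by
          rw [mem_preimage, add_sub_cancel_right]
        by_cases hx : x ∈ unitCube d
        · rw [indicator_of_mem hx, indicator_of_mem (h1.2 hx), hg.add_of_mem (hvec n)]
        · rw [indicator_of_notMem hx, indicator_of_notMem (fun h => hx (h1.1 h))]
    _ = _ := by simp [tsum_fintype]

end

/-! ### Convolution of periodic Sobolev fields -/

/-- A smooth nonnegative convolution kernel of integral one supported in the ball of radius `δ`. -/
structure IsKernel {d : ℕ} (δ : ℝ) (ρ : Space d → ℝ) : Prop where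
  smooth : ContDiff ℝ ((⊤ : ℕ∞) : WithTop ℕ∞) ρ
  nonneg : ∀ x, 0 ≤ ρ x
  eq_zero : ∀ x, δ < ‖x‖ → ρ x = 0
  integral_eq_one : ∫ x, ρ x = 1

theorem IsMollifier.isKernel_rescale {d : ℕ} {η : Space d → ℝ} (hη : IsMollifier η) {δ : ℝ}
    (hδ : 0 < δ) : IsKernel δ (rescale η δ) where
  smooth := contDiff_const.mul (hη.smooth.comp (contDiff_const_smul _))
  nonneg x := mul_nonneg (by positivity) (hη.nonneg _)
  eq_zero x hx := by
    have : δ⁻¹ • x ∉ tsupport η := fun h => by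
      have := hη.support h
      rw [mem_closedBall_zero_iff, norm_smul, norm_inv, Real.norm_of_nonneg hδ.le,
        inv_mul_le_iff₀ hδ, mul_one] at this
      linarith
    rw [rescale, image_eq_zero_of_notMem_tsupport this, mul_zero]
  integral_eq_one := by
    simp only [rescale]
    rw [integral_const_mul, Measure.integral_comp_inv_smul, hη.integral_eq_one,
      finrank_euclideanSpace, Fintype.card_fin, abs_of_pos (by positivity), smul_eq_mul, mul_one,
      inv_mul_cancel₀ (by positivity)]

/-- Bump functions serve as a second, auxiliary family of kernels, used to approximate a Sobolev
field by smooth ones. -/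
theorem _root_.ContDiffBump.isKernel_normed {d : ℕ} (φ : ContDiffBump (0 : Space d)) :
    IsKernel φ.rOut (φ.normed volume) where
  smooth := φ.contDiff_normed
  nonneg x := φ.nonneg_normed x
  eq_zero x hx := by
    have : x ∉ Function.support (φ.normed volume) := by
      rw [φ.support_normed_eq, mem_ball_zero_iff]; exact not_lt.2 hx.le
    simpa using this
  integral_eq_one := φ.integral_normed

namespace IsKernel

variable {d : ℕ} {δ : ℝ} {ρ : Space d → ℝ}

theorem hasCompactSupport (h : IsKernel δ ρ) : HasCompactSupport ρ :=
  HasCompactSupport.of_support_subset_isCompact (isCompact_closedBall 0 δ) fun x hx => by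
    rw [mem_closedBall_zero_iff]
    exact not_lt.1 fun hlt => hx (h.eq_zero x hlt)

theorem continuous (h : IsKernel δ ρ) : Continuous ρ := h.smooth.continuous

theorem integrable (h : IsKernel δ ρ) : Integrable ρ :=
  h.continuous.integrable_of_hasCompactSupport h.hasCompactSupport

/-- The probability measure with density `ρ`. -/
noncomputable def _root_.TorusFlow.kernelMeasure (ρ : Space d → ℝ) : Measure (Space d) :=
  volume.withDensity fun z => ENNReal.ofReal (ρ z)

theorem isProbabilityMeasure (h : IsKernel δ ρ) : IsProbabilityMeasure (kernelMeasure ρ) := by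
  refine ⟨?_⟩
  rw [kernelMeasure, withDensity_apply _ MeasurableSet.univ, Measure.restrict_univ,
    ← ofReal_integral_eq_lintegral_ofReal h.integrable (Eventually.of_forall h.nonneg),
    h.integral_eq_one, ENNReal.ofReal_one]

theorem lintegral_kernelMeasure (h : IsKernel δ ρ) (f : Space d → ℝ≥0∞) :
    ∫⁻ z, f z ∂kernelMeasure ρ = ∫⁻ z, ENNReal.ofReal (ρ z) * f z := by
  rw [kernelMeasure, lintegral_withDensity_eq_lintegral_mul_non_measurable _
    h.continuous.measurable.ennreal_ofReal (Eventually.of_forall fun _ => ENNReal.ofReal_lt_top)]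
  rfl

theorem ae_norm_le (h : IsKernel δ ρ) : ∀ᵐ z ∂kernelMeasure ρ, ‖z‖ ≤ δ := by
  rw [kernelMeasure, ae_withDensity_iff h.continuous.measurable.ennreal_ofReal]
  refine Eventually.of_forall fun z hz => not_lt.1 fun hlt => hz ?_
  rw [h.eq_zero z hlt, ENNReal.ofReal_zero]

theorem enorm_integral_smul_le (h : IsKernel δ ρ) {F : Type*} [NormedAddCommGroup F]
    [NormedSpace ℝ F] (f : Space d → F) :
    ‖∫ z, ρ z • f z‖ₑ ≤ ∫⁻ z, ‖f z‖ₑ ∂kernelMeasure ρ := by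
  rw [h.lintegral_kernelMeasure]
  refine (enorm_integral_le_lintegral_enorm _).trans (le_of_eq ?_)
  refine lintegral_congr fun z => ?_
  rw [enorm_smul, Real.enorm_of_nonneg (h.nonneg z)]

end IsKernel

/-- Convolution in space with the kernel `ρ`. -/
noncomputable abbrev moll {d : ℕ} {F : Type*} [NormedAddCommGroup F] [NormedSpace ℝ F]
    (ρ : Space d → ℝ) (f : Space d → F) : Space d → F :=
  ρ ⋆[ContinuousLinearMap.lsmul ℝ ℝ, volume] f

/-- The gradient of the convolution with the kernel `ρ`. -/
noncomputable def mollDeriv {d : ℕ} (ρ : Space d → ℝ) (f : Space d → Space d) :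
    Space d → Space d →L[ℝ] Space d :=
  (fderiv ℝ ρ) ⋆[(ContinuousLinearMap.lsmul ℝ ℝ : ℝ →L[ℝ] Space d →L[ℝ] Space d).precompL
    (Space d), volume] f

theorem moll_congr_ae {d : ℕ} {F : Type*} [NormedAddCommGroup F] [NormedSpace ℝ F]
    (ρ : Space d → ℝ) {f g : Space d → F} (h : f =ᵐ[volume] g) : moll ρ f = moll ρ g := by
  funext x
  rw [moll, moll, convolution_lsmul_swap, convolution_lsmul_swap]
  exact integral_congr_ae (h.mono fun y hy => by simp only [hy])

theorem IsPeriodic.moll {d : ℕ} {F : Type*} [NormedAddCommGroup F] [NormedSpace ℝ F]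
    (ρ : Space d → ℝ) {f : Space d → F} (hf : IsPeriodic f) : IsPeriodic (moll ρ f) := by
  intro i x
  simp only [TorusFlow.moll, convolution_lsmul]
  congr 1; funext z
  rw [add_sub_right_comm, hf]

theorem IsPeriodic.mollDeriv {d : ℕ} (ρ : Space d → ℝ) {f : Space d → Space d}
    (hf : IsPeriodic f) : IsPeriodic (mollDeriv ρ f) := by
  intro i x
  simp only [TorusFlow.mollDeriv, convolution_def]
  congr 1; funext z
  rw [add_sub_right_comm, hf]

/-- Jensen's inequality for averages of translates of a periodic function. -/
theorem lintegral_average_rpow_le {d : ℕ} {Ω : Type*} [MeasurableSpace Ω] {ν : Measure Ω}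
    [IsProbabilityMeasure ν] {τ : Ω → Space d} (hτ : Measurable τ) {p : ℝ} (hp : 1 ≤ p)
    {h : Space d → ℝ≥0∞} (hh : Measurable h) (hper : IsPeriodic h) :
    ∫⁻ x, (∫⁻ ω, h (x - τ ω) ∂ν) ^ p ∂torusMeasure d ≤ ∫⁻ x, h x ^ p ∂torusMeasure d := by
  have hp0 : 0 < p := by linarith
  have hmeas : Measurable (Function.uncurry fun (x : Space d) ω => h (x - τ ω)) :=
    hh.comp (measurable_fst.sub (hτ.comp measurable_snd))
  have hJ : ∀ x, (∫⁻ ω, h (x - τ ω) ∂ν) ^ p ≤ ∫⁻ ω, h (x - τ ω) ^ p ∂ν := by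
    intro x
    have hm : AEMeasurable (fun ω => h (x - τ ω)) ν :=
      (hh.comp (measurable_const.sub hτ)).aemeasurable
    have h1 := eLpNorm'_le_eLpNorm'_of_exponent_le (f := fun ω => h (x - τ ω)) zero_lt_one hp ν
      hm.aestronglyMeasurable
    simp only [eLpNorm', enorm_eq_self, ENNReal.rpow_one, one_div, inv_one] at h1
    calc _ ≤ ((∫⁻ ω, h (x - τ ω) ^ p ∂ν) ^ p⁻¹) ^ p := by gcongr
      _ = _ := by rw [← ENNReal.rpow_mul, inv_mul_cancel₀ hp0.ne', ENNReal.rpow_one]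
  calc ∫⁻ x, (∫⁻ ω, h (x - τ ω) ∂ν) ^ p ∂torusMeasure d
      ≤ ∫⁻ x, ∫⁻ ω, h (x - τ ω) ^ p ∂ν ∂torusMeasure d := lintegral_mono hJ
    _ = ∫⁻ ω, ∫⁻ x, h (x - τ ω) ^ p ∂torusMeasure d ∂ν :=
        lintegral_lintegral_swap (hmeas.pow_const p).aemeasurable
    _ = ∫⁻ ω, ∫⁻ x, h x ^ p ∂torusMeasure d ∂ν := by
        refine lintegral_congr fun ω => ?_
        exact (hper.comp fun a => a ^ p).setLIntegral_sub (τ ω)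
    _ = _ := by simp

theorem norm_precompL_lsmul_apply_le {E F : Type*} [NormedAddCommGroup E] [NormedSpace ℝ E]
    [NormedAddCommGroup F] [NormedSpace ℝ F] (u : E →L[ℝ] ℝ) (y : F) :
    ‖(ContinuousLinearMap.lsmul ℝ ℝ : ℝ →L[ℝ] F →L[ℝ] F).precompL E u y‖ ≤ ‖u‖ * ‖y‖ := by
  refine ContinuousLinearMap.opNorm_le_bound _ (by positivity) fun e => ?_
  rw [ContinuousLinearMap.precompL_apply, ContinuousLinearMap.lsmul_apply, norm_smul]
  calc ‖u e‖ * ‖y‖ ≤ ‖u‖ * ‖e‖ * ‖y‖ := by gcongr; exact u.le_opNorm e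
    _ = _ := by ring

theorem stronglyMeasurable_clm_apply₂ {α E F G : Type*} [MeasurableSpace α]
    [NormedAddCommGroup E] [NormedSpace ℝ E] [NormedAddCommGroup F] [NormedSpace ℝ F]
    [NormedAddCommGroup G] [NormedSpace ℝ G] (L : E →L[ℝ] F →L[ℝ] G) {f : α → E} {g : α → F}
    (hf : StronglyMeasurable f) (hg : StronglyMeasurable g) :
    StronglyMeasurable fun x => L (f x) (g x) :=
  L.continuous₂.comp_stronglyMeasurable (hf.prodMk hg)

namespace IsKernel

variable {d : ℕ} {δ : ℝ} {ρ : Space d → ℝ}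

theorem integrable_fderiv (h : IsKernel δ ρ) : Integrable (fderiv ℝ ρ) :=
  (h.smooth.continuous_fderiv (by simp)).integrable_of_hasCompactSupport
    (h.hasCompactSupport.fderiv (𝕜 := ℝ))

theorem locallyIntegrable_of_bounded {f : Space d → Space d} {K : ℝ} (hf : Measurable f)
    (hK : ∀ x, ‖f x‖ ≤ K) : LocallyIntegrable f volume := fun x =>
  ⟨Metric.ball x 1, Metric.ball_mem_nhds x one_pos,
    Measure.integrableOn_of_bounded measure_ball_lt_top.ne hf.aestronglyMeasurable
      (Eventually.of_forall hK)⟩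

theorem hasFDerivAt_moll (h : IsKernel δ ρ) {f : Space d → Space d}
    (hf : LocallyIntegrable f volume) (x : Space d) :
    HasFDerivAt (moll ρ f) (mollDeriv ρ f x) x :=
  h.hasCompactSupport.hasFDerivAt_convolution_left _ (h.smooth.of_le (by simp)) hf x

theorem norm_moll_le (h : IsKernel δ ρ) {F : Type*} [NormedAddCommGroup F] [NormedSpace ℝ F]
    {f : Space d → F} {K : ℝ} (hK : ∀ x, ‖f x‖ ≤ K) (x : Space d) : ‖moll ρ f x‖ ≤ K := by
  rw [moll, convolution_lsmul]
  calc ‖∫ z, ρ z • f (x - z)‖ ≤ ∫ z, ρ z * K := by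
        refine norm_integral_le_of_norm_le (h.integrable.mul_const K)
          (Eventually.of_forall fun z => ?_)
        rw [norm_smul, Real.norm_of_nonneg (h.nonneg z)]
        exact mul_le_mul_of_nonneg_left (hK _) (h.nonneg z)
    _ = K := by rw [integral_mul_const, h.integral_eq_one, one_mul]

theorem norm_mollDeriv_le (h : IsKernel δ ρ) {f : Space d → Space d} {K : ℝ}
    (hK : ∀ x, ‖f x‖ ≤ K) (x : Space d) :
    ‖mollDeriv ρ f x‖ ≤ (∫ z, ‖fderiv ℝ ρ z‖) * K := by
  rw [mollDeriv, convolution_def, ← integral_mul_const]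
  refine norm_integral_le_of_norm_le (h.integrable_fderiv.norm.mul_const K)
    (Eventually.of_forall fun z => ?_)
  exact (norm_precompL_lsmul_apply_le _ _).trans (by gcongr; exact hK _)

theorem isBoundedC1Field_moll (h : IsKernel δ ρ) {f : ℝ → Space d → Space d} {K : ℝ}
    (hf : StronglyMeasurable (Function.uncurry f)) (hK : ∀ t x, ‖f t x‖ ≤ K) :
    IsBoundedC1Field K ((∫ z, ‖fderiv ℝ ρ z‖) * K) (fun t => moll ρ (f t))
      (fun t => mollDeriv ρ (f t)) where
  stronglyMeasurable := by
    have : StronglyMeasurable fun w : ℝ × Space d => ∫ z, ρ z • f w.1 (w.2 - z) := by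
      refine StronglyMeasurable.integral_prod_right
        (f := fun (w : ℝ × Space d) z => ρ z • f w.1 (w.2 - z)) ?_
      have h1 : StronglyMeasurable fun w : (ℝ × Space d) × Space d => ρ w.2 :=
        (h.continuous.comp continuous_snd).stronglyMeasurable
      have h2 : StronglyMeasurable fun w : (ℝ × Space d) × Space d => f w.1.1 (w.1.2 - w.2) :=
        hf.comp_measurable (g := fun w : (ℝ × Space d) × Space d => (w.1.1, w.1.2 - w.2))
          (by fun_prop)
      exact h1.smul h2
    exact this
  stronglyMeasurable_deriv := by
    refine StronglyMeasurable.integral_prod_right (f := fun (w : ℝ × Space d) z =>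
      (ContinuousLinearMap.lsmul ℝ ℝ : ℝ →L[ℝ] Space d →L[ℝ] Space d).precompL (Space d)
        (fderiv ℝ ρ z) (f w.1 (w.2 - z))) ?_
    have h1 : StronglyMeasurable fun w : (ℝ × Space d) × Space d => fderiv ℝ ρ w.2 :=
      ((h.smooth.continuous_fderiv (by simp)).comp continuous_snd).stronglyMeasurable
    have h2 : StronglyMeasurable fun w : (ℝ × Space d) × Space d => f w.1.1 (w.1.2 - w.2) :=
      hf.comp_measurable (g := fun w : (ℝ × Space d) × Space d => (w.1.1, w.1.2 - w.2))
        (by fun_prop)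
    exact stronglyMeasurable_clm_apply₂ _ h1 h2
  norm_le t x := h.norm_moll_le (hK t) x
  hasFDerivAt t x := h.hasFDerivAt_moll (locallyIntegrable_of_bounded
    hf.measurable.of_uncurry_left (hK t)) x
  norm_deriv_le t x := h.norm_mollDeriv_le (hK t) x

theorem convolutionExists (h : IsKernel δ ρ) {F : Type*} [NormedAddCommGroup F] [NormedSpace ℝ F]
    {g : Space d → F} (hg : LocallyIntegrable g volume) (x : Space d) :
    Integrable fun z => ρ z • g (x - z) :=
  h.hasCompactSupport.convolutionExists_left (ContinuousLinearMap.lsmul ℝ ℝ) h.continuous hg x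

/-- The gradient of the convolution is the convolution of the weak gradient. -/
theorem mollDeriv_eq_moll (h : IsKernel δ ρ) {f : Space d → Space d}
    {g : Space d → Space d →L[ℝ] Space d} (hfg : IsWeakGradient f g) (x : Space d) :
    mollDeriv ρ f x = moll ρ g x := by
  obtain ⟨hf, hg, hw⟩ := hfg
  ext1 e
  -- The test function is y ↦ ρ(x - y); the sign from the reflection cancels the one in the
  -- definition of the weak gradient.
  have hs : ContDiff ℝ ((⊤ : ℕ∞) : WithTop ℕ∞) fun y => ρ (x - y) :=
    h.smooth.comp (contDiff_const.sub contDiff_id)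
  have hc : HasCompactSupport fun y => ρ (x - y) :=
    h.hasCompactSupport.comp_homeomorph (Homeomorph.subLeft x)
  have h1 := hw _ hs hc e
  have h2 : ∀ y, fderiv ℝ (fun y => ρ (x - y)) y e = -fderiv ℝ ρ (x - y) e := by
    intro y
    have h3 : HasFDerivAt (fun y => ρ (x - y))
        ((fderiv ℝ ρ (x - y)).comp (-ContinuousLinearMap.id ℝ (Space d))) y :=
      ((h.smooth.differentiable (by simp)) (x - y)).hasFDerivAt.comp y
        ((hasFDerivAt_id y).const_sub x)
    rw [h3.fderiv]
    simp
  simp only [h2, neg_smul, integral_neg, neg_inj] at h1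
  have hi1 : Integrable fun y =>
      (ContinuousLinearMap.lsmul ℝ ℝ : ℝ →L[ℝ] Space d →L[ℝ] Space d).precompL (Space d)
        (fderiv ℝ ρ y) (f (x - y)) :=
    (h.hasCompactSupport.fderiv (𝕜 := ℝ)).convolutionExists_left
      ((ContinuousLinearMap.lsmul ℝ ℝ : ℝ →L[ℝ] Space d →L[ℝ] Space d).precompL (Space d))
      (h.smooth.continuous_fderiv (by simp)) hf x
  have hi2 := h.convolutionExists hg x
  rw [mollDeriv, convolution_def, ContinuousLinearMap.integral_apply hi1, moll, convolution_lsmul,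
    ContinuousLinearMap.integral_apply hi2]
  simp only [ContinuousLinearMap.precompL_apply, ContinuousLinearMap.lsmul_apply,
    _root_.smul_apply]
  rw [← integral_sub_left_eq_self (fun y => fderiv ℝ ρ y e • f (x - y)) volume x,
    ← integral_sub_left_eq_self (fun y => ρ y • g (x - y) e) volume x]
  simpa only [sub_sub_cancel] using h1

theorem enorm_mollDeriv_le (h : IsKernel δ ρ) {f : Space d → Space d}
    {g : Space d → Space d →L[ℝ] Space d} (hfg : IsWeakGradient f g) (x : Space d) :
    ‖mollDeriv ρ f x‖ₑ ≤ ∫⁻ z, ‖g (x - z)‖ₑ ∂kernelMeasure ρ := by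
  rw [h.mollDeriv_eq_moll hfg, moll, convolution_lsmul]
  exact h.enorm_integral_smul_le fun z => g (x - z)

/-- The gradient of the convolution averages translates of g, so Jensen's inequality and translation
invariance apply. The bound does not see the kernel, which keeps the later constants independent of
δ and η. -/
theorem lintegral_mollDeriv_rpow_le (h : IsKernel δ ρ) {f : Space d → Space d}
    {g : Space d → Space d →L[ℝ] Space d} (hfg : IsWeakGradient f g) (hg : Measurable g)
    (hper : IsPeriodic g) {p : ℝ} (hp : 1 ≤ p) :
    ∫⁻ x, ‖mollDeriv ρ f x‖ₑ ^ p ∂torusMeasure d ≤ ∫⁻ x, ‖g x‖ₑ ^ p ∂torusMeasure d := by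
  have := h.isProbabilityMeasure
  refine le_trans (lintegral_mono fun x => ?_) (lintegral_average_rpow_le (ν := kernelMeasure ρ)
    measurable_id hp hg.enorm (hper.comp fun a => ‖a‖ₑ))
  exact ENNReal.rpow_le_rpow (h.enorm_mollDeriv_le hfg x) (by linarith)

/-- The divergence of the convolution is an average of the divergence, so a one-sided a.e. bound
becomes an everywhere bound with the same `m`, for all kernels at once. -/
theorem ofReal_neg_traceCLM_mollDeriv_le (h : IsKernel δ ρ) {f : Space d → Space d}
    {g : Space d → Space d →L[ℝ] Space d} (hfg : IsWeakGradient f g) {m : ℝ≥0∞}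
    (hm : ∀ᵐ x, ENNReal.ofReal (-traceCLM d (g x)) ≤ m) (x : Space d) :
    ENNReal.ofReal (-traceCLM d (mollDeriv ρ f x)) ≤ m := by
  rcases eq_or_ne m ⊤ with rfl | hmt
  · exact le_top
  have hi := h.convolutionExists hfg.2.1 x
  rw [h.mollDeriv_eq_moll hfg, moll, convolution_lsmul,
    ← ContinuousLinearMap.integral_comp_comm _ hi, ← integral_neg]
  refine ENNReal.ofReal_le_of_le_toReal ?_
  calc ∫ z, -traceCLM d (ρ z • g (x - z)) ≤ ∫ z, ρ z * m.toReal := by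
        refine integral_mono_ae ((traceCLM d).integrable_comp hi).neg
          (h.integrable.mul_const _) ?_
        have hm' : ∀ᵐ z, ENNReal.ofReal (-traceCLM d (g (x - z))) ≤ m :=
          (quasiMeasurePreserving_sub_left (volume : Measure (Space d)) x).ae hm
        filter_upwards [hm'] with z hz
        rw [map_smul, smul_eq_mul, ← mul_neg]
        refine mul_le_mul_of_nonneg_left ?_ (h.nonneg z)
        exact (ENNReal.ofReal_le_iff_le_toReal hmt).1 hz
    _ = m.toReal := by rw [integral_mul_const, h.integral_eq_one, one_mul]

theorem integral_smul_sub (h : IsKernel δ ρ) {f : Space d → Space d} {K : ℝ} (hf : Measurable f)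
    (hK : ∀ x, ‖f x‖ ≤ K) (x : Space d) :
    f x - moll ρ f x = ∫ z, ρ z • (f x - f (x - z)) := by
  have h1 := h.convolutionExists (locallyIntegrable_of_bounded hf hK) x
  simp only [smul_sub]
  rw [integral_sub (h.integrable.smul_const _) h1, integral_smul_const, h.integral_eq_one,
    one_smul, moll, convolution_lsmul]

/-- Convolution moves a differentiable periodic function by at most `δ` times its gradient. -/
theorem lintegral_sub_moll_rpow_le_of_hasFDerivAt (h : IsKernel δ ρ) {w : Space d → Space d}
    {w' : Space d → Space d →L[ℝ] Space d} (hw : ∀ x, HasFDerivAt w (w' x) x)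
    (hw'm : Measurable w') {K Λ : ℝ} (hK : ∀ x, ‖w x‖ ≤ K) (hΛ : ∀ x, ‖w' x‖ ≤ Λ)
    (hper : IsPeriodic w') {p : ℝ} (hp : 1 ≤ p) :
    ∫⁻ x, ‖w x - moll ρ w x‖ₑ ^ p ∂torusMeasure d ≤
      ENNReal.ofReal δ ^ p * ∫⁻ x, ‖w' x‖ₑ ^ p ∂torusMeasure d := by
  have hp0 : 0 ≤ p := by linarith
  have := h.isProbabilityMeasure
  have hwm : Measurable w := (continuous_iff_continuousAt.2
    fun x => (hw x).continuousAt).measurable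
  -- The increment from x - z to x is an integral over the segment; together with the average over z
  -- it averages w' over translates by s z, with (z, s) distributed by the product of two
  -- probability measures.
  let I : Measure ℝ := volume.restrict (Ioo 0 1)
  have hI : IsProbabilityMeasure I := ⟨by simp [I]⟩
  have hτ : Measurable fun ω : Space d × ℝ => ω.2 • ω.1 := measurable_snd.smul measurable_fst
  have hpt : ∀ x, ‖w x - moll ρ w x‖ₑ ≤
      ENNReal.ofReal δ * ∫⁻ ω, ‖w' (x - ω.2 • ω.1)‖ₑ ∂((kernelMeasure ρ).prod I) := by
    intro x
    rw [h.integral_smul_sub hwm hK]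
    refine (h.enorm_integral_smul_le fun z => w x - w (x - z)).trans ?_
    have hm : Measurable fun ω : Space d × ℝ => ‖w' (x - ω.2 • ω.1)‖ₑ :=
      (hw'm.comp (measurable_const.sub hτ)).enorm
    rw [lintegral_prod _ hm.aemeasurable,
      ← lintegral_const_mul' _ _ ENNReal.ofReal_ne_top]
    refine lintegral_mono_ae ?_
    filter_upwards [h.ae_norm_le] with z hz
    have h1 := enorm_add_sub_le_lintegral hw hΛ x (-z)
    rw [← enorm_neg, neg_sub, sub_eq_add_neg x z]
    refine h1.trans ?_
    rw [← lintegral_const_mul' _ _ ENNReal.ofReal_ne_top]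
    refine lintegral_mono fun s => ?_
    rw [mul_comm, smul_neg, ← sub_eq_add_neg, enorm_neg]
    gcongr
    rw [← ofReal_norm]
    exact ENNReal.ofReal_le_ofReal hz
  calc ∫⁻ x, ‖w x - moll ρ w x‖ₑ ^ p ∂torusMeasure d
      ≤ ∫⁻ x, ENNReal.ofReal δ ^ p *
          (∫⁻ ω, ‖w' (x - ω.2 • ω.1)‖ₑ ∂((kernelMeasure ρ).prod I)) ^ p ∂torusMeasure d := by
        refine lintegral_mono fun x => ?_
        rw [← ENNReal.mul_rpow_of_nonneg _ _ hp0]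
        exact ENNReal.rpow_le_rpow (hpt x) hp0
    _ = ENNReal.ofReal δ ^ p * ∫⁻ x,
          (∫⁻ ω, ‖w' (x - ω.2 • ω.1)‖ₑ ∂((kernelMeasure ρ).prod I)) ^ p ∂torusMeasure d :=
        lintegral_const_mul' _ _ (ENNReal.rpow_ne_top_of_nonneg hp0 ENNReal.ofReal_ne_top)
    _ ≤ _ := by
        refine mul_le_mul_right ?_ _
        exact lintegral_average_rpow_le hτ hp hw'm.enorm (hper.comp fun a => ‖a‖ₑ)

/-- Convolution moves a bounded periodic Sobolev function by at most `δ` times its gradient. -/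
theorem lintegral_sub_moll_rpow_le (h : IsKernel δ ρ)
    {f : Space d → Space d} {g : Space d → Space d →L[ℝ] Space d} (hfg : IsWeakGradient f g)
    (hf : Measurable f) (hg : Measurable g) {K : ℝ} (hK : ∀ x, ‖f x‖ ≤ K)
    (hfper : IsPeriodic f) (hgper : IsPeriodic g) {p : ℝ} (hp : 1 ≤ p) :
    ∫⁻ x, ‖f x - moll ρ f x‖ₑ ^ p ∂torusMeasure d ≤
      ENNReal.ofReal δ ^ p * ∫⁻ x, ‖g x‖ₑ ^ p ∂torusMeasure d := by
  -- The estimate is known for the smooth fields φ_n * f and passes to the limit by Fatou's lemma.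
  -- The ratio 2 of outer to inner radius stays bounded, as the a.e. convergence of φ_n * f to f
  -- requires.
  let φ : ℕ → ContDiffBump (0 : Space d) := fun n =>
    ⟨1 / (n + 1), 2 / (n + 1), by positivity, by gcongr; norm_num⟩
  have hk : ∀ n, IsKernel (φ n).rOut ((φ n).normed volume) := fun n => (φ n).isKernel_normed
  have hlim : ∀ᵐ x : Space d, Tendsto (fun n => moll ((φ n).normed volume) f x) atTop (𝓝 (f x)) := by
    refine ContDiffBump.ae_convolution_tendsto_right_of_locallyIntegrable (K := 2) ?_ ?_ hfg.1
    · have := (tendsto_one_div_add_atTop_nhds_zero_nat (𝕜 := ℝ)).const_mul 2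
      rw [mul_zero] at this
      refine this.congr fun n => ?_
      simp only [φ]; ring
    · refine Eventually.of_forall fun n => le_of_eq ?_
      simp only [φ]; ring
  have hfield : ∀ n, IsBoundedC1Field K ((∫ z, ‖fderiv ℝ ((φ n).normed volume) z‖) * K)
      (fun _ => moll ((φ n).normed volume) f) (fun _ => mollDeriv ((φ n).normed volume) f) :=
    fun n => (hk n).isBoundedC1Field_moll (f := fun _ => f)
      (hf.comp measurable_snd).stronglyMeasurable fun _ => hK
  have hmoll : ∀ x, Tendsto (fun n => moll ρ (moll ((φ n).normed volume) f) x) atTop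
      (𝓝 (moll ρ f x)) := by
    intro x
    simp only [moll, convolution_lsmul]
    refine tendsto_integral_of_dominated_convergence (fun z => ρ z * K) (fun n => ?_)
      (h.integrable.mul_const K) (fun n => Eventually.of_forall fun z => ?_) ?_
    · have hm := (hfield n).stronglyMeasurable.measurable.of_uncurry_left (x := 0)
      exact (h.continuous.measurable.smul
        (hm.comp (measurable_const.sub measurable_id))).aestronglyMeasurable
    · rw [norm_smul, Real.norm_of_nonneg (h.nonneg z)]
      exact mul_le_mul_of_nonneg_left ((hk n).norm_moll_le hK _) (h.nonneg z)
    · filter_upwards [(quasiMeasurePreserving_sub_left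
        (volume : Measure (Space d)) x).ae hlim] with z hz
      exact hz.const_smul (ρ z)
  have hbound : ∀ n, ∫⁻ x, ‖moll ((φ n).normed volume) f x -
      moll ρ (moll ((φ n).normed volume) f) x‖ₑ ^ p ∂torusMeasure d ≤
      ENNReal.ofReal δ ^ p * ∫⁻ x, ‖g x‖ₑ ^ p ∂torusMeasure d := by
    intro n
    refine (h.lintegral_sub_moll_rpow_le_of_hasFDerivAt ((hfield n).hasFDerivAt 0)
      ((hfield n).stronglyMeasurable_deriv.measurable.of_uncurry_left (x := 0))
      ((hfield n).norm_le 0) ((hfield n).norm_deriv_le 0) (hfper.mollDeriv _) hp).trans ?_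
    refine mul_le_mul_right ?_ _
    exact (hk n).lintegral_mollDeriv_rpow_le hfg hg hgper hp
  have hae : ∀ᵐ x ∂torusMeasure d, ‖f x - moll ρ f x‖ₑ ^ p =
      liminf (fun n => ‖moll ((φ n).normed volume) f x -
        moll ρ (moll ((φ n).normed volume) f) x‖ₑ ^ p) atTop := by
    filter_upwards [ae_restrict_of_ae hlim] with x hx
    exact (((ENNReal.continuous_rpow_const.tendsto _).comp
      ((hx.sub (hmoll x)).enorm)).liminf_eq).symm
  rw [lintegral_congr_ae hae]
  refine (lintegral_liminf_le fun n => ?_).trans ?_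
  · have hm := (hfield n).stronglyMeasurable.measurable.of_uncurry_left (x := 0)
    have hm2 := ((h.isBoundedC1Field_moll (f := fun _ => moll ((φ n).normed volume) f)
      (hfield n).stronglyMeasurable fun _ => (hfield n).norm_le 0).stronglyMeasurable.measurable.of_uncurry_left (x := 0))
    exact ((hm.sub hm2).enorm).pow_const p
  · refine (liminf_le_liminf (Eventually.of_forall hbound)).trans ?_
    simp

end IsKernel

/-! ### Everywhere-defined representatives of the velocity field -/

theorem ae_prod_of_ae_spaceTimeMeasure {d : ℕ} {T : ℝ} {P : ℝ × Space d → Prop}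
    (hP : ∀ᵐ w ∂spaceTimeMeasure d T, P w) :
    ∀ᵐ w ∂((volume.restrict (Ioo 0 T)).prod (volume : Measure (Space d))),
      P (w.1, fractPt w.2) :=
  (MeasureTheory.QuasiMeasurePreserving.prodMap
    (Measure.QuasiMeasurePreserving.id (volume.restrict (Ioo 0 T)))
    (quasiMeasurePreserving_fractPt d)).ae hP

/-- A jointly measurable periodic representative of a field on `(0,T) × 𝕋^d`. -/
theorem exists_periodic_representative {d : ℕ} {T : ℝ} {F : Type*} [NormedAddCommGroup F]
    {f : ℝ → Space d → F} (hper : ∀ t, IsPeriodic (f t))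
    (hm : AEStronglyMeasurable (Function.uncurry f) (spaceTimeMeasure d T)) :
    ∃ g : ℝ → Space d → F, StronglyMeasurable (Function.uncurry g) ∧ (∀ t, IsPeriodic (g t)) ∧
      ∀ᵐ w ∂((volume.restrict (Ioo 0 T)).prod (volume : Measure (Space d))),
        f w.1 w.2 = g w.1 w.2 := by
  obtain ⟨h, hsm, hae⟩ := hm
  refine ⟨fun t x => h (t, fractPt x), ?_, fun t => ?_, ?_⟩
  · exact hsm.comp_measurable (g := fun w : ℝ × Space d => (w.1, fractPt w.2))
      (measurable_fst.prodMk ((measurable_fractPt d).comp measurable_snd))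
  · exact (isPeriodic_fractPt d).comp fun y => h (t, y)
  · filter_upwards [ae_prod_of_ae_spaceTimeMeasure hae] with w hw
    rw [← hw, Function.uncurry_apply_pair, (hper w.1).apply_fractPt]

/-- A jointly measurable, periodic and everywhere bounded representative of a bounded field. -/
theorem exists_bounded_periodic_representative {d : ℕ} {T K : ℝ} (hK : 0 ≤ K) {F : Type*}
    [NormedAddCommGroup F] {f : ℝ → Space d → F} (hper : ∀ t, IsPeriodic (f t))
    (hm : AEStronglyMeasurable (Function.uncurry f) (spaceTimeMeasure d T))
    (hb : ∀ᵐ w ∂spaceTimeMeasure d T, ‖Function.uncurry f w‖ ≤ K) :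
    ∃ g : ℝ → Space d → F, StronglyMeasurable (Function.uncurry g) ∧ (∀ t, IsPeriodic (g t)) ∧
      (∀ t x, ‖g t x‖ ≤ K) ∧
      ∀ᵐ w ∂((volume.restrict (Ioo 0 T)).prod (volume : Measure (Space d))),
        f w.1 w.2 = g w.1 w.2 := by
  classical
  obtain ⟨h, hsm, hp, hae⟩ := exists_periodic_representative hper hm
  refine ⟨fun t x => if ‖h t x‖ ≤ K then h t x else 0, ?_, fun t => ?_, fun t x => ?_, ?_⟩
  · exact StronglyMeasurable.ite (measurableSet_le hsm.norm.measurable measurable_const) hsm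
      stronglyMeasurable_const
  · exact (hp t).comp fun y => if ‖y‖ ≤ K then y else 0
  · beta_reduce
    split_ifs with hx
    · exact hx
    · simpa using hK
  · filter_upwards [hae, ae_prod_of_ae_spaceTimeMeasure hb] with w hw hwb
    rw [Function.uncurry_apply_pair, (hper w.1).apply_fractPt, hw] at hwb
    rw [hw, if_pos hwb]

theorem IsWeakGradient.congr_ae {d : ℕ} {f f₂ : Space d → Space d}
    {g g₂ : Space d → Space d →L[ℝ] Space d} (h : IsWeakGradient f g)
    (hf : f =ᵐ[volume] f₂) (hg : g =ᵐ[volume] g₂) : IsWeakGradient f₂ g₂ := by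
  refine ⟨h.1.congr hf, h.2.1.congr hg, fun φ hφ hc e => ?_⟩
  have h1 : (fun x => (fderiv ℝ φ x e) • f x) =ᵐ[volume] fun x => (fderiv ℝ φ x e) • f₂ x :=
    hf.mono fun x hx => by simp only [hx]
  have h2 : (fun x => φ x • (g x e)) =ᵐ[volume] fun x => φ x • (g₂ x e) :=
    hg.mono fun x hx => by simp only [hx]
  rw [← integral_congr_ae h1, h.2.2 φ hφ hc e, integral_congr_ae h2]

/-- A bounded Sobolev field on the torus given by jointly measurable periodic representatives,
with the negative part of its divergence bounded by an integrable function of time. -/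
structure IsSobolevField {d : ℕ} (T p K : ℝ) (u : ℝ → Space d → Space d)
    (G : ℝ → Space d → Space d →L[ℝ] Space d) (m : ℝ → ℝ≥0∞) : Prop where
  stronglyMeasurable : StronglyMeasurable (Function.uncurry u)
  periodic : ∀ t, IsPeriodic (u t)
  norm_le : ∀ t x, ‖u t x‖ ≤ K
  stronglyMeasurable_grad : StronglyMeasurable (Function.uncurry G)
  periodic_grad : ∀ t, IsPeriodic (G t)
  weakGradient : ∀ᵐ t ∂(volume.restrict (Ioo 0 T)), IsWeakGradient (u t) (G t)
  lintegral_grad_ne_top :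
    ∫⁻ t in Ioo 0 T, (∫⁻ x, ‖G t x‖ₑ ^ p ∂torusMeasure d) ^ (1 / p) ≠ ⊤
  div_le : ∀ᵐ t ∂(volume.restrict (Ioo 0 T)), ∀ᵐ x, ENNReal.ofReal (-traceCLM d (G t x)) ≤ m t
  lintegral_div_ne_top : ∫⁻ t in Ioo 0 T, m t ≠ ⊤

theorem eLpNorm_torusMeasure_eq {d : ℕ} {F : Type*} [NormedAddCommGroup F] {p : ℝ} (hp : 1 < p)
    (f : Space d → F) : eLpNorm f (ENNReal.ofReal p) (torusMeasure d) =
      (∫⁻ x, ‖f x‖ₑ ^ p ∂torusMeasure d) ^ (1 / p) := by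
  rw [eLpNorm_eq_lintegral_rpow_enorm_toReal (by simp; linarith) ENNReal.ofReal_ne_top,
    ENNReal.toReal_ofReal (by linarith)]

/-- Replaces the field by a jointly measurable version, periodic and bounded everywhere, so that
estimates along individual trajectories carry no exceptional sets. Here m(t) is the essential
supremum of the negative part of the divergence at time t. -/
theorem IsAdmissible.exists_isSobolevField {d : ℕ} {T p : ℝ} (hp : 1 < p)
    {u : ℝ → Space d → Space d} (hu : IsAdmissible T p u) :
    ∃ (K : ℝ) (v : ℝ → Space d → Space d) (G : ℝ → Space d → Space d →L[ℝ] Space d)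
      (m : ℝ → ℝ≥0∞), IsSobolevField T p K v G m ∧
        ∀ᵐ w ∂((volume.restrict (Ioo 0 T)).prod (volume : Measure (Space d))),
          u w.1 w.2 = v w.1 w.2 := by
  obtain ⟨Du, hS, hdiv1, hdiv2⟩ := hu.sobolev
  set K := (eLpNorm (Function.uncurry u) ⊤ (spaceTimeMeasure d T)).toReal with hK
  have hb : ∀ᵐ w ∂spaceTimeMeasure d T, ‖Function.uncurry u w‖ ≤ K := by
    filter_upwards [ae_le_eLpNormEssSup (f := Function.uncurry u)
      (μ := spaceTimeMeasure d T)] with w hw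
    rw [hK, eLpNorm_exponent_top, ← toReal_enorm]
    refine ENNReal.toReal_mono ?_ hw
    have := hu.bounded.2.ne
    rwa [eLpNorm_exponent_top] at this
  obtain ⟨v, hv1, hv2, hv3, hv4⟩ := exists_bounded_periodic_representative
    ENNReal.toReal_nonneg hu.periodic hS.measurable_u hb
  obtain ⟨G, hG1, hG2, hG3'⟩ := exists_periodic_representative hS.periodic hS.measurable_Du
  have hG3 : ∀ᵐ t ∂(volume.restrict (Ioo 0 T)), Du t =ᵐ[volume] G t :=
    Measure.ae_ae_of_ae_prod hG3'
  refine ⟨K, v, G, fun t => eLpNorm (divNeg Du t) ⊤ (torusMeasure d),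
    ⟨hv1, hv2, hv3, hG1, hG2, ?_, ?_, ?_, ?_⟩, hv4⟩
  · filter_upwards [Measure.ae_ae_of_ae_prod hv4, hG3, hS.weakGradient] with t h1 h2 h3
    exact h3.congr_ae h1 h2
  · refine ((lintegral_mono_ae ?_).trans_lt hS.norm_finite).ne
    filter_upwards [hG3] with t ht
    refine le_add_left (le_of_eq ?_)
    rw [eLpNorm_torusMeasure_eq hp]
    congr 1
    refine lintegral_congr_ae ?_
    filter_upwards [ae_restrict_of_ae ht] with x hx
    rw [hx]
  · filter_upwards [hG3] with t ht
    have h1 : ∀ᵐ x ∂torusMeasure d,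
        ‖divNeg Du t x‖ₑ ≤ eLpNorm (divNeg Du t) ⊤ (torusMeasure d) := by
      rw [eLpNorm_exponent_top]; exact ae_le_eLpNormEssSup
    have h2 : IsPeriodic fun x => ‖divNeg Du t x‖ₑ ≤ eLpNorm (divNeg Du t) ⊤ (torusMeasure d) :=
      (hS.periodic t).comp fun A => ‖max (-∑ i : Fin d, (A (basisVec i)) i) 0‖ₑ ≤
        eLpNorm (divNeg Du t) ⊤ (torusMeasure d)
    filter_upwards [ht, ae_of_ae_torusMeasure h1 h2] with x hx h3
    rw [← hx, traceCLM_apply]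
    refine le_trans ?_ h3
    rw [divNeg, Real.enorm_of_nonneg (le_max_right _ _)]
    exact ENNReal.ofReal_le_ofReal (le_max_left _ _)
  -- For p ≤ d the space-time bound holds on almost every time slice and (0, T) has finite length;
  -- for p > d integrability in time is assumed.
  · rcases le_or_gt p d with hpd | hpd
    · have h1 := hdiv1 hpd
      set c := eLpNorm (Function.uncurry (divNeg Du)) ⊤ (spaceTimeMeasure d T) with hc
      have h2 : ∀ᵐ w ∂spaceTimeMeasure d T, ‖Function.uncurry (divNeg Du) w‖ₑ ≤ c := by
        rw [hc, eLpNorm_exponent_top]; exact ae_le_eLpNormEssSup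
      have h3 : ∀ᵐ t ∂(volume.restrict (Ioo 0 T)),
          eLpNorm (divNeg Du t) ⊤ (torusMeasure d) ≤ c := by
        filter_upwards [Measure.ae_ae_of_ae_prod h2] with t ht
        rw [eLpNorm_exponent_top]
        exact eLpNormEssSup_le_of_ae_enorm_bound ht
      refine ((lintegral_mono_ae h3).trans_lt ?_).ne
      rw [setLIntegral_const]
      exact ENNReal.mul_lt_top h1.2 (by simp)
    · exact (hdiv2 hpd).ne

/-! ### Measurability and null sets along compressible flows -/

/-- A flow with continuous trajectories which compresses volume at most by the factor `L`. -/
structure IsCompressibleFlow {d : ℕ} (T : ℝ) (L : ℝ≥0∞) (X : ℝ → Space d → Space d) : Prop where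
  continuousOn : ∀ᵐ x, ContinuousOn (fun t => X t x) (Icc 0 T)
  aemeasurable : ∀ t ∈ Icc 0 T, AEMeasurable (X t) volume
  map_le : ∀ t ∈ Icc 0 T, (volume : Measure (Space d)).map (X t) ≤ L • volume

namespace IsCompressibleFlow

variable {d : ℕ} {T : ℝ} {L : ℝ≥0∞} {X : ℝ → Space d → Space d}

theorem lintegral_comp_le (h : IsCompressibleFlow T L X) {t : ℝ} (ht : t ∈ Icc 0 T)
    {f : Space d → ℝ≥0∞} (hf : Measurable f) : ∫⁻ x, f (X t x) ≤ L * ∫⁻ x, f x := by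
  rw [← lintegral_map' hf.aemeasurable (h.aemeasurable t ht)]
  refine (lintegral_mono' (h.map_le t ht) le_rfl).trans (le_of_eq ?_)
  rw [lintegral_smul_measure, smul_eq_mul]

/-- The null set off which `X t` agrees with a measurable map depends on t. Sampling time on the
grids k/(n+1) involves only countably many times, and continuity of the trajectories recovers the
flow as a limit. -/
theorem aemeasurable_uncurry (h : IsCompressibleFlow T L X) :
    AEMeasurable (Function.uncurry X) ((volume.restrict (Ioo 0 T)).prod volume) := by
  rcases le_or_gt T 0 with hT | hT
  · rw [Ioo_eq_empty (not_lt.2 hT), Measure.restrict_empty, Measure.zero_prod]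
    exact aemeasurable_zero_measure
  have hproj : ∀ t, (projIcc 0 T hT.le t : ℝ) ∈ Icc 0 T := fun t => (projIcc 0 T hT.le t).2
  choose! Z hZm hZe using fun t (ht : t ∈ Icc 0 T) => h.aemeasurable t ht
  -- The grid point just below t, projected back to [0, T], where measurability of the flow is
  -- available.
  let q : ℕ → ℝ → ℝ := fun n t => projIcc 0 T hT.le (⌊(n + 1) * t⌋ / (n + 1))
  have hq : ∀ t ∈ Ioo 0 T, Tendsto (fun n => q n t) atTop (𝓝[Icc 0 T] t) := by
    intro t ht
    refine tendsto_nhdsWithin_iff.2 ⟨?_, Eventually.of_forall fun n => hproj _⟩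
    have h1 : Tendsto (fun n : ℕ => (⌊((n : ℝ) + 1) * t⌋ : ℝ) / (n + 1)) atTop (𝓝 t) := by
      have h2 : Tendsto (fun n : ℕ => t - 1 / ((n : ℝ) + 1)) atTop (𝓝 t) := by
        simpa using tendsto_const_nhds.sub (tendsto_one_div_add_atTop_nhds_zero_nat (𝕜 := ℝ))
      refine tendsto_of_tendsto_of_tendsto_of_le_of_le h2 tendsto_const_nhds (fun n => ?_)
        fun n => ?_
      · have hn : (0 : ℝ) < n + 1 := by positivity
        rw [le_div_iff₀ hn, sub_mul, one_div, inv_mul_cancel₀ hn.ne']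
        linarith [Int.sub_one_lt_floor (((n : ℝ) + 1) * t)]
      · have hn : (0 : ℝ) < n + 1 := by positivity
        rw [div_le_iff₀ hn]
        linarith [Int.floor_le (((n : ℝ) + 1) * t)]
    have h3 := ((continuous_subtype_val.comp (continuous_projIcc (h := hT.le))).tendsto t).comp h1
    simp only [Function.comp_apply, projIcc_of_mem hT.le (Ioo_subset_Icc_self ht)] at h3
    exact h3
  have hae : ∀ᵐ x : Space d, ∀ n : ℕ, ∀ k : ℤ,
      X (projIcc 0 T hT.le (k / (n + 1))) x = Z (projIcc 0 T hT.le (k / (n + 1))) x :=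
    ae_all_iff.2 fun n => ae_all_iff.2 fun k => hZe _ (hproj _)
  refine aemeasurable_of_tendsto_metrizable_ae atTop
    (f := fun n w => Z (q n w.1) w.2) (fun n => Measurable.aemeasurable ?_) ?_
  · have h1 : Measurable fun w : Space d × ℤ => Z (projIcc 0 T hT.le (w.2 / (n + 1))) w.1 :=
      measurable_from_prod_countable_left fun k => hZm _ (hproj (k / (n + 1)))
    have h2 : Measurable fun w : ℝ × Space d => (w.2, ⌊((n : ℝ) + 1) * w.1⌋) :=
      measurable_snd.prodMk (measurable_fst.const_mul ((n : ℝ) + 1)).floor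
    have h3 := h1.comp h2
    exact h3
  · have h2 : ∀ᵐ w ∂((volume.restrict (Ioo 0 T)).prod (volume : Measure (Space d))),
        w.1 ∈ Ioo 0 T :=
      Measure.quasiMeasurePreserving_fst.ae (ae_restrict_mem measurableSet_Ioo)
    filter_upwards [h2, Measure.quasiMeasurePreserving_snd.ae hae,
      Measure.quasiMeasurePreserving_snd.ae h.continuousOn] with w hw1 hw2 hw3
    have h4 := (hw3 w.1 (Ioo_subset_Icc_self hw1)).tendsto.comp (hq w.1 hw1)
    refine h4.congr fun n => ?_
    exact hw2 n _

/-- The flow maps null sets of space-time to null sets. -/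
theorem ae_comp (h : IsCompressibleFlow T L X) {P : ℝ × Space d → Prop}
    (hP : ∀ᵐ w ∂((volume.restrict (Ioo 0 T)).prod (volume : Measure (Space d))), P w) :
    ∀ᵐ w ∂((volume.restrict (Ioo 0 T)).prod (volume : Measure (Space d))),
      P (w.1, X w.1 w.2) := by
  obtain ⟨Z, hZm, hZe⟩ := h.aemeasurable_uncurry
  -- A measurable null hull of the exceptional set: almost all of its time slices are null, and
  -- their preimages under `X t` are null by compressibility.
  set N := toMeasurable ((volume.restrict (Ioo 0 T)).prod (volume : Measure (Space d)))
    {w | ¬P w} with hN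
  have hNm : MeasurableSet N := measurableSet_toMeasurable _ _
  have hN0 : ((volume.restrict (Ioo 0 T)).prod (volume : Measure (Space d))) N = 0 := by
    rw [hN, measure_toMeasurable]; exact hP
  have hNae : ∀ᵐ t ∂(volume.restrict (Ioo 0 T)), volume (Prod.mk t ⁻¹' N) = 0 :=
    Measure.measure_ae_null_of_prod_null hN0
  have hpre : MeasurableSet ((fun w : ℝ × Space d => (w.1, Z w)) ⁻¹' N) :=
    (measurable_fst.prodMk hZm) hNm
  have hnull : ((volume.restrict (Ioo 0 T)).prod (volume : Measure (Space d)))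
      ((fun w : ℝ × Space d => (w.1, Z w)) ⁻¹' N) = 0 := by
    rw [Measure.measure_prod_null hpre]
    filter_upwards [hNae, Measure.ae_ae_of_ae_prod hZe, ae_restrict_mem measurableSet_Ioo]
      with t ht1 ht2 ht3
    have ht : t ∈ Icc 0 T := Ioo_subset_Icc_self ht3
    have hS : MeasurableSet (Prod.mk t ⁻¹' N) := measurable_prodMk_left hNm
    have h1 : volume (X t ⁻¹' (Prod.mk t ⁻¹' N)) = 0 := by
      rw [← Measure.map_apply_of_aemeasurable (h.aemeasurable t ht) hS]
      refine le_antisymm ((h.map_le t ht _).trans (le_of_eq ?_)) zero_le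
      simp [ht1]
    refine (measure_congr ?_).trans h1
    filter_upwards [ht2] with x hx
    have hx' : X t x = Z (t, x) := hx
    apply propext
    change (t, Z (t, x)) ∈ N ↔ (t, X t x) ∈ N
    rw [hx']
  filter_upwards [hZe, measure_eq_zero_iff_ae_notMem.1 hnull] with w hw1 hw2
  by_contra hcon
  refine hw2 ?_
  have hw1' : X w.1 w.2 = Z w := hw1
  change (w.1, Z w) ∈ N
  rw [← hw1']
  exact subset_toMeasurable _ _ hcon

end IsCompressibleFlow

theorem ae_ae_swap_of_ae_prod {d : ℕ} {μ : Measure ℝ} [SFinite μ] {P : ℝ × Space d → Prop}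
    (hP : ∀ᵐ w ∂(μ.prod (volume : Measure (Space d))), P w) :
    ∀ᵐ x : Space d, ∀ᵐ t ∂μ, P (t, x) := by
  have h : ∀ᵐ w ∂((volume : Measure (Space d)).prod μ), P w.swap :=
    Measure.measurePreserving_swap.quasiMeasurePreserving.ae hP
  exact Measure.ae_ae_of_ae_prod h

theorem IsRegularLagrangianFlow.exists_isCompressibleFlow {d : ℕ} {T : ℝ} (hT : 0 ≤ T)
    {u : ℝ → Space d → Space d}
    {Φ : ℝ → Space d → Space d} (h : IsRegularLagrangianFlow T u Φ) :
    ∃ L : ℝ≥0, IsCompressibleFlow T L Φ := by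
  obtain ⟨L, -, hL⟩ := h.compressibility
  refine ⟨L, ?_, h.measurable, fun t ht => (hL t ht).trans (le_of_eq ?_)⟩
  · filter_upwards [h.solution] with x hx
    simpa [uIcc_of_le hT] using hx.1.continuousOn
  · rfl

/-- A regular Lagrangian flow does not depend on the representative of the field. -/
theorem IsRegularLagrangianFlow.isACSolution_of_ae_eq {d : ℕ} {T : ℝ} (hT : 0 ≤ T)
    {u v : ℝ → Space d → Space d} {Φ : ℝ → Space d → Space d}
    (h : IsRegularLagrangianFlow T u Φ)
    (huv : ∀ᵐ w ∂((volume.restrict (Ioo 0 T)).prod (volume : Measure (Space d))),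
      u w.1 w.2 = v w.1 w.2) :
    ∀ᵐ x, IsACSolution T v x fun t => Φ t x := by
  obtain ⟨L, hL⟩ := h.exists_isCompressibleFlow hT
  filter_upwards [h.solution, ae_ae_swap_of_ae_prod (hL.ae_comp huv)] with x hx hxe
  refine ⟨hx.1, hx.2.1, ?_⟩
  filter_upwards [hx.2.2, hxe] with t ht1 ht2
  have ht2' : u t (Φ t x) = v t (Φ t x) := ht2
  rwa [← ht2']

/-! ### The logarithmic estimate in L^p -/

/-- Minkowski's integral inequality. -/
theorem rpow_lintegral_rpow_le_lintegral {α β : Type*} [MeasurableSpace α] [MeasurableSpace β]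
    {μ : Measure α} {ν : Measure β} [SFinite μ] [IsFiniteMeasure ν] {p : ℝ} (hp : 1 < p)
    {F : β → ℝ≥0∞} {g : α → β → ℝ≥0∞} (hF : AEMeasurable F ν)
    (hg : AEMeasurable (Function.uncurry g) (μ.prod ν)) {B : ℝ≥0∞} (hB : B ≠ ⊤)
    (hFB : ∀ᵐ x ∂ν, F x ≤ B) (h : ∀ᵐ x ∂ν, F x ≤ ∫⁻ s, g s x ∂μ) :
    (∫⁻ x, F x ^ p ∂ν) ^ (1 / p) ≤ ∫⁻ s, (∫⁻ x, g s x ^ p ∂ν) ^ (1 / p) ∂μ := by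
  have hp0 : 0 < p := by linarith
  have hpq : p.HolderConjugate (p / (p - 1)) := Real.HolderConjugate.conjExponent hp
  set q := p / (p - 1) with hq
  have hp1 : 0 < p - 1 := by linarith
  have hq0 : 0 < q := div_pos hp0 hp1
  set I := ∫⁻ x, F x ^ p ∂ν with hI
  have hIt : I ≠ ⊤ := by
    refine ((lintegral_mono_ae (g := fun _ => B ^ p) ?_).trans_lt ?_).ne
    · filter_upwards [hFB] with x hx
      gcongr
    · rw [lintegral_const]
      exact ENNReal.mul_lt_top (ENNReal.rpow_lt_top_of_nonneg hp0.le hB) (measure_lt_top _ _)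
  have hFp : AEMeasurable (fun x => F x ^ (p - 1)) ν := hF.pow_const _
  have hgs : AEMeasurable (fun w : β × α => g w.2 w.1 * F w.1 ^ (p - 1)) (ν.prod μ) :=
    hg.prod_swap.mul hFp.comp_fst
  have hgm : ∀ᵐ s ∂μ, AEMeasurable (g s) ν := by
    obtain ⟨g', hg', hge⟩ := hg
    filter_upwards [Measure.ae_ae_of_ae_prod hge] with s hs
    exact ⟨fun x => g' (s, x), hg'.of_uncurry_left (x := s) (f := fun s x => g' (s, x)), hs⟩
  -- Write F^p = F · F^(p-1), exchange the integrals and apply Hölder at each s. Dividing by I^(1/q)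
  -- is legitimate because boundedness of F makes I finite.
  have key : I ≤ (∫⁻ s, (∫⁻ x, g s x ^ p ∂ν) ^ (1 / p) ∂μ) * I ^ (1 / q) := by
    calc I = ∫⁻ x, F x * F x ^ (p - 1) ∂ν := by
          refine lintegral_congr fun x => ?_
          have h1 := ENNReal.rpow_add_of_nonneg (x := F x) 1 (p - 1) zero_le_one hp1.le
          rwa [ENNReal.rpow_one, add_sub_cancel] at h1
      _ ≤ ∫⁻ x, ∫⁻ s, g s x * F x ^ (p - 1) ∂μ ∂ν := by
          refine lintegral_mono_ae ?_
          filter_upwards [h, hFB] with x hx hxB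
          rw [lintegral_mul_const' _ _
            (ENNReal.rpow_lt_top_of_nonneg hp1.le (hxB.trans_lt hB.lt_top).ne).ne]
          gcongr
      _ = ∫⁻ s, ∫⁻ x, g s x * F x ^ (p - 1) ∂ν ∂μ := lintegral_lintegral_swap hgs
      _ ≤ ∫⁻ s, (∫⁻ x, g s x ^ p ∂ν) ^ (1 / p) * I ^ (1 / q) ∂μ := by
          refine lintegral_mono_ae ?_
          filter_upwards [hgm] with s hs
          refine (ENNReal.lintegral_mul_le_Lp_mul_Lq ν hpq hs hFp).trans (le_of_eq ?_)
          congr 2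
          refine lintegral_congr fun x => ?_
          rw [← ENNReal.rpow_mul, hq, mul_div_cancel₀ _ hp1.ne']
      _ = _ := lintegral_mul_const' _ _
          (ENNReal.rpow_lt_top_of_nonneg (by positivity) hIt).ne
  rcases eq_or_ne I 0 with h0 | h0
  · rw [h0, ENNReal.zero_rpow_of_pos (by positivity)]
    exact zero_le
  have hIq0 : I ^ (1 / q) ≠ 0 := by simp [h0, hIt]
  have hIqt : I ^ (1 / q) ≠ ⊤ := (ENNReal.rpow_lt_top_of_nonneg (by positivity) hIt).ne
  refine (ENNReal.mul_le_mul_iff_left hIq0 hIqt).1 (le_trans (le_of_eq ?_) key)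
  rw [← ENNReal.rpow_add _ _ h0 hIt]
  have := hpq.inv_add_inv_eq_one
  rw [one_div, one_div, this, ENNReal.rpow_one]

theorem IsCompressibleFlow.mono {d : ℕ} {T : ℝ} {L L' : ℝ≥0∞} {X : ℝ → Space d → Space d}
    (h : IsCompressibleFlow T L X) (hL : L ≤ L') : IsCompressibleFlow T L' X :=
  ⟨h.continuousOn, h.aemeasurable, fun t ht => (h.map_le t ht).trans fun s => by
    simp only [Measure.smul_apply, smul_eq_mul]; gcongr⟩

theorem IsBoundedC1Field.isCompressibleFlow {d : ℕ} {K Λ : ℝ} {v : ℝ → Space d → Space d}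
    {v' : ℝ → Space d → Space d →L[ℝ] Space d} (h : IsBoundedC1Field K Λ v v') {T : ℝ}
    (hT : 0 ≤ T) {m : ℝ → ℝ≥0∞}
    (hm : ∀ᵐ t ∂(volume.restrict (Ioo 0 T)), ∀ x, ENNReal.ofReal (-traceCLM d (v' t x)) ≤ m t)
    (hfin : ∫⁻ t in Ioo 0 T, m t ≠ ⊤) {X : ℝ → Space d → Space d}
    (hX : IsClassicalFlow T v X) :
    IsCompressibleFlow T
      (ENNReal.ofReal (Real.exp (2 * ((∫⁻ t in Ioo 0 T, m t).toReal + 1)))) X where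
  continuousOn := Eventually.of_forall fun x => by
    simpa [uIcc_of_le hT] using (hX x).1.continuousOn
  aemeasurable t ht := (h.measurable_flow hX ht).aemeasurable
  map_le t ht := by
    refine Measure.le_iff.2 fun B hB => ?_
    rw [Measure.map_apply (h.measurable_flow hX ht) hB]
    exact h.volume_preimage_flow_le hm hfin hX ht B

/-- The maximal function of the gradient, cut off outside a ball of radius `3R`. -/
noncomputable def localMaximal {d : ℕ} (R : ℝ) (A : Space d → Space d →L[ℝ] Space d)
    (x : Space d) : ℝ≥0∞ :=
  maximalFunction (4 * R) ((Metric.ball (0 : Space d) (3 * R)).indicator fun z => ‖A z‖ₑ) x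

theorem measurable_localMaximal {d : ℕ} (R : ℝ) {A : ℝ → Space d → Space d →L[ℝ] Space d}
    (hA : StronglyMeasurable (Function.uncurry A)) :
    Measurable fun w : ℝ × Space d => localMaximal R (A w.1) w.2 := by
  refine measurable_maximalFunction (4 * R)
    (f := fun w : ℝ × Space d => (Metric.ball (0 : Space d) (3 * R)).indicator
      fun z => ‖A w.1 z‖ₑ) ?_ measurable_snd
  have h1 : Measurable fun w : (ℝ × Space d) × Space d => ‖A w.1.1 w.2‖ₑ :=
    (hA.comp_measurable (g := fun w : (ℝ × Space d) × Space d => (w.1.1, w.2))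
      ((measurable_fst.comp measurable_fst).prodMk measurable_snd)).enorm
  exact h1.indicator (measurable_snd (Metric.isOpen_ball (x := (0 : Space d))
    (ε := 3 * R)).measurableSet)

/-- The bound Λ secures finiteness of the maximal function but does not enter the constant; for
mollified gradients Λ would blow up as δ → 0. -/
theorem lintegral_localMaximal_rpow_le {d : ℕ} {p Λ : ℝ} (hp : 1 < p) (R : ℝ)
    {A : Space d → Space d →L[ℝ] Space d} (hA : Measurable A) (hΛ : ∀ x, ‖A x‖ ≤ Λ) :
    ∫⁻ x, localMaximal R A x ^ p ≤
      ENNReal.ofReal (p * (2 * 4 ^ d) * (2 ^ (p - 1) / (p - 1))) *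
        ∫⁻ x in Metric.ball 0 (3 * R), ‖A x‖ₑ ^ p := by
  have hp0 : 0 < p := by linarith
  refine (lintegral_maximalFunction_rpow_le hp (4 * R)
    (hA.enorm.indicator Metric.isOpen_ball.measurableSet) (B := ENNReal.ofReal Λ)
    ENNReal.ofReal_ne_top fun x => ?_).trans (le_of_eq ?_)
  · refine (indicator_le_self _ _ x).trans ?_
    rw [← ofReal_norm]
    exact ENNReal.ofReal_le_ofReal (hΛ x)
  · rw [← lintegral_indicator Metric.isOpen_ball.measurableSet]
    congr 1
    refine lintegral_congr fun x => ?_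
    by_cases hx : x ∈ Metric.ball (0 : Space d) (3 * R)
    · rw [indicator_of_mem hx, indicator_of_mem hx]
    · rw [indicator_of_notMem hx, indicator_of_notMem hx, ENNReal.zero_rpow_of_pos hp0]

/-- The cube lies in the ball of radius d + 1 and trajectories travel at most K T. This confines
everything to a fixed ball covered by finitely many cubes. -/
theorem mem_ball_of_norm_sub_le {d : ℕ} {K T R : ℝ} (hR : d + 1 + K * T ≤ R) {x z : Space d}
    (hx : x ∈ unitCube d) (hz : ‖z - x‖ ≤ K * T) : z ∈ Metric.ball (0 : Space d) R := by
  have h1 := unitCube_subset_ball d hx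
  rw [mem_ball_zero_iff] at h1 ⊢
  calc ‖z‖ = ‖(z - x) + x‖ := by rw [sub_add_cancel]
    _ ≤ ‖z - x‖ + ‖x‖ := norm_add_le _ _
    _ < R := by linarith

theorem norm_sub_le_of_isACSolution {d : ℕ} {K T t : ℝ} {v : ℝ → Space d → Space d}
    (hK : ∀ t x, ‖v t x‖ ≤ K) {x : Space d} {y : ℝ → Space d} (hy : IsACSolution T v x y)
    (ht : t ∈ Icc 0 T) : ‖y t - x‖ ≤ K * t := by
  have h := norm_sub_le_of_ae_norm_le ((norm_nonneg _).trans (hK 0 0)) hy.1 hy.2.2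
    (Eventually.of_forall fun t => hK t (y t)) le_rfl ht.1 ht.2
  rwa [hy.2.1, sub_zero] at h

/-- The logarithm of the distance of two trajectories is controlled by the difference of the
fields along the first one and by the maximal function of the gradient along both. -/
theorem ofReal_log_le_of_isACSolution {d : ℕ} {K Λ T t r R : ℝ} {v w : ℝ → Space d → Space d}
    {w' : ℝ → Space d → Space d →L[ℝ] Space d} (hK : ∀ t x, ‖v t x‖ ≤ K)
    (hw : IsBoundedC1Field K Λ w w') (hR : d + 1 + K * T ≤ R) (hr : 0 < r) {x : Space d}
    (hx : x ∈ unitCube d) {y z : ℝ → Space d} (hy : IsACSolution T v x y)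
    (hz : IsACSolution T w x z) (ht : t ∈ Icc 0 T) :
    ENNReal.ofReal (1 / 2 * Real.log (1 + ‖y t - z t‖ ^ 2 / r ^ 2)) ≤
      ∫⁻ s in Ioo 0 t, (‖v s (y s) - w s (y s)‖ₑ / ENNReal.ofReal r +
        4 ^ d * (localMaximal R (w' s) (y s) + localMaximal R (w' s) (z s))) := by
  have hK0 : 0 ≤ K := (norm_nonneg _).trans (hK 0 0)
  refine ofReal_log_le_lintegral (y := fun s => y s - z s)
    (y' := fun s => v s (y s) - w s (z s)) hr (hy.1.fun_sub hz.1) ?_ ?_ ?_ ht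
  · rw [hy.2.1, hz.2.1, sub_self]
  · filter_upwards [hy.2.2, hz.2.2] with s h1 h2
    exact h1.sub h2
  · filter_upwards [ae_restrict_mem measurableSet_Ioo] with s hs
    have hs' : s ∈ Icc 0 T := Ioo_subset_Icc_self hs
    have hyR : y s ∈ Metric.ball (0 : Space d) R := mem_ball_of_norm_sub_le hR hx
      ((norm_sub_le_of_isACSolution hK hy hs').trans (by gcongr; exact hs'.2))
    have hzR : z s ∈ Metric.ball (0 : Space d) R := mem_ball_of_norm_sub_le hR hx
      ((norm_sub_le_of_isACSolution hw.norm_le hz hs').trans (by gcongr; exact hs'.2))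
    have h1 := enorm_sub_le_maximalFunction (hw.hasFDerivAt s) (hw.norm_deriv_le s)
      (hw.stronglyMeasurable_deriv.measurable.of_uncurry_left (x := s))
      (f := (Metric.ball (0 : Space d) (3 * R)).indicator fun z => ‖w' s z‖ₑ)
      (fun z hz => by rw [indicator_of_mem hz]) hyR hzR
    -- The intermediate term w(y) puts the difference of the fields on the first trajectory and
    -- leaves the spatial increment to the smooth field w.
    calc ‖v s (y s) - w s (z s)‖ₑ
        = ‖(v s (y s) - w s (y s)) + (w s (y s) - w s (z s))‖ₑ := by rw [sub_add_sub_cancel]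
      _ ≤ _ := (enorm_add_le _ _).trans (add_le_add_right h1 _)
      _ = _ := by rw [localMaximal, localMaximal]; ring

namespace IsCompressibleFlow

variable {d : ℕ} {T R : ℝ} {L : ℝ≥0∞} {X : ℝ → Space d → Space d}

/-- The change of variables for periodic functions. -/
theorem lintegral_comp_torusMeasure_le (h : IsCompressibleFlow T L X) {t : ℝ}
    (ht : t ∈ Icc 0 T) (hX : ∀ᵐ x, x ∈ unitCube d → X t x ∈ Metric.ball (0 : Space d) R) {n : ℕ}
    (hn : ∀ g : Space d → ℝ≥0∞, IsPeriodic g →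
      ∫⁻ x in Metric.ball 0 R, g x ≤ n * ∫⁻ x, g x ∂torusMeasure d)
    {f : Space d → ℝ≥0∞} (hf : Measurable f) (hper : IsPeriodic f) :
    ∫⁻ x, f (X t x) ∂torusMeasure d ≤ L * n * ∫⁻ x, f x ∂torusMeasure d := by
  calc ∫⁻ x, f (X t x) ∂torusMeasure d
      ≤ ∫⁻ x, (Metric.ball (0 : Space d) R).indicator f (X t x) ∂torusMeasure d := by
        refine lintegral_mono_ae ?_
        rw [torusMeasure]
        filter_upwards [ae_restrict_of_ae hX, ae_restrict_mem (measurableSet_unitCube d)]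
          with x hx1 hx2
        rw [indicator_of_mem (hx1 hx2)]
    _ ≤ ∫⁻ x, (Metric.ball (0 : Space d) R).indicator f (X t x) := setLIntegral_le_lintegral _ _
    _ ≤ L * ∫⁻ x, (Metric.ball (0 : Space d) R).indicator f x :=
        h.lintegral_comp_le ht (hf.indicator Metric.isOpen_ball.measurableSet)
    _ ≤ L * (n * ∫⁻ x, f x ∂torusMeasure d) := by
        rw [lintegral_indicator Metric.isOpen_ball.measurableSet]
        exact mul_le_mul_right (hn f hper) _
    _ = _ := by rw [mul_assoc]

theorem aemeasurable_prodMk (h : IsCompressibleFlow T L X) {t : ℝ} (ht : t ≤ T) :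
    AEMeasurable (fun w : ℝ × Space d => (w.1, X w.1 w.2))
      ((volume.restrict (Ioo 0 t)).prod (torusMeasure d)) := by
  refine measurable_fst.aemeasurable.prodMk ?_
  refine h.aemeasurable_uncurry.mono_ac ?_
  exact (Measure.absolutelyContinuous_of_le (Measure.restrict_mono
    (Ioo_subset_Ioo le_rfl ht) le_rfl)).prod
    (Measure.absolutelyContinuous_of_le Measure.restrict_le_self)

theorem aemeasurable_torusMeasure (h : IsCompressibleFlow T L X) {t : ℝ} (ht : t ∈ Icc 0 T) :
    AEMeasurable (X t) (torusMeasure d) := (h.aemeasurable t ht).restrict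

end IsCompressibleFlow

theorem norm_sub_le_of_isACSolution_of_isACSolution {d : ℕ} {K T t : ℝ}
    {v w : ℝ → Space d → Space d} (hv : ∀ t x, ‖v t x‖ ≤ K) (hw : ∀ t x, ‖w t x‖ ≤ K) {x : Space d}
    {y z : ℝ → Space d} (hy : IsACSolution T v x y) (hz : IsACSolution T w x z)
    (ht : t ∈ Icc 0 T) : ‖y t - z t‖ ≤ 2 * K * t := by
  have h1 := norm_sub_le_of_isACSolution hv hy ht
  have h2 := norm_sub_le_of_isACSolution hw hz ht
  calc ‖y t - z t‖ = ‖(y t - x) - (z t - x)‖ := by rw [sub_sub_sub_cancel_right]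
    _ ≤ ‖y t - x‖ + ‖z t - x‖ := norm_sub_le _ _
    _ ≤ _ := by linarith

theorem rpow_lintegral_const_mul_rpow {α : Type*} [MeasurableSpace α] {μ : Measure α} {p : ℝ}
    (hp : 0 < p) {c : ℝ≥0∞} (hc : c ≠ ⊤) (f : α → ℝ≥0∞) :
    (∫⁻ x, (c * f x) ^ p ∂μ) ^ (1 / p) = c * (∫⁻ x, f x ^ p ∂μ) ^ (1 / p) := by
  simp only [ENNReal.mul_rpow_of_nonneg _ _ hp.le]
  rw [lintegral_const_mul' _ _ (ENNReal.rpow_lt_top_of_nonneg hp.le hc).ne,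
    ENNReal.mul_rpow_of_nonneg _ _ (by positivity), ← ENNReal.rpow_mul, mul_one_div_cancel hp.ne',
    ENNReal.rpow_one]

theorem rpow_lintegral_div_add_rpow_le {α : Type*} [MeasurableSpace α] {μ : Measure α} {p : ℝ}
    (hp : 1 ≤ p) {r c : ℝ≥0∞} (hr : r ≠ 0) (hc : c ≠ ⊤) {f g h : α → ℝ≥0∞}
    (hf : AEMeasurable f μ) (hg : AEMeasurable g μ) (hh : AEMeasurable h μ) {a₁ a₂ a₃ : ℝ≥0∞}
    (h1 : (∫⁻ x, f x ^ p ∂μ) ^ (1 / p) ≤ a₁) (h2 : (∫⁻ x, g x ^ p ∂μ) ^ (1 / p) ≤ a₂)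
    (h3 : (∫⁻ x, h x ^ p ∂μ) ^ (1 / p) ≤ a₃) :
    (∫⁻ x, (f x / r + c * (g x + h x)) ^ p ∂μ) ^ (1 / p) ≤ a₁ / r + c * (a₂ + a₃) := by
  have hp0 : 0 < p := by linarith
  calc (∫⁻ x, (f x / r + c * (g x + h x)) ^ p ∂μ) ^ (1 / p)
      = (∫⁻ x, ((fun x => r⁻¹ * f x) + fun x => c * (g + h) x) x ^ p ∂μ) ^ (1 / p) := by
        simp only [Pi.add_apply, ENNReal.div_eq_inv_mul]
    _ ≤ (∫⁻ x, (r⁻¹ * f x) ^ p ∂μ) ^ (1 / p) + (∫⁻ x, (c * (g + h) x) ^ p ∂μ) ^ (1 / p) :=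
        ENNReal.lintegral_Lp_add_le (hf.const_mul _) ((hg.add hh).const_mul _) hp
    _ = r⁻¹ * (∫⁻ x, f x ^ p ∂μ) ^ (1 / p) + c * (∫⁻ x, (g + h) x ^ p ∂μ) ^ (1 / p) := by
        rw [rpow_lintegral_const_mul_rpow hp0 (ENNReal.inv_ne_top.2 hr),
          rpow_lintegral_const_mul_rpow hp0 hc]
    _ ≤ r⁻¹ * a₁ + c * (a₂ + a₃) :=
        add_le_add (mul_le_mul_right h1 _) (mul_le_mul_right
          ((ENNReal.lintegral_Lp_add_le hg hh hp).trans (add_le_add h2 h3)) _)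
    _ = _ := by rw [ENNReal.div_eq_inv_mul]

theorem rpow_lintegral_rpow_le_mul {p : ℝ} (hp : 0 < p) {I J c : ℝ≥0∞} (h : I ≤ c * J) :
    I ^ (1 / p) ≤ c ^ (1 / p) * J ^ (1 / p) := by
  rw [← ENNReal.mul_rpow_of_nonneg _ _ (by positivity)]
  gcongr

/-- Four bounds in a row: compression of the flow, the strong-type estimate on ℝ^d for the gradient
cut off to B(0, 3R), covering that ball by cubes, and Jensen for the mollified gradient. None of the
factors depends on the kernel. -/
theorem IsCompressibleFlow.lintegral_localMaximal_comp_rpow_le {d : ℕ} {T R p δ K : ℝ} {L : ℝ≥0∞}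
    {X : ℝ → Space d → Space d} (h : IsCompressibleFlow T L X) (hp : 1 < p) {t : ℝ}
    (ht : t ∈ Icc 0 T) {n : ℕ}
    (hn : ∀ g : Space d → ℝ≥0∞, IsPeriodic g →
      ∫⁻ x in Metric.ball 0 (3 * R), g x ≤ n * ∫⁻ x, g x ∂torusMeasure d)
    {ρ : Space d → ℝ} (hρ : IsKernel δ ρ) {v : ℝ → Space d → Space d}
    (hv : StronglyMeasurable (Function.uncurry v)) (hK : ∀ t x, ‖v t x‖ ≤ K)
    (hper : IsPeriodic (v t)) {g : Space d → Space d →L[ℝ] Space d} (hvg : IsWeakGradient (v t) g)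
    (hg : Measurable g) (hgper : IsPeriodic g) :
    ∫⁻ x, localMaximal R (mollDeriv ρ (v t)) (X t x) ^ p ∂torusMeasure d ≤
      L * (ENNReal.ofReal (p * (2 * 4 ^ d) * (2 ^ (p - 1) / (p - 1))) * n) *
        ∫⁻ x, ‖g x‖ₑ ^ p ∂torusMeasure d := by
  have hw := hρ.isBoundedC1Field_moll hv hK
  have hm : Measurable (mollDeriv ρ (v t)) :=
    hw.stronglyMeasurable_deriv.measurable.of_uncurry_left (x := t)
  have hM : Measurable fun x => localMaximal R (mollDeriv ρ (v t)) x :=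
    (measurable_localMaximal R hw.stronglyMeasurable_deriv).of_uncurry_left
      (f := fun s x => localMaximal R (mollDeriv ρ (v s)) x) (x := t)
  calc ∫⁻ x, localMaximal R (mollDeriv ρ (v t)) (X t x) ^ p ∂torusMeasure d
      ≤ ∫⁻ x, localMaximal R (mollDeriv ρ (v t)) (X t x) ^ p := setLIntegral_le_lintegral _ _
    _ ≤ L * ∫⁻ x, localMaximal R (mollDeriv ρ (v t)) x ^ p :=
        h.lintegral_comp_le ht (hM.pow_const p)
    _ ≤ L * (ENNReal.ofReal (p * (2 * 4 ^ d) * (2 ^ (p - 1) / (p - 1))) *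
          ∫⁻ x in Metric.ball 0 (3 * R), ‖mollDeriv ρ (v t) x‖ₑ ^ p) :=
        mul_le_mul_right (lintegral_localMaximal_rpow_le hp R hm (hw.norm_deriv_le t)) _
    _ ≤ L * (ENNReal.ofReal (p * (2 * 4 ^ d) * (2 ^ (p - 1) / (p - 1))) *
          (n * ∫⁻ x, ‖mollDeriv ρ (v t) x‖ₑ ^ p ∂torusMeasure d)) :=
        mul_le_mul_right (mul_le_mul_right
          (hn _ ((hper.mollDeriv ρ).comp fun a => ‖a‖ₑ ^ p)) _) _
    _ ≤ L * (ENNReal.ofReal (p * (2 * 4 ^ d) * (2 ^ (p - 1) / (p - 1))) *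
          (n * ∫⁻ x, ‖g x‖ₑ ^ p ∂torusMeasure d)) :=
        mul_le_mul_right (mul_le_mul_right (mul_le_mul_right
          (hρ.lintegral_mollDeriv_rpow_le hvg hg hgper hp.le) _) _) _
    _ = _ := by ring

/-- The integrated Crippa–De Lellis estimate. The quantifier order is the point: c is fixed by d, T,
p, K and the compression bound L before the kernel and the flows are chosen, so it serves all δ and
η. -/
theorem exists_lintegral_log_rpow_le {d : ℕ} {T p K : ℝ} (hp : 1 < p) (L : ℝ≥0) :
    ∃ c : ℝ≥0, ∀ (v : ℝ → Space d → Space d) (G : ℝ → Space d → Space d →L[ℝ] Space d)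
      (m : ℝ → ℝ≥0∞), IsSobolevField T p K v G m →
      ∀ (δ : ℝ) (ρ : Space d → ℝ), IsKernel δ ρ → ∀ X Y : ℝ → Space d → Space d,
      IsCompressibleFlow T L X → IsCompressibleFlow T L Y →
      (∀ᵐ x, IsACSolution T v x fun t => X t x) →
      IsClassicalFlow T (fun t => moll ρ (v t)) Y → ∀ t ∈ Icc 0 T, ∀ r : ℝ, 0 < r →
      (∫⁻ x, ENNReal.ofReal (1 / 2 * Real.log (1 + ‖X t x - Y t x‖ ^ 2 / r ^ 2)) ^ p
        ∂torusMeasure d) ^ (1 / p) ≤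
      c * ((∫⁻ s in Ioo 0 t, (∫⁻ x, ‖v s x - moll ρ (v s) x‖ₑ ^ p ∂torusMeasure d) ^ (1 / p)) /
          ENNReal.ofReal r +
        ∫⁻ s in Ioo 0 T, (∫⁻ x, ‖G s x‖ₑ ^ p ∂torusMeasure d) ^ (1 / p)) := by
  have hp0 : 0 < p := by linarith
  set R : ℝ := d + 1 + K * T with hR
  obtain ⟨n, hn⟩ := exists_setLIntegral_ball_le d R
  obtain ⟨n₃, hn₃⟩ := exists_setLIntegral_ball_le d (3 * R)
  set Cp : ℝ := p * (2 * 4 ^ d) * (2 ^ (p - 1) / (p - 1)) with hCp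
  -- `a` is the cost of changing variables in the field difference along X; `b` is the cost of each
  -- of the two maximal-function terms.
  set a : ℝ≥0∞ := (L * n : ℝ≥0∞) ^ (1 / p) with ha
  set b : ℝ≥0∞ := (L * (ENNReal.ofReal Cp * n₃)) ^ (1 / p) with hb
  have ha1 : a ≠ ⊤ := (ENNReal.rpow_lt_top_of_nonneg (by positivity)
    (ENNReal.mul_ne_top ENNReal.coe_ne_top (by simp))).ne
  have hb1 : b ≠ ⊤ := (ENNReal.rpow_lt_top_of_nonneg (by positivity)
    (ENNReal.mul_ne_top ENNReal.coe_ne_top (ENNReal.mul_ne_top (by simp) (by simp)))).ne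
  have hab : a + 4 ^ d * (b + b) ≠ ⊤ := ENNReal.add_ne_top.2 ⟨ha1, ENNReal.mul_ne_top
    (ENNReal.pow_ne_top (by simp)) (ENNReal.add_ne_top.2 ⟨hb1, hb1⟩)⟩
  refine ⟨(a + 4 ^ d * (b + b)).toNNReal, fun v G m hv δ ρ hρ X Y hX Y' hXs hYs t ht r hr => ?_⟩
  rw [ENNReal.coe_toNNReal hab]
  have hw := hρ.isBoundedC1Field_moll hv.stronglyMeasurable hv.norm_le
  set w : ℝ → Space d → Space d := fun t => moll ρ (v t) with hwdef
  set w' := fun t => mollDeriv ρ (v t) with hw'def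
  have hR0 : ENNReal.ofReal r ≠ 0 := by simpa using hr
  have hri : (ENNReal.ofReal r)⁻¹ ≠ ⊤ := ENNReal.inv_ne_top.2 hR0
  have h4 : (4 : ℝ≥0∞) ^ d ≠ ⊤ := ENNReal.pow_ne_top (by simp)
  have hK0 : 0 ≤ K := hw.bound_nonneg
  have hmd : Measurable fun z : ℝ × Space d => ‖v z.1 z.2 - w z.1 z.2‖ₑ :=
    (hv.stronglyMeasurable.sub hw.stronglyMeasurable).measurable.enorm
  have hmM := measurable_localMaximal R hw.stronglyMeasurable_deriv
  have hmds : ∀ s, Measurable fun z : Space d => ‖v s z - w s z‖ₑ := fun s =>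
    hmd.of_uncurry_left (f := fun s z => ‖v s z - w s z‖ₑ) (x := s)
  have hmMs : ∀ s, Measurable fun z : Space d => localMaximal R (w' s) z := fun s =>
    hmM.of_uncurry_left (f := fun s z => localMaximal R (w' s) z) (x := s)
  have hXt := hX.aemeasurable_prodMk ht.2
  have hYt := Y'.aemeasurable_prodMk ht.2
  have hmG : Measurable fun s => (∫⁻ x, ‖G s x‖ₑ ^ p ∂torusMeasure d) ^ (1 / p) :=
    (Measurable.lintegral_prod_right' (f := fun z : ℝ × Space d => ‖G z.1 z.2‖ₑ ^ p)
      (hv.stronglyMeasurable_grad.measurable.enorm.pow_const p)).pow_const _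
  have hdist : ∀ᵐ x ∂torusMeasure d, ‖X t x - Y t x‖ ≤ 2 * K * t := by
    filter_upwards [ae_restrict_of_ae hXs] with x hx
    exact norm_sub_le_of_isACSolution_of_isACSolution (y := fun t => X t x) (z := fun t => Y t x)
      hv.norm_le hw.norm_le hx (hYs x) ht
  set g : ℝ → Space d → ℝ≥0∞ := fun s x =>
    ‖v s (X s x) - w s (X s x)‖ₑ / ENNReal.ofReal r +
      4 ^ d * (localMaximal R (w' s) (X s x) + localMaximal R (w' s) (Y s x)) with hg
  have hF : AEMeasurable (fun x => ENNReal.ofReal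
      (1 / 2 * Real.log (1 + ‖X t x - Y t x‖ ^ 2 / r ^ 2))) (torusMeasure d) := by
    have h1 : AEMeasurable (fun x => X t x - Y t x) (torusMeasure d) :=
      (hX.aemeasurable_torusMeasure ht).sub (Y'.aemeasurable_torusMeasure ht)
    exact ((Real.measurable_log.comp_aemeasurable
      ((h1.norm.pow_const 2).div_const (r ^ 2) |>.const_add 1)).const_mul _).ennreal_ofReal
  have hgm : AEMeasurable (Function.uncurry g)
      ((volume.restrict (Ioo 0 t)).prod (torusMeasure d)) :=
    ((hmd.comp_aemeasurable hXt).div_const _).add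
      (((hmM.comp_aemeasurable hXt).add (hmM.comp_aemeasurable hYt)).const_mul _)
  have hlog : ∀ᵐ x ∂torusMeasure d, ENNReal.ofReal
      (1 / 2 * Real.log (1 + ‖X t x - Y t x‖ ^ 2 / r ^ 2)) ≤ ∫⁻ s in Ioo 0 t, g s x := by
    rw [torusMeasure]
    filter_upwards [ae_restrict_of_ae hXs, ae_restrict_mem (measurableSet_unitCube d)]
      with x hx1 hx2
    exact ofReal_log_le_of_isACSolution (R := R) (y := fun t => X t x) (z := fun t => Y t x)
      hv.norm_le hw hR.ge hr hx2 hx1 (hYs x) ht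
  -- The explicit bound on the logarithm, from |X - Y| ≤ 2Kt, only provides the finiteness required
  -- by Minkowski's inequality.
  refine (rpow_lintegral_rpow_le_lintegral hp hF hgm
    (B := ENNReal.ofReal (1 / 2 * Real.log (1 + (2 * K * t) ^ 2 / r ^ 2)))
    ENNReal.ofReal_ne_top ?_ hlog).trans ?_
  · filter_upwards [hdist] with x hx
    gcongr
  set e : ℝ → ℝ≥0∞ := fun s => (∫⁻ x, ‖v s x - w s x‖ₑ ^ p ∂torusMeasure d) ^ (1 / p) with he
  set γ : ℝ → ℝ≥0∞ := fun s => (∫⁻ x, ‖G s x‖ₑ ^ p ∂torusMeasure d) ^ (1 / p) with hγ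
  have hs : ∀ᵐ s ∂(volume.restrict (Ioo 0 t)), (∫⁻ x, g s x ^ p ∂torusMeasure d) ^ (1 / p) ≤
      (a / ENNReal.ofReal r) * e s + 4 ^ d * (b + b) * γ s := by
    have hsub : ∀ᵐ s ∂(volume.restrict (Ioo 0 t)), IsWeakGradient (v s) (G s) :=
      (Measure.absolutelyContinuous_of_le (Measure.restrict_mono
        (Ioo_subset_Ioo le_rfl ht.2) le_rfl)).ae_le hv.weakGradient
    filter_upwards [hsub, ae_restrict_mem measurableSet_Ioo] with s hsw hs
    have hsT : s ∈ Icc 0 T := ⟨hs.1.le, hs.2.le.trans ht.2⟩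
    have hball : ∀ᵐ x, x ∈ unitCube d → X s x ∈ Metric.ball (0 : Space d) R := by
      filter_upwards [hXs] with x hx hxc
      exact mem_ball_of_norm_sub_le le_rfl hxc ((norm_sub_le_of_isACSolution hv.norm_le hx
        hsT).trans (by gcongr; exact hsT.2))
    have hXm := hX.aemeasurable_torusMeasure hsT
    have hYm := Y'.aemeasurable_torusMeasure hsT
    have hGm : Measurable (G s) :=
      hv.stronglyMeasurable_grad.measurable.of_uncurry_left (x := s)
    have b1 : (∫⁻ x, ‖v s (X s x) - w s (X s x)‖ₑ ^ p ∂torusMeasure d) ^ (1 / p) ≤ a * e s :=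
      rpow_lintegral_rpow_le_mul hp0 (hX.lintegral_comp_torusMeasure_le hsT hball hn
        (f := fun z => ‖v s z - w s z‖ₑ ^ p) ((hmds s).pow_const p) fun i x => by
          simp only [hwdef, hv.periodic s i x, (hv.periodic s).moll ρ i x])
    have b2 : (∫⁻ x, localMaximal R (w' s) (X s x) ^ p ∂torusMeasure d) ^ (1 / p) ≤ b * γ s :=
      rpow_lintegral_rpow_le_mul hp0 (hX.lintegral_localMaximal_comp_rpow_le hp hsT hn₃ hρ
        hv.stronglyMeasurable hv.norm_le (hv.periodic s) hsw hGm (hv.periodic_grad s))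
    have b3 : (∫⁻ x, localMaximal R (w' s) (Y s x) ^ p ∂torusMeasure d) ^ (1 / p) ≤ b * γ s :=
      rpow_lintegral_rpow_le_mul hp0 (Y'.lintegral_localMaximal_comp_rpow_le hp hsT hn₃ hρ
        hv.stronglyMeasurable hv.norm_le (hv.periodic s) hsw hGm (hv.periodic_grad s))
    have m1 : AEMeasurable (fun x => ‖v s (X s x) - w s (X s x)‖ₑ) (torusMeasure d) :=
      (hmds s).comp_aemeasurable hXm
    have m2 : AEMeasurable (fun x => localMaximal R (w' s) (X s x)) (torusMeasure d) :=
      (hmMs s).comp_aemeasurable hXm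
    have m3 : AEMeasurable (fun x => localMaximal R (w' s) (Y s x)) (torusMeasure d) :=
      (hmMs s).comp_aemeasurable hYm
    refine (rpow_lintegral_div_add_rpow_le hp.le hR0 h4 m1 m2 m3 b1 b2 b3).trans (le_of_eq ?_)
    simp only [ENNReal.div_eq_inv_mul]; ring
  have h4b : 4 ^ d * (b + b) ≠ ⊤ := ENNReal.mul_ne_top h4 (ENNReal.add_ne_top.2 ⟨hb1, hb1⟩)
  calc ∫⁻ s in Ioo 0 t, (∫⁻ x, g s x ^ p ∂torusMeasure d) ^ (1 / p)
      ≤ ∫⁻ s in Ioo 0 t, ((a / ENNReal.ofReal r) * e s + 4 ^ d * (b + b) * γ s) :=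
        lintegral_mono_ae hs
    _ = (a / ENNReal.ofReal r) * (∫⁻ s in Ioo 0 t, e s) +
          4 ^ d * (b + b) * ∫⁻ s in Ioo 0 t, γ s := by
        rw [lintegral_add_right _ (hmG.const_mul _),
          lintegral_const_mul' _ _ (ENNReal.div_ne_top ha1 hR0), lintegral_const_mul' _ _ h4b]
    _ ≤ (a / ENNReal.ofReal r) * (∫⁻ s in Ioo 0 t, e s) +
          4 ^ d * (b + b) * ∫⁻ s in Ioo 0 T, γ s :=
        add_le_add_right (mul_le_mul_right
          (lintegral_mono_set (Ioo_subset_Ioo le_rfl ht.2)) _) _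
    _ = a * ((∫⁻ s in Ioo 0 t, e s) / ENNReal.ofReal r) +
          4 ^ d * (b + b) * ∫⁻ s in Ioo 0 T, γ s := by
        simp only [ENNReal.div_eq_inv_mul]; ring
    _ ≤ (a + 4 ^ d * (b + b)) * ((∫⁻ s in Ioo 0 t, e s) / ENNReal.ofReal r) +
          (a + 4 ^ d * (b + b)) * ∫⁻ s in Ioo 0 T, γ s :=
        add_le_add (mul_le_mul_left le_self_add _) (mul_le_mul_left le_add_self _)
    _ = _ := (mul_add _ _ _).symm

/-! ### From the logarithmic bound to the L^p distance -/

/-- Concavity of D ↦ log(1 + D/r), which lies above its chord on [0, s]; it appears here as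
Bernoulli's inequality (1 + s/r)^(D/s) ≤ 1 + D/r. -/
theorem mul_log_one_add_div_le {D s r : ℝ} (hD : 0 ≤ D) (hDs : D ≤ s) (hs : 0 < s) (hr : 0 < r) :
    D * Real.log (1 + s / r) ≤ s * Real.log (1 + D / r) := by
  have h1 := rpow_one_add_le_one_add_mul_self (s := s / r) (p := D / s)
    (by linarith [div_pos hs hr]) (div_nonneg hD hs.le) ((div_le_one hs).2 hDs)
  have h2 : 0 < 1 + s / r := by positivity
  have h3 := Real.log_le_log (Real.rpow_pos_of_pos h2 _) h1
  rw [Real.log_rpow h2, div_mul_div_cancel₀ hs.ne', div_mul_eq_mul_div, div_le_iff₀ hs] at h3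
  linarith

/-- From (1 + a)² ≤ 2(1 + a²), with ½ log 2 rounded up to 1. -/
theorem log_one_add_le {a : ℝ} (ha : 0 ≤ a) :
    Real.log (1 + a) ≤ 1 / 2 * Real.log (1 + a ^ 2) + 1 := by
  have h1 : Real.log ((1 + a) ^ 2) ≤ Real.log (2 * (1 + a ^ 2)) :=
    Real.log_le_log (by positivity) (by nlinarith [sq_nonneg (a - 1)])
  rw [Real.log_pow, Real.log_mul two_ne_zero (by positivity)] at h1
  push_cast at h1
  linarith [Real.log_two_lt_d9]

theorem le_mul_log_one_add_sq {D s r : ℝ} (hD : 0 ≤ D) (hDs : D ≤ s) (hs : 0 < s) (hr : 0 < r) :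
    D ≤ s / Real.log (1 + s / r) * (1 / 2 * Real.log (1 + D ^ 2 / r ^ 2) + 1) := by
  have hlog : 0 < Real.log (1 + s / r) := Real.log_pos (by linarith [div_pos hs hr])
  rw [div_mul_eq_mul_div, le_div_iff₀ hlog]
  refine (mul_log_one_add_div_le hD hDs hs hr).trans (mul_le_mul_of_nonneg_left ?_ hs.le)
  rw [← div_pow]
  exact log_one_add_le (div_nonneg hD hr.le)

/-- From log E = log s - log(s/E) one gets |log E| ≤ log(1 + s/E) + |log s|, and log(1 + s/E) ≥ log
2 absorbs the last term multiplicatively. The factor on the right tends to 0 with s. The case E > 1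
is included. -/
theorem div_log_one_add_le {s E : ℝ} (hE : 0 < E) (hEs : E ≤ s) (hE1 : E ≠ 1) :
    s / Real.log (1 + s / E) ≤ (s + |s * Real.log s| / Real.log 2) * |Real.log E|⁻¹ := by
  have hs : 0 < s := hE.trans_le hEs
  have h2 : 0 < Real.log 2 := Real.log_pos one_lt_two
  have hE0 : 0 < |Real.log E| :=
    abs_pos.2 (Real.log_ne_zero_of_pos_of_ne_one hE hE1)
  have h1 : Real.log 2 ≤ Real.log (1 + s / E) :=
    Real.log_le_log two_pos (by linarith [(one_le_div hE).2 hEs])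
  have h3 : |Real.log E| ≤ Real.log (1 + s / E) + |Real.log s| := by
    have h4 : Real.log E = Real.log s - Real.log (s / E) := by
      rw [Real.log_div hs.ne' hE.ne']; ring
    have h5 : 0 ≤ Real.log (s / E) := Real.log_nonneg ((one_le_div hE).2 hEs)
    have h6 : Real.log (s / E) ≤ Real.log (1 + s / E) :=
      Real.log_le_log (div_pos hs hE) (by linarith)
    rw [h4]
    refine (abs_sub _ _).trans ?_
    rw [abs_of_nonneg h5]
    linarith
  rw [← div_eq_mul_inv, div_le_div_iff₀ (h2.trans_le h1) hE0, abs_mul, abs_of_pos hs]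
  have h7 : |Real.log s| ≤ |Real.log s| / Real.log 2 * Real.log (1 + s / E) := by
    rw [div_mul_eq_mul_div, le_div_iff₀ h2]
    gcongr
  calc s * |Real.log E| ≤ s * (Real.log (1 + s / E) + |Real.log s|) := by gcongr
    _ ≤ s * (Real.log (1 + s / E) + |Real.log s| / Real.log 2 * Real.log (1 + s / E)) := by gcongr
    _ = _ := by ring

/-- Takes L^p norms in `le_mul_log_one_add_sq`; its additive 1 contributes exactly 1 because the
torus has total mass one. -/
theorem eLpNorm_le_of_log_le {d : ℕ} {p s r : ℝ} (hp : 1 < p) (hs : 0 < s) (hr : 0 < r)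
    {f : Space d → Space d} (hf : AEMeasurable f (torusMeasure d))
    (hfs : ∀ᵐ x ∂torusMeasure d, ‖f x‖ ≤ s) {B : ℝ} (hB : 0 ≤ B)
    (hlog : (∫⁻ x, ENNReal.ofReal (1 / 2 * Real.log (1 + ‖f x‖ ^ 2 / r ^ 2)) ^ p
      ∂torusMeasure d) ^ (1 / p) ≤ ENNReal.ofReal B) :
    eLpNorm f (ENNReal.ofReal p) (torusMeasure d) ≤
      ENNReal.ofReal ((B + 1) * (s / Real.log (1 + s / r))) := by
  have hp0 : 0 < p := by linarith
  have hlog0 : 0 < Real.log (1 + s / r) := Real.log_pos (by linarith [div_pos hs hr])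
  set F : Space d → ℝ≥0∞ := fun x => ENNReal.ofReal (1 / 2 * Real.log (1 + ‖f x‖ ^ 2 / r ^ 2))
    with hF
  have hFm : AEMeasurable F (torusMeasure d) :=
    ((Real.measurable_log.comp_aemeasurable
      ((hf.norm.pow_const 2).div_const (r ^ 2) |>.const_add 1)).const_mul _).ennreal_ofReal
  set c := s / Real.log (1 + s / r) with hc
  have hc0 : 0 ≤ c := by positivity
  have h1 : ∀ᵐ x ∂torusMeasure d, ‖f x‖ₑ ≤ ENNReal.ofReal c * (F + fun _ => 1 : Space d → ℝ≥0∞) x := by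
    filter_upwards [hfs] with x hx
    have h0 : 0 ≤ Real.log (1 + ‖f x‖ ^ 2 / r ^ 2) :=
      Real.log_nonneg (by linarith [show 0 ≤ ‖f x‖ ^ 2 / r ^ 2 by positivity])
    rw [Pi.add_apply, hF, ← ENNReal.ofReal_one, ← ENNReal.ofReal_add (by positivity) zero_le_one,
      ← ENNReal.ofReal_mul hc0, ← ofReal_norm]
    exact ENNReal.ofReal_le_ofReal (le_mul_log_one_add_sq (norm_nonneg _) hx hs hr)
  rw [eLpNorm_torusMeasure_eq hp]
  calc (∫⁻ x, ‖f x‖ₑ ^ p ∂torusMeasure d) ^ (1 / p)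
      ≤ (∫⁻ x, (ENNReal.ofReal c * (F + fun _ => 1 : Space d → ℝ≥0∞) x) ^ p ∂torusMeasure d) ^ (1 / p) := by
        refine ENNReal.rpow_le_rpow (lintegral_mono_ae ?_) (by positivity)
        filter_upwards [h1] with x hx
        exact ENNReal.rpow_le_rpow hx hp0.le
    _ = ENNReal.ofReal c * (∫⁻ x, (F + fun _ => 1 : Space d → ℝ≥0∞) x ^ p ∂torusMeasure d) ^ (1 / p) :=
        rpow_lintegral_const_mul_rpow hp0 ENNReal.ofReal_ne_top _
    _ ≤ ENNReal.ofReal c * ((∫⁻ x, F x ^ p ∂torusMeasure d) ^ (1 / p) +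
          (∫⁻ _, 1 ^ p ∂torusMeasure d) ^ (1 / p)) :=
        mul_le_mul_right (ENNReal.lintegral_Lp_add_le hFm aemeasurable_const hp.le) _
    _ ≤ ENNReal.ofReal c * (ENNReal.ofReal B + ENNReal.ofReal 1) := by
        refine mul_le_mul_right (add_le_add hlog (le_of_eq ?_)) _
        simp
    _ = _ := by
        rw [← ENNReal.ofReal_add hB zero_le_one, ← ENNReal.ofReal_mul hc0, mul_comm c]

/-- All the analysis enters the main theorem through these bounds, whose constants precede δ and η.
The scale r ≥ E_δ(t) is left free so that E_δ(t) = 0 can be handled by letting r → 0. -/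
theorem IsRegularLagrangianFlow.exists_eLpNorm_sub_le {d : ℕ} {T p : ℝ} (hT : 0 < T) (hp : 1 < p)
    {u : ℝ → Space d → Space d} (hu : IsAdmissible T p u) {Φ : ℝ → Space d → Space d}
    (hΦ : IsRegularLagrangianFlow T u Φ) :
    ∃ S B H : ℝ, 0 < S ∧ 0 ≤ B ∧ 0 ≤ H ∧ ∀ η : Space d → ℝ, IsMollifier η → ∀ δ : ℝ, 0 < δ →
      ∀ Φδ : ℝ → Space d → Space d, IsClassicalFlow T (regularise η δ u) Φδ → ∀ t ∈ Icc 0 T,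
        normL1Lp p t (u - regularise η δ u) ≤ ENNReal.ofReal (S * t) ∧
        normL1Lp p t (u - regularise η δ u) ≤ ENNReal.ofReal (δ * H) ∧
        eLpNorm (fun x => Φ t x - Φδ t x) (ENNReal.ofReal p) (torusMeasure d) ≤
          ENNReal.ofReal (S * t) ∧
        (0 < t → ∀ r : ℝ, 0 < r → normL1Lp p t (u - regularise η δ u) ≤ ENNReal.ofReal r →
          eLpNorm (fun x => Φ t x - Φδ t x) (ENNReal.ofReal p) (torusMeasure d) ≤
            ENNReal.ofReal ((B + 1) * (S * t / Real.log (1 + S * t / r)))) := by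
  have hp0 : 0 < p := by linarith
  obtain ⟨K, v, G, m, hv, huv⟩ := hu.exists_isSobolevField hp
  obtain ⟨L₁, hL₁⟩ := hΦ.exists_isCompressibleFlow hT.le
  have hsol := hΦ.isACSolution_of_ae_eq hT.le huv
  set L₂ : ℝ≥0 := (Real.exp (2 * ((∫⁻ t in Ioo 0 T, m t).toReal + 1))).toNNReal with hL₂
  obtain ⟨c, hc⟩ := exists_lintegral_log_rpow_le (d := d) (T := T) (K := K) hp (L₁ ⊔ L₂)
  set H := ∫⁻ s in Ioo 0 T, (∫⁻ x, ‖G s x‖ₑ ^ p ∂torusMeasure d) ^ (1 / p) with hH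
  have hHt : H ≠ ⊤ := hv.lintegral_grad_ne_top
  have hK : 0 ≤ K := (norm_nonneg _).trans (hv.norm_le 0 0)
  -- The extra 1 makes S positive even when K = 0. `H` is the L¹L^p norm of the gradient, and B
  -- bounds the logarithmic functional once E_δ(t)/r ≤ 1.
  refine ⟨2 * K + 1, c * (1 + H.toReal), H.toReal, by positivity, by positivity, by positivity,
    fun η hη δ hδ Φδ hΦδ t ht => ?_⟩
  have hρ := hη.isKernel_rescale hδ
  set ρ := rescale η δ with hρd
  have huvt : ∀ᵐ s ∂(volume.restrict (Ioo 0 T)), u s =ᵐ[volume] v s :=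
    Measure.ae_ae_of_ae_prod huv
  have hreg : ∀ᵐ s ∂(volume.restrict (Ioo 0 T)), regularise η δ u s = moll ρ (v s) := by
    filter_upwards [huvt] with s hs
    exact moll_congr_ae ρ hs
  have hw := hρ.isBoundedC1Field_moll hv.stronglyMeasurable hv.norm_le
  -- Convolution ignores null sets, so for almost every time the two mollified fields agree at every
  -- point and every trajectory of Φδ is one for the representative.
  have hY : IsClassicalFlow T (fun t => moll ρ (v t)) Φδ := fun x => by
    refine ⟨(hΦδ x).1, (hΦδ x).2.1, ?_⟩
    filter_upwards [(hΦδ x).2.2, hreg] with s h1 h2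
    rwa [← h2]
  have hYc : IsCompressibleFlow T L₂ Φδ := by
    refine hw.isCompressibleFlow hT.le ?_ hv.lintegral_div_ne_top hY
    filter_upwards [hv.weakGradient, hv.div_le] with s h1 h2 x
    exact hρ.ofReal_neg_traceCLM_mollDeriv_le h1 h2 x
  have hdist : ∀ᵐ x ∂torusMeasure d, ‖Φ t x - Φδ t x‖ ≤ (2 * K + 1) * t := by
    filter_upwards [ae_restrict_of_ae hsol] with x hx
    have h1 := norm_sub_le_of_isACSolution_of_isACSolution (y := fun t => Φ t x)
      (z := fun t => Φδ t x) hv.norm_le hw.norm_le hx (hY x) ht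
    beta_reduce at h1
    nlinarith [ht.1]
  have hE : normL1Lp p t (u - regularise η δ u) =
      ∫⁻ s in Ioo 0 t, (∫⁻ x, ‖v s x - moll ρ (v s) x‖ₑ ^ p ∂torusMeasure d) ^ (1 / p) := by
    have hac := (Measure.absolutelyContinuous_of_le (Measure.restrict_mono (μ := volume)
      (Ioo_subset_Ioo (le_refl (0 : ℝ)) ht.2) le_rfl)).ae_le
    refine lintegral_congr_ae ?_
    filter_upwards [hac huvt, hac hreg] with s h1 h2
    rw [eLpNorm_torusMeasure_eq hp, Pi.sub_apply, h2]
    congr 1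
    refine lintegral_congr_ae ?_
    filter_upwards [ae_restrict_of_ae h1] with x hx
    rw [Pi.sub_apply, hx]
  have hfm : AEMeasurable (fun x => Φ t x - Φδ t x) (torusMeasure d) :=
    (hL₁.aemeasurable_torusMeasure ht).sub (hYc.aemeasurable_torusMeasure ht)
  refine ⟨?_, ?_, ?_, fun ht0 r hr hEr => ?_⟩
  · rw [hE]
    calc _ ≤ ∫⁻ s in Ioo 0 t, ENNReal.ofReal (2 * K + 1) := by
          refine lintegral_mono fun s => ?_
          rw [← eLpNorm_torusMeasure_eq hp]
          refine (eLpNorm_le_of_ae_bound (C := 2 * K + 1) (Eventually.of_forall fun x => ?_)).trans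
            (le_of_eq (by simp))
          refine (norm_sub_le _ _).trans ?_
          linarith [hv.norm_le s x, hw.norm_le s x]
      _ = _ := by
          rw [setLIntegral_const, Real.volume_Ioo, sub_zero, ← ENNReal.ofReal_mul (by positivity)]
  · rw [hE, ENNReal.ofReal_mul hδ.le, ENNReal.ofReal_toReal hHt]
    calc _ ≤ ∫⁻ s in Ioo 0 T, (∫⁻ x, ‖v s x - moll ρ (v s) x‖ₑ ^ p ∂torusMeasure d) ^ (1 / p) :=
          lintegral_mono_set (Ioo_subset_Ioo le_rfl ht.2)
      _ ≤ ∫⁻ s in Ioo 0 T, ENNReal.ofReal δ *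
            (∫⁻ x, ‖G s x‖ₑ ^ p ∂torusMeasure d) ^ (1 / p) := by
          refine lintegral_mono_ae ?_
          filter_upwards [hv.weakGradient] with s hs
          have h1 := rpow_lintegral_rpow_le_mul hp0 (hρ.lintegral_sub_moll_rpow_le hs
            (hv.stronglyMeasurable.measurable.of_uncurry_left (x := s))
            (hv.stronglyMeasurable_grad.measurable.of_uncurry_left (x := s)) (hv.norm_le s)
            (hv.periodic s) (hv.periodic_grad s) hp.le)
          rwa [← ENNReal.rpow_mul, mul_one_div_cancel hp0.ne', ENNReal.rpow_one] at h1
      _ = _ := lintegral_const_mul' _ _ ENNReal.ofReal_ne_top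
  · exact (eLpNorm_le_of_ae_bound hdist).trans (le_of_eq (by simp))
  · refine eLpNorm_le_of_log_le hp (by positivity) hr hfm hdist (by positivity) ?_
    refine (hc v G m hv δ ρ hρ Φ Φδ (hL₁.mono (by simp)) (hYc.mono (by simp)) hsol hY t ht r
      hr).trans ?_
    rw [← hE, ENNReal.ofReal_mul (by positivity), ENNReal.ofReal_coe_nnreal,
      ENNReal.ofReal_add zero_le_one (by positivity), ENNReal.ofReal_toReal hHt, ENNReal.ofReal_one]
    refine mul_le_mul_right (add_le_add_left ?_ _) _
    refine (ENNReal.div_le_div_right hEr _).trans ?_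
    exact ENNReal.div_self_le_one

end TorusFlow

/-! ### The three estimates -/

theorem mainTheorem8 (d : ℕ) (T p : ℝ) (hT : 0 < T) (hp : 1 < p)
    (u : ℝ → TorusFlow.Space d → TorusFlow.Space d) (hu : TorusFlow.IsAdmissible T p u)
    (Φ : ℝ → TorusFlow.Space d → TorusFlow.Space d)
    (hΦ : TorusFlow.IsRegularLagrangianFlow T u Φ) :
    ∃ (C : ℝ → ℝ) (A δ₀ : ℝ),
      (∀ t, 0 ≤ C t) ∧ Tendsto C (𝓝[>] 0) (𝓝 0) ∧ 0 < A ∧ 0 < δ₀ ∧ δ₀ < 1 ∧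
      ∀ η : TorusFlow.Space d → ℝ, TorusFlow.IsMollifier η →
      ∀ δ : ℝ, 0 < δ →
      ∀ Φδ : ℝ → TorusFlow.Space d → TorusFlow.Space d,
        TorusFlow.IsClassicalFlow T (TorusFlow.regularise η δ u) Φδ →
      ∀ t ∈ Icc 0 T,
        (TorusFlow.normL1Lp p t (u - TorusFlow.regularise η δ u) ≠ 1 →
          eLpNorm (fun x => Φ t x - Φδ t x) (ENNReal.ofReal p) (TorusFlow.torusMeasure d) ≤
            ENNReal.ofReal (C t *
              |Real.log (TorusFlow.normL1Lp p t (u - TorusFlow.regularise η δ u)).toReal|⁻¹)) ∧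
        (δ < δ₀ →
          TorusFlow.normL1Lp p t (u - TorusFlow.regularise η δ u) < 1 ∧
          |Real.log (TorusFlow.normL1Lp p t (u - TorusFlow.regularise η δ u)).toReal|⁻¹ ≤
            A * |Real.log δ|⁻¹) ∧
        (δ < 1 →
          eLpNorm (fun x => Φ t x - Φδ t x) (ENNReal.ofReal p) (TorusFlow.torusMeasure d) ≤
            ENNReal.ofReal (A * (C t * |Real.log δ|⁻¹))) := by
  obtain ⟨S, B, H, hS, hB, hH, key⟩ := hΦ.exists_eLpNorm_sub_le hT hp hu
  set c : ℝ → ℝ := fun s => s + |s * Real.log s| / Real.log 2 with hc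
  have hlog2 : 0 < Real.log 2 := Real.log_pos one_lt_two
  have hc0 : ∀ s, 0 ≤ s → s ≤ c s := fun s _ => by
    have : 0 ≤ |s * Real.log s| / Real.log 2 := by positivity
    simp only [hc]; linarith
  -- δ < δ₀ means √δ < 1/(H + 2), hence δH < √δ < 1; the 2 makes this quantity less than 1 even when
  -- H = 0.
  set δ₀ : ℝ := (1 / (H + 2)) ^ 2 with hδ₀
  have hHp : 0 < 1 / (H + 2) := by positivity
  have hH1 : 1 / (H + 2) < 1 := by rw [div_lt_one (by linarith)]; linarith
  have hδ0 : 0 < δ₀ := by positivity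
  have hδ1 : δ₀ < 1 := pow_lt_one₀ hHp.le hH1 two_ne_zero
  have hCnn : ∀ t, 0 ≤ (B + 1) * c (S * |t|) := fun t =>
    mul_nonneg (by linarith) ((by positivity : 0 ≤ S * |t|).trans (hc0 _ (by positivity)))
  -- The absolute value keeps C nonnegative for all real t. In A, the 2 comes from |log √δ| = ½|log
  -- δ| in the second claim, and |log δ₀| handles δ₀ ≤ δ < 1 in the third.
  refine ⟨fun t => (B + 1) * c (S * |t|), 2 + |Real.log δ₀|, δ₀, hCnn, ?_, by positivity, hδ0, hδ1,
    fun η hη δ hδ Φδ hΦδ t ht => ?_⟩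
  · have hcont : Continuous fun t : ℝ => (B + 1) * c (S * |t|) := by
      have h1 : Continuous fun t : ℝ => S * |t| := by fun_prop
      have h2 : Continuous fun t : ℝ => S * |t| * Real.log (S * |t|) :=
        Real.continuous_mul_log.comp h1
      exact (h1.add (h2.abs.div_const _)).const_mul _
    have h := hcont.tendsto 0
    simp only [hc, abs_zero, mul_zero, zero_mul, zero_div, add_zero] at h
    exact h.mono_left nhdsWithin_le_nhds
  obtain ⟨h1, h2, h3, h4⟩ := key η hη δ hδ Φδ hΦδ t ht
  set e := TorusFlow.normL1Lp p t (u - TorusFlow.regularise η δ u) with he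
  have het : e ≠ ⊤ := ne_top_of_le_ne_top ENNReal.ofReal_ne_top h1
  have habs : S * |t| = S * t := by rw [abs_of_nonneg ht.1]
  have hSt : 0 ≤ S * t := mul_nonneg hS.le ht.1
  have part1 : e ≠ 1 →
      eLpNorm (fun x => Φ t x - Φδ t x) (ENNReal.ofReal p) (TorusFlow.torusMeasure d) ≤
        ENNReal.ofReal ((B + 1) * c (S * |t|) * |Real.log e.toReal|⁻¹) := by
    intro he1
    rcases ht.1.eq_or_lt with rfl | ht0
    · refine h3.trans ?_
      simp
    have hSt0 : 0 < S * t := by positivity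
    rcases eq_or_ne e 0 with he0 | he0
    -- If E_δ(t) = 0, every r > 0 is admissible; r = S t/(n + 1) sends the bound to 0. The
    -- right-hand side is then 0 too, since `Real.log 0 = 0` and `0⁻¹ = 0`, as the convention
    -- demands.
    · have hlim : Tendsto (fun n : ℕ => ENNReal.ofReal
          ((B + 1) * (S * t / Real.log (1 + ((n : ℝ) + 1))))) atTop (𝓝 0) := by
        have h5 : Tendsto (fun n : ℕ => Real.log (1 + ((n : ℝ) + 1))) atTop atTop :=
          Real.tendsto_log_atTop.comp (tendsto_atTop_add_const_left _ _
            (tendsto_atTop_add_const_right _ _ tendsto_natCast_atTop_atTop))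
        have h6 := ENNReal.tendsto_ofReal ((h5.const_div_atTop (S * t)).const_mul (B + 1))
        simpa using h6
      refine (ge_of_tendsto' hlim fun n => ?_).trans zero_le
      have hn : (0 : ℝ) < n + 1 := by positivity
      have h7 := h4 ht0 (S * t / (n + 1)) (by positivity) (by rw [he0]; exact zero_le)
      rwa [div_div_cancel₀ hSt0.ne'] at h7
    · have hE0 : 0 < e.toReal := ENNReal.toReal_pos he0 het
      refine (h4 ht0 e.toReal hE0 (ENNReal.ofReal_toReal het).ge).trans
        (ENNReal.ofReal_le_ofReal ?_)
      rw [mul_assoc, habs]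
      refine mul_le_mul_of_nonneg_left (TorusFlow.div_log_one_add_le hE0
        (ENNReal.toReal_le_of_le_ofReal hSt h1) fun h => he1 ?_) (by linarith)
      rw [← ENNReal.ofReal_toReal het, h, ENNReal.ofReal_one]
  have part2 : δ < δ₀ → e < 1 ∧
      |Real.log e.toReal|⁻¹ ≤ (2 + |Real.log δ₀|) * |Real.log δ|⁻¹ := by
    intro hδδ
    have hsq : √δ < 1 / (H + 2) := (Real.sqrt_lt' hHp).2 hδδ
    have hsq0 : 0 < √δ := Real.sqrt_pos.2 hδ
    have hE : δ * H < √δ := by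
      rw [lt_div_iff₀ (by linarith)] at hsq
      have h5 : √δ * √δ = δ := Real.mul_self_sqrt hδ.le
      nlinarith
    have he2 : e.toReal < √δ := (ENNReal.toReal_le_of_le_ofReal (by positivity) h2).trans_lt hE
    refine ⟨?_, ?_⟩
    · rw [← ENNReal.ofReal_toReal het, ENNReal.ofReal_lt_one]
      linarith
    rcases (ENNReal.toReal_nonneg (a := e)).eq_or_lt with h0 | h0
    · rw [← h0, Real.log_zero, abs_zero, inv_zero]
      positivity
    have hlogδ : Real.log δ < 0 := Real.log_neg hδ (hδδ.trans hδ1)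
    -- E_δ(t) < √δ < 1, so both logarithms are negative and |log E_δ(t)| ≥ ½ |log δ|.
    have hle : 2⁻¹ * |Real.log δ| ≤ |Real.log e.toReal| := by
      have h6 : Real.log e.toReal ≤ Real.log √δ := Real.log_le_log h0 he2.le
      rw [Real.log_sqrt hδ.le] at h6
      rw [abs_of_neg hlogδ, abs_of_neg (by linarith)]
      linarith
    calc |Real.log e.toReal|⁻¹ ≤ (2⁻¹ * |Real.log δ|)⁻¹ :=
          inv_anti₀ (mul_pos (by norm_num) (abs_pos.2 hlogδ.ne)) hle
      _ = 2 * |Real.log δ|⁻¹ := by rw [mul_inv, inv_inv]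
      _ ≤ _ := by gcongr; linarith [abs_nonneg (Real.log δ₀)]
  refine ⟨part1, part2, fun hδlt => ?_⟩
  rcases lt_or_ge δ δ₀ with hδδ | hδδ
  · obtain ⟨h5, h6⟩ := part2 hδδ
    refine (part1 h5.ne).trans (ENNReal.ofReal_le_ofReal ?_)
    calc _ ≤ (B + 1) * c (S * |t|) * ((2 + |Real.log δ₀|) * |Real.log δ|⁻¹) :=
          mul_le_mul_of_nonneg_left h6 (hCnn t)
      _ = _ := by ring
  -- For δ₀ ≤ δ < 1, E_δ(t) may equal 1 and the first claim is unavailable; the trivial bound S t ≤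
  -- C_t suffices, as A ≥ |log δ|.
  · refine h3.trans (ENNReal.ofReal_le_ofReal ?_)
    have hlogδ : Real.log δ < 0 := Real.log_neg hδ hδlt
    have h5 : |Real.log δ| ≤ 2 + |Real.log δ₀| := by
      have h6 := Real.log_le_log hδ0 hδδ
      rw [abs_of_neg hlogδ, abs_of_neg (by linarith)]
      linarith
    have h7 : 1 ≤ (2 + |Real.log δ₀|) * |Real.log δ|⁻¹ := by
      rwa [← div_eq_mul_inv, one_le_div (abs_pos.2 hlogδ.ne)]
    have h8 : S * t ≤ (B + 1) * c (S * |t|) := by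
      rw [habs]
      nlinarith [hc0 (S * t) hSt]
    calc S * t ≤ (B + 1) * c (S * |t|) := h8
      _ ≤ (B + 1) * c (S * |t|) * ((2 + |Real.log δ₀|) * |Real.log δ|⁻¹) :=
          le_mul_of_one_le_right (hCnn t) h7
      _ = _ := by ring
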